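/- Let $\mathbb H_1=\mathbb R^3$ with the group law $(a,b,c)(a',b',c')=(a+a',b+b',c+c'+ab')$, let $\Gamma=\mathbb Z^3\subset\mathbb H_1$, and let $M=\Gamma\backslash\mathbb H_1$ be the standard Heisenberg nilmanifold, with the measure of total mass $1$ given by $da\,db\,dc$ on the fundamental domain $[0,1)^3$. Let $\mathcal L_M=-(A_M^2+B_M^2)$ be the canonical sub-Laplacian on $L^2(M)$, that is, the self-adjoint extension of this operator from $C^\infty(M)$, where $A_M,B_M$ are the vector fields on $M$ induced by the left-invariant fields $\partial_a$ and $\partial_b+a\partial_c$. For $\mu\ge 0$ let $\Pi_\mu$ be the spectral projector of $\sqrt{\mathcal L_M}$ at $\mu$, that is, the orthogonal projection of $L^2(M)$ onto the $\mu^2$-eigenspace of $\mathcal L_M$. For $\lambda\in\mathbb Z$ let $\mathrm{Pr}_\lambda$ be the orthogonal projection of $L^2(M)$ onto $\{f\in L^2(M): f(\Gamma(a,b,c))=f(\Gamma(a,b,0))e^{2\pi i\lambda c}\}$. For $\ell\in\mathbb N_0$ let $\mathcal L_\ell(v)=e^{-v/2}\sum_{k=0}^{\ell}(-1)^k\binom{\ell}{\ell-k}\frac{v^k}{k!}$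 be the Laguerre function of type $0$ and degree $\ell$. For every $\epsilon\in(0,1)$ there is a constant $C_\epsilon>0$, depending only on $\epsilon$, such that the following holds for all $\lambda\in\mathbb Z\setminus\{0\}$ and all $\mu\ge 0$ with $\Pi_\mu\mathrm{Pr}_\lambda\ne 0$. There is $\ell\in\mathbb N_0$ with $\mu^2=2\pi|\lambda|(2\ell+1)$, the series $\sum_{a,b\in\mathbb Z}\big|\mathcal L_\ell\big(\pi\tfrac{a^2+b^2}{|\lambda|}\big)\big|^2$ converges, and for every $f\in L^2(M)$ $$\|\Pi_\mu\mathrm{Pr}_\lambda f\|_{L^4(M)}\le \|\Pi_\mu\mathrm{Pr}_\lambda f\|_{L^2(M)}\bigg(\sum_{a,b\in\mathbb Z}\Big|\mathcal L_\ell\Big(\pi\frac{a^2+b^2}{|\lambda|}\Big)\Big|^2\bigg)^{1/4}\le C_\epsilon\,\mu^{(1+\epsilon)/2}\,\|\Pi_\mu\mathrm{Pr}_\lambda f\|_{L^2(M)}.$$ -/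

import Mathlib

open MeasureTheory
open scoped ENNReal ContDiff

/-! ## The Heisenberg group and its standard nilmanifold -/

/-- The three-dimensional Heisenberg group: the triple `(a, b, c)` stands for the upper triangular
unipotent real matrix with rows `(1, a, c)`, `(0, 1, b)`, `(0, 0, 1)`. -/
@[ext]
structure Heis where
  a : ℝ
  b : ℝ
  c : ℝ

namespace Heis

/-- The product `(a, b, c)(a', b', c') = (a + a', b + b', c + c' + a b')` (matrix product). -/
instance : Mul Heis := ⟨fun x y => ⟨x.a + y.a, x.b + y.b, x.c + y.c + x.a * y.b⟩⟩

instance : One Heis := ⟨⟨0, 0, 0⟩⟩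

instance : Inv Heis := ⟨fun x => ⟨-x.a, -x.b, -x.c + x.a * x.b⟩⟩

@[simp] theorem mul_a (x y : Heis) : (x * y).a = x.a + y.a := rfl
@[simp] theorem mul_b (x y : Heis) : (x * y).b = x.b + y.b := rfl
@[simp] theorem mul_c (x y : Heis) : (x * y).c = x.c + y.c + x.a * y.b := rfl
@[simp] theorem one_a : (1 : Heis).a = 0 := rfl
@[simp] theorem one_b : (1 : Heis).b = 0 := rfl
@[simp] theorem one_c : (1 : Heis).c = 0 := rfl
@[simp] theorem inv_a (x : Heis) : (x⁻¹).a = -x.a := rfl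
@[simp] theorem inv_b (x : Heis) : (x⁻¹).b = -x.b := rfl
@[simp] theorem inv_c (x : Heis) : (x⁻¹).c = -x.c + x.a * x.b := rfl

instance : Group Heis :=
  Group.ofLeftAxioms
    (fun x y z => by ext <;> simp <;> ring)
    (fun x => by ext <;> simp)
    (fun x => by ext <;> simp)

/-- The Borel sets of `ℝ³`. -/
instance : MeasurableSpace Heis :=
  MeasurableSpace.comap (fun x : Heis => (x.a, x.b, x.c)) inferInstance

theorem measurable_mk : Measurable (fun p : ℝ × ℝ × ℝ => (⟨p.1, p.2.1, p.2.2⟩ : Heis)) := by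
  rintro s ⟨t, ht, rfl⟩
  exact ht

/-- The discrete subgroup `Γ` of the elements with integer entries. -/
def Γ : Subgroup Heis where
  carrier := {x | (∃ k : ℤ, x.a = k) ∧ (∃ k : ℤ, x.b = k) ∧ ∃ k : ℤ, x.c = k}
  mul_mem' := by
    rintro x y ⟨⟨i, hi⟩, ⟨j, hj⟩, ⟨k, hk⟩⟩ ⟨⟨i', hi'⟩, ⟨j', hj'⟩, ⟨k', hk'⟩⟩
    exact ⟨⟨i + i', by simp [hi, hi']⟩, ⟨j + j', by simp [hj, hj']⟩,
      ⟨k + k' + i * j', by simp [hi, hk, hk', hj']⟩⟩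
  one_mem' := ⟨⟨0, by simp⟩, ⟨0, by simp⟩, ⟨0, by simp⟩⟩
  inv_mem' := by
    rintro x ⟨⟨i, hi⟩, ⟨j, hj⟩, ⟨k, hk⟩⟩
    exact ⟨⟨-i, by simp [hi]⟩, ⟨-j, by simp [hj]⟩, ⟨-k + i * j, by simp [hi, hj, hk]⟩⟩

/-- The nilmanifold `M = Γ \ ℍ₁` of the classes `Γ x` (orbits of left multiplication by `Γ`),
with the quotient `σ`-algebra. -/
abbrev M : Type := MulAction.orbitRel.Quotient Γ Heis

/-- The class `Γ (a, b, c)`. -/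
def cls (a b c : ℝ) : M := Quotient.mk (MulAction.orbitRel Γ Heis) (⟨a, b, c⟩ : Heis)

theorem measurable_cls : Measurable (fun p : ℝ × ℝ × ℝ => cls p.1 p.2.1 p.2.2) :=
  measurable_quotient_mk''.comp measurable_mk

/-- The map `Γ x ↦ Γ x g` of `M`, for `g` in the Heisenberg group. -/
def rightTranslate (g : Heis) : M → M :=
  Quotient.map (fun x => x * g) (by
    rintro x y ⟨γ, h⟩
    exact ⟨γ, by rw [← h]; exact (mul_assoc (γ : Heis) y g).symm⟩)

/-- The measure of `M`: the one that is `da db dc` on the fundamental domain `[0,1)³`. -/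
noncomputable def vol : Measure M :=
  Measure.map (fun p : ℝ × ℝ × ℝ => cls p.1 p.2.1 p.2.2)
    (volume.restrict (Set.Ico 0 1 ×ˢ Set.Ico 0 1 ×ˢ Set.Ico 0 1))

/-- The Hilbert space `L²(M)` of complex functions. -/
noncomputable abbrev L2 : Type := Lp ℂ 2 vol

/-! ## The sub-Laplacian and its spectral projectors -/

/-- `φ ∈ C^∞(M)`: the associated left `Γ`-invariant function on `ℝ³` is smooth. -/
def IsSmooth (φ : M → ℂ) : Prop :=
  ContDiff ℝ ∞ (fun p : ℝ × ℝ × ℝ => φ (cls p.1 p.2.1 p.2.2))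

/-- The vector field `A_M` on `M` induced by `A = ∂_a`, that is
`A_M φ (ẋ) = d/dt φ (ẋ exp (t A))` at `t = 0`, where `exp (t A) = (t, 0, 0)`. -/
noncomputable def fieldA (φ : M → ℂ) (x : M) : ℂ :=
  deriv (fun t : ℝ => φ (rightTranslate ⟨t, 0, 0⟩ x)) 0

/-- The vector field `B_M` on `M` induced by `B = ∂_b + a ∂_c`, where `exp (t B) = (0, t, 0)`. -/
noncomputable def fieldB (φ : M → ℂ) (x : M) : ℂ :=
  deriv (fun t : ℝ => φ (rightTranslate ⟨0, t, 0⟩ x)) 0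

/-- The sub-Laplacian `𝓛_M = - (A_M² + B_M²)` on functions (used for smooth ones). -/
noncomputable def subLaplacian (φ : M → ℂ) (x : M) : ℂ :=
  -(fieldA (fieldA φ) x + fieldB (fieldB φ) x)

/-- The graph, in `L²(M) × L²(M)`, of the operator `𝓛_M` with domain `C^∞(M)`. -/
def subLaplacianGraph : Set (L2 × L2) :=
  {p | ∃ φ : M → ℂ, IsSmooth φ ∧ p.1 =ᵐ[vol] φ ∧ p.2 =ᵐ[vol] subLaplacian φ}

/-- The eigenspace, for the real number `e`, of the self-adjoint operator `𝓛_M` on `L²(M)`.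
As `𝓛_M` is essentially self-adjoint on `C^∞(M)`, its self-adjoint extension is the adjoint of
`𝓛_M` on `C^∞(M)`: `f` belongs to its domain and is mapped to `e f` if and only if
`(𝓛_M φ, f) = (φ, e f)` for all `φ ∈ C^∞(M)`. -/
noncomputable def eigenspace (e : ℝ) : Submodule ℂ L2 where
  carrier := {f | ∀ p ∈ subLaplacianGraph, inner ℂ p.2 f = inner ℂ p.1 ((e : ℂ) • f)}
  add_mem' := by
    intro f g hf hg p hp
    rw [smul_add, inner_add_right, inner_add_right, hf p hp, hg p hp]
  zero_mem' := by
    intro p _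
    simp
  smul_mem' := by
    intro z f hf p hp
    rw [smul_comm, inner_smul_right, inner_smul_right, hf p hp]

theorem isClosed_eigenspace (e : ℝ) : IsClosed (eigenspace e : Set L2) := by
  have h : (eigenspace e : Set L2) =
      ⋂ p ∈ subLaplacianGraph, {f : L2 | inner ℂ p.2 f = inner ℂ p.1 ((e : ℂ) • f)} := by
    ext f
    simp [eigenspace]
  rw [h]
  exact isClosed_biInter fun p _ => isClosed_eq (by fun_prop) (by fun_prop)

instance (e : ℝ) : CompleteSpace (eigenspace e) := (isClosed_eigenspace e).completeSpace_coe

/-- The spectral projector `Π_m` of `√𝓛_M` at `m ≥ 0`: the orthogonal projection of `L²(M)` onto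
the `m`-eigenspace of `√𝓛_M`, which is the `m²`-eigenspace of `𝓛_M`. It is zero when `m` is not in
the spectrum. -/
noncomputable def specProj (m : ℝ) : L2 →L[ℂ] L2 := (eigenspace (m ^ 2)).starProjection

/-! ## The Fourier decomposition in the central variable -/

/-- The space `L²_n(M)`, `n ∈ ℤ`, of the `f ∈ L²(M)` such that
`f (Γ (a, b, c)) = f (Γ (a, b, 0)) e^{2 π i n c}`
(after a modification of `f` on a set of measure zero). -/
noncomputable def fourierSpace (n : ℤ) : Submodule ℂ L2 where
  carrier := {f | ∃ φ : M → ℂ, f =ᵐ[vol] φ ∧ ∀ a b c : ℝ,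
    φ (cls a b c) = φ (cls a b 0) * Complex.exp (2 * Real.pi * Complex.I * n * c)}
  add_mem' := by
    rintro f g ⟨φ, hf, hφ⟩ ⟨ψ, hg, hψ⟩
    refine ⟨φ + ψ, (Lp.coeFn_add f g).trans (hf.add hg), fun a b c => ?_⟩
    rw [Pi.add_apply, Pi.add_apply, hφ, hψ, add_mul]
  zero_mem' := ⟨0, Lp.coeFn_zero _ _ _, by simp⟩
  smul_mem' := by
    rintro z f ⟨φ, hf, hφ⟩
    refine ⟨z • φ, (Lp.coeFn_smul z f).trans (hf.const_smul z), fun a b c => ?_⟩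
    rw [Pi.smul_apply, Pi.smul_apply, hφ, smul_mul_assoc]

theorem isClosed_fourierSpace (n : ℤ) : IsClosed (fourierSpace n : Set L2) := by
  classical
  rw [← isSeqClosed_iff_isClosed]
  intro u f hu huf
  choose φ hφ hφ' using hu
  obtain ⟨ns, -, hns⟩ :=
    (tendstoInMeasure_of_tendsto_Lp huf).exists_seq_tendsto_ae
  let ψ : M → ℂ := fun x =>
    if h : ∃ l, Filter.Tendsto (fun k => φ (ns k) x) Filter.atTop (nhds l) then h.choose else 0
  have key : ∀ x l, Filter.Tendsto (fun k => φ (ns k) x) Filter.atTop (nhds l) → ψ x = l := by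
    intro x l hl
    have h : ∃ l, Filter.Tendsto (fun k => φ (ns k) x) Filter.atTop (nhds l) := ⟨l, hl⟩
    simp only [ψ, dif_pos h]
    exact tendsto_nhds_unique h.choose_spec hl
  refine ⟨ψ, ?_, fun a b c => ?_⟩
  · filter_upwards [hns, ae_all_iff.2 hφ] with x hx hx'
    exact (key x _ (by simpa only [hx'] using hx)).symm
  · set w := Complex.exp (2 * Real.pi * Complex.I * n * c) with hw
    have hw0 : w ≠ 0 := Complex.exp_ne_zero _
    by_cases h : ∃ l, Filter.Tendsto (fun k => φ (ns k) (cls a b 0)) Filter.atTop (nhds l)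
    · obtain ⟨l, hl⟩ := h
      rw [key _ l hl]
      refine key _ _ ?_
      simp only [hφ' _ a b c]
      exact hl.mul_const w
    · have h2 : ¬ ∃ l, Filter.Tendsto (fun k => φ (ns k) (cls a b c)) Filter.atTop (nhds l) := by
        rintro ⟨l, hl⟩
        refine h ⟨l * w⁻¹, ?_⟩
        have := hl.mul_const w⁻¹
        simp only [hφ' _ a b c, ← hw] at this
        simpa only [mul_assoc, mul_inv_cancel₀ hw0, mul_one] using this
      simp only [ψ, dif_neg h, dif_neg h2, zero_mul]

instance (n : ℤ) : CompleteSpace (fourierSpace n) := (isClosed_fourierSpace n).completeSpace_coe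

/-- The orthogonal projection `Pr_n` of `L²(M)` onto `L²_n(M)`. -/
noncomputable def fourierProj (n : ℤ) : L2 →L[ℂ] L2 := (fourierSpace n).starProjection

/-! ## Laguerre functions -/

/-- The Laguerre function of type `0` and degree `ℓ`: `𝓛_ℓ(v) = L_ℓ(v) e^{-v/2}`, where
`L_ℓ(v) = ∑_{k ≤ ℓ} (-1)^k (ℓ choose ℓ - k) v^k / k!` is the Laguerre polynomial. -/
noncomputable def laguerre (ℓ : ℕ) (v : ℝ) : ℝ :=
  (∑ k ∈ Finset.range (ℓ + 1), (-1) ^ k * (ℓ.choose (ℓ - k) : ℝ) * (v ^ k / (k.factorial : ℝ))) *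
    Real.exp (-v / 2)

/-- The term `|𝓛_ℓ(π (a² + b²) / |n|)|²` at `p = (a, b) ∈ ℤ²`. -/
noncomputable def laguerreTerm (ℓ : ℕ) (n : ℤ) (p : ℤ × ℤ) : ℝ :=
  |laguerre ℓ (Real.pi * (((p.1 : ℝ) ^ 2 + (p.2 : ℝ) ^ 2) / |(n : ℝ)|))| ^ 2

end Heis

/-! Right translation by the centre commutes with the sub-Laplacian, so F = Π_μ Pr_n f is at once an
eigenfunction and a function of central frequency n. It is determined by the profile g(a, b) =
F(Γ(a, b, 0)), for which g(a + 1, b) = e^{-2πinb} g(a, b). The Fourier coefficients G_m of g in b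
therefore satisfy G_{m+n}(a) = G_m(a + 1): the |n| functions G_r, with r running over the residues,
now viewed on the whole line, carry all of F, and ‖F‖² is the sum of the ‖G_r‖²
(`Profile.sum_integral_partialCoeff`).

Pairing the eigenvalue equation with theta-like test functions gives −G_j'' + 4π²(nx + j)² G_j = μ²
G_j weakly on the line (`integral_oscillator_mul_partialCoeff`). Square integrable weak solutions of
the oscillator equation are multiples of Hermite functions (`ae_eq_hermFun_of_weak_eigenfunction`).
Hence μ² = 2π|n|(2ℓ + 1), and G_j(x) = c_j h_ℓ(κx + κj/n) with κ² = 4π|n| and one ℓ for all j.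

For the L⁴ norm, |g|² is doubly periodic and its (r, s) Fourier coefficient unfolds to ∑_ρ ∫
e^{-2πisx} G_ρ(x) conj G_{ρ−r}(x) dx (`Profile.fcoeff_sqCoeff`). Each integral is an ambiguity
function of h_ℓ, that is, a Laguerre function at π(r² + s²)/|n| (`integral_hermFun_mul_hermFun`).
The coefficient is thus at most that Laguerre value times ‖F‖², and Parseval in both variables gives
the first inequality (`Profile.lintegral_enorm_pow_four_le`).

For the lattice sum, the bound |𝓛_ℓ| ≤ 1 and a crude exponential bound interpolate to e^{−cv/(ℓ+1)},
so the sum is O(|n|(ℓ + 1)) = O(μ²) (`summable_laguerreTerm_and_tsum_le`). Its fourth root is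
O(μ^{1/2}), and μ ≥ 1, so a single constant serves every ε. -/

namespace Heis

open Polynomial

/-! ## Hermite polynomials and the Gaussian functional -/

/-- The probabilists' Hermite polynomial over a commutative ring. -/
noncomputable def herm (R : Type*) [CommRing R] (k : ℕ) : R[X] :=
  (hermite k).map (Int.castRingHom R)

theorem herm_zero (R : Type*) [CommRing R] : herm R 0 = 1 := by
  simp [herm]

theorem herm_succ (R : Type*) [CommRing R] (k : ℕ) :
    herm R (k + 1) = X * herm R k - derivative (herm R k) := by
  simp [herm, derivative_map]

theorem natDegree_herm (R : Type*) [CommRing R] [Nontrivial R] (k : ℕ) :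
    (herm R k).natDegree = k := by
  rw [herm, (hermite_monic k).natDegree_map, natDegree_hermite]

theorem monic_herm (R : Type*) [CommRing R] (k : ℕ) : (herm R k).Monic :=
  (hermite_monic k).map _

theorem derivative_herm_succ (R : Type*) [CommRing R] (k : ℕ) :
    derivative (herm R (k + 1)) = ((k : R[X]) + 1) * herm R k := by
  induction k with
  | zero => simp [herm_succ, herm_zero]
  | succ k ih =>
    rw [herm_succ R (k + 1), derivative_sub, derivative_mul, derivative_X, ih, derivative_mul,
      herm_succ R k]
    simp
    ring

/-- The Hermite equation. -/
theorem herm_ode (R : Type*) [CommRing R] (k : ℕ) :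
    derivative (derivative (herm R k)) = X * derivative (herm R k) - (k : R[X]) * herm R k := by
  have h1 := derivative_herm_succ R k
  rw [herm_succ, derivative_sub, derivative_mul, derivative_X] at h1
  linear_combination -h1

theorem herm_eval_ofReal (k : ℕ) (y : ℝ) :
    (herm ℂ k).eval (y : ℂ) = (((herm ℝ k).eval y : ℝ) : ℂ) := by
  have : herm ℂ k = (herm ℝ k).map Complex.ofRealHom := by
    rw [herm, herm, Polynomial.map_map]
    congr 1
  rw [this, ← Complex.ofRealHom_eq_coe, Polynomial.eval_map_apply]
  rfl

theorem iterate_derivative_herm_self (k : ℕ) :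
    derivative^[k] (herm ℂ k) = C ((k.factorial : ℕ) : ℂ) := by
  induction k with
  | zero => simp [herm_zero]
  | succ k ih =>
    rw [Function.iterate_succ_apply, derivative_herm_succ]
    have : ((k : ℂ[X]) + 1) * herm ℂ k = ((k + 1 : ℕ) : ℂ) • herm ℂ k := by
      rw [smul_eq_C_mul]; simp
    rw [this, iterate_derivative_smul, ih, smul_C, Nat.factorial_succ]
    simp

theorem integrable_eval_mul_gaussian (Q : ℂ[X]) {b : ℝ} (hb : 0 < b) :
    Integrable fun y : ℝ => Q.eval (y : ℂ) * (Real.exp (-b * y ^ 2) : ℂ) := by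
  induction Q using Polynomial.induction_on' with
  | add p q hp hq =>
    simp only [eval_add, add_mul]
    exact hp.add hq
  | monomial n a =>
    have h := integrable_rpow_mul_exp_neg_mul_sq hb (s := n)
      (by have : (0 : ℝ) ≤ n := n.cast_nonneg
          linarith)
    have := (h.ofReal (𝕜 := ℂ)).const_mul a
    refine this.congr (Filter.Eventually.of_forall fun y => ?_)
    simp [eval_monomial, mul_assoc]

theorem integrable_eval_mul_cexp (Q : ℂ[X]) (q : ℝ) :
    Integrable fun y : ℝ => Q.eval (y : ℂ) * Complex.exp (-(y : ℂ) ^ 2 / 2 + Complex.I * q * y) := by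
  have h := integrable_eval_mul_gaussian Q (b := 1 / 2) (by norm_num)
  refine (h.bdd_mul (c := 1) (f := fun y : ℝ => Complex.exp (Complex.I * q * y)) ?_ ?_).congr ?_
  · exact (by fun_prop : Continuous fun y : ℝ => Complex.exp (Complex.I * q * y)).aestronglyMeasurable
  · refine Filter.Eventually.of_forall fun y => ?_
    rw [Complex.norm_exp]
    simp
  · refine Filter.Eventually.of_forall fun y => ?_
    simp only [Complex.exp_add, Complex.ofReal_exp]
    push_cast
    rw [show (-(1 / 2) * (y : ℂ) ^ 2) = -(y : ℂ) ^ 2 / 2 by ring]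
    ring

/-- The functional `Q ↦ ∫ Q(y) e^{-y²/2 + iqy} dy` on polynomials. -/
noncomputable def gaussFun (q : ℝ) : ℂ[X] →ₗ[ℂ] ℂ where
  toFun Q := ∫ y : ℝ, Q.eval (y : ℂ) * Complex.exp (-(y : ℂ) ^ 2 / 2 + Complex.I * q * y)
  map_add' P Q := by
    simp only [eval_add, add_mul]
    exact integral_add (integrable_eval_mul_cexp P q) (integrable_eval_mul_cexp Q q)
  map_smul' c Q := by
    simp only [eval_smul, smul_eq_mul, mul_assoc, RingHom.id_apply]
    exact integral_const_mul _ _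

theorem gaussFun_apply (q : ℝ) (Q : ℂ[X]) : gaussFun q Q =
    ∫ y : ℝ, Q.eval (y : ℂ) * Complex.exp (-(y : ℂ) ^ 2 / 2 + Complex.I * q * y) := rfl

/-- Integration by parts: the derivative of Q(y) e^{−y²/2 + iqy} has integral zero. -/
theorem gaussFun_X_mul (q : ℝ) (Q : ℂ[X]) :
    gaussFun q (X * Q) = gaussFun q (derivative Q) + Complex.I * q * gaussFun q Q := by
  have key : gaussFun q (derivative Q + (-(X : ℂ[X]) + C (Complex.I * q)) * Q) = 0 := by
    rw [gaussFun_apply]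
    refine integral_eq_zero_of_hasDerivAt_of_integrable (f := fun y : ℝ =>
      Q.eval (y : ℂ) * Complex.exp (-(y : ℂ) ^ 2 / 2 + Complex.I * q * y)) (fun y => ?_)
      (integrable_eval_mul_cexp _ q) (integrable_eval_mul_cexp _ q)
    have h1 : HasDerivAt (fun z : ℂ =>
        Q.eval z * Complex.exp (-z ^ 2 / 2 + Complex.I * q * z))
        ((derivative Q + (-(X : ℂ[X]) + C (Complex.I * q)) * Q).eval (y : ℂ) *
          Complex.exp (-(y : ℂ) ^ 2 / 2 + Complex.I * q * y)) y := by
      have h2 : HasDerivAt (fun z : ℂ => -z ^ 2 / 2 + Complex.I * q * z)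
          (-(y : ℂ) + Complex.I * q) y := by
        have := (((hasDerivAt_id (y : ℂ)).pow 2).neg.div_const 2).add
          ((hasDerivAt_id (y : ℂ)).const_mul (Complex.I * q))
        refine this.congr_deriv ?_
        simp
        ring
      refine ((Q.hasDerivAt (y : ℂ)).mul h2.cexp).congr_deriv ?_
      simp
      ring
    exact h1.comp_ofReal
  have e : derivative Q + (-(X : ℂ[X]) + C (Complex.I * q)) * Q =
      derivative Q - X * Q + (Complex.I * q) • Q := by
    rw [smul_eq_C_mul]; ring
  rw [e, map_add, map_sub, map_smul, smul_eq_mul] at key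
  linear_combination -key

theorem gaussFun_zero_X_mul (Q : ℂ[X]) : gaussFun 0 (X * Q) = gaussFun 0 (derivative Q) := by
  simpa using gaussFun_X_mul 0 Q

theorem gaussFun_one (q : ℝ) :
    gaussFun q 1 = (Real.sqrt (2 * Real.pi) * Real.exp (-q ^ 2 / 2) : ℝ) := by
  have h := fourierIntegral_gaussian (b := 1 / 2) (by norm_num) (q : ℂ)
  rw [gaussFun_apply]
  have e : ∀ y : ℝ, (1 : ℂ[X]).eval (y : ℂ) *
      Complex.exp (-(y : ℂ) ^ 2 / 2 + Complex.I * q * y) =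
      Complex.exp (Complex.I * q * y) * Complex.exp (-(1 / 2) * (y : ℂ) ^ 2) := by
    intro y
    rw [← Complex.exp_add, eval_one, one_mul]
    congr 1
    ring
  simp_rw [e]
  rw [h]
  push_cast
  congr 1
  · rw [Real.sqrt_eq_rpow, Complex.ofReal_cpow (by positivity)]
    push_cast
    congr 1
    ring
  · congr 1
    ring

/-- Shifting the contour in a Gaussian integral. -/
theorem gaussFun_eq_comp (q : ℝ) (Q : ℂ[X]) :
    gaussFun q Q =
      (Real.exp (-q ^ 2 / 2) : ℂ) * gaussFun 0 (Q.comp (X + C (Complex.I * q))) := by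
  have mono : ∀ n : ℕ, gaussFun q (X ^ n) =
      (Real.exp (-q ^ 2 / 2) : ℂ) * gaussFun 0 ((X ^ n : ℂ[X]).comp (X + C (Complex.I * q))) := by
    intro n
    -- Both sides obey the recursion of `gaussFun_X_mul`. It relates the power n + 1 to the power n
    -- and to its derivative, of degree n − 1, so two earlier cases are needed.
    induction n using Nat.strong_induction_on with
    | _ n ih =>
      rcases n with _ | n
      · simp [gaussFun_one]
        ring
      · have e : gaussFun 0 ((X ^ (n + 1) : ℂ[X]).comp (X + C (Complex.I * q))) =
            gaussFun 0 ((derivative (X ^ n : ℂ[X])).comp (X + C (Complex.I * q))) +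
            Complex.I * q * gaussFun 0 ((X ^ n : ℂ[X]).comp (X + C (Complex.I * q))) := by
          rw [pow_succ', mul_comp, X_comp, add_mul, map_add, gaussFun_zero_X_mul,
            derivative_comp, ← smul_eq_C_mul, map_smul, smul_eq_mul]
          simp
        rw [e, pow_succ', gaussFun_X_mul, ih n (by omega), mul_add]
        have e2 : gaussFun q (derivative (X ^ n : ℂ[X])) = (Real.exp (-q ^ 2 / 2) : ℂ) *
            gaussFun 0 ((derivative (X ^ n : ℂ[X])).comp (X + C (Complex.I * q))) := by
          rcases n with _ | n
          · simp
          · rw [derivative_X_pow, ← smul_eq_C_mul, map_smul, Nat.add_sub_cancel,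
              ih n (by omega), smul_comp, map_smul]
            simp only [smul_eq_mul]
            ring
        rw [e2]
        ring
  induction Q using Polynomial.induction_on' with
  | add P Q hP hQ => rw [map_add, hP, hQ, add_comp, map_add, mul_add]
  | monomial n a =>
    rw [← smul_X_eq_monomial, map_smul, mono, smul_comp, map_smul]
    simp only [smul_eq_mul]
    ring

/-- For the Gaussian functional the raising operator X − d/dx is the transpose of d/dx, and `herm`
is built by iterating it. -/
theorem gaussFun_herm_mul (j : ℕ) (Q : ℂ[X]) :
    gaussFun 0 (herm ℂ j * Q) = gaussFun 0 (derivative^[j] Q) := by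
  induction j generalizing Q with
  | zero => simp [herm_zero]
  | succ j ih =>
    rw [herm_succ, sub_mul, map_sub, mul_assoc, gaussFun_zero_X_mul, derivative_mul, map_add,
      add_sub_cancel_left, ih, Function.iterate_succ_apply]

/-- Moving the derivatives onto the factor of lower degree kills it; in equal degrees they leave the
constant k!. -/
theorem gaussFun_herm_mul_herm (j k : ℕ) :
    gaussFun 0 (herm ℂ j * herm ℂ k) =
      if j = k then ((Real.sqrt (2 * Real.pi) * (k.factorial : ℝ) : ℝ) : ℂ) else 0 := by
  have lt : ∀ {j k : ℕ}, j < k → gaussFun 0 (herm ℂ k * herm ℂ j) = 0 := by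
    intro j k h
    rw [gaussFun_herm_mul, iterate_derivative_eq_zero (by rwa [natDegree_herm]), map_zero]
  rcases lt_trichotomy j k with h | h | h
  · rw [if_neg h.ne, mul_comm, lt h]
  · subst h
    rw [if_pos rfl, gaussFun_herm_mul, iterate_derivative_herm_self, C_eq_algebraMap,
      Algebra.algebraMap_eq_smul_one, map_smul, gaussFun_one]
    simp
    ring
  · rw [if_neg h.ne', lt h]

/-- The Appell property of the Hermite polynomials. -/
theorem herm_comp_X_add (k : ℕ) (a : ℂ) :
    (herm ℂ k).comp (X + C a) =
      ∑ m ∈ Finset.range (k + 1), (a ^ m * (k.choose m : ℂ)) • herm ℂ (k - m) := by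
  -- The raising operator T generates the Hermite polynomials from 1. Translation of the variable by
  -- a conjugates T into a + T, and since scalars commute with T the binomial theorem expands (a +
  -- T)^k.
  let T : Module.End ℂ ℂ[X] := LinearMap.mulLeft ℂ X - derivative
  have hT : ∀ k, (T ^ k) 1 = herm ℂ k := by
    intro k
    induction k with
    | zero => simp [herm_zero]
    | succ k ih => rw [pow_succ', Module.End.mul_apply, ih, herm_succ]; simp [T]
  have h1 : ∀ k, ((a • (1 : Module.End ℂ ℂ[X]) + T) ^ k) 1 = (herm ℂ k).comp (X + C a) := by
    intro k
    induction k with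
    | zero => simp [herm_zero]
    | succ k ih =>
      rw [pow_succ', Module.End.mul_apply, ih, herm_succ, sub_comp, mul_comp]
      simp [T, derivative_comp, smul_eq_C_mul]
      ring
  have hc : Commute (a • (1 : Module.End ℂ ℂ[X])) T :=
    (Commute.one_left T).smul_left a
  rw [← h1, hc.add_pow, LinearMap.sum_apply]
  refine Finset.sum_congr rfl fun m _ => ?_
  rw [_root_.smul_pow, one_pow, smul_mul_assoc, one_mul, ← nsmul_eq_mul', LinearMap.smul_apply,
    LinearMap.smul_apply, hT, mul_smul, smul_comm, Nat.cast_smul_eq_nsmul]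

/-- Orthogonality leaves only the diagonal of the double Appell expansion. The remaining sum is the
Laguerre polynomial at −ab. -/
theorem gaussFun_herm_shift (k : ℕ) (a b : ℂ) :
    gaussFun 0 ((herm ℂ k).comp (X + C a) * (herm ℂ k).comp (X + C b)) =
      (Real.sqrt (2 * Real.pi) * (k.factorial : ℝ) : ℝ) *
        ∑ m ∈ Finset.range (k + 1), (k.choose m : ℂ) * ((a * b) ^ m / (m.factorial : ℂ)) := by
  rw [herm_comp_X_add, herm_comp_X_add, Finset.sum_mul_sum, map_sum, Finset.mul_sum]
  refine Finset.sum_congr rfl fun m hm => ?_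
  rw [map_sum, Finset.sum_eq_single m]
  · rw [smul_mul_smul_comm, map_smul, gaussFun_herm_mul_herm, if_pos rfl]
    have h := Nat.choose_mul_factorial_mul_factorial (Nat.lt_succ_iff.1 (Finset.mem_range.1 hm))
    have h' : (k.choose m : ℂ) * m.factorial * (k - m).factorial = k.factorial := by exact_mod_cast h
    have h0 : (m.factorial : ℂ) ≠ 0 := by exact_mod_cast m.factorial_ne_zero
    push_cast
    rw [← h', smul_eq_mul, mul_pow]
    field_simp
  · intro i hi hne
    rw [smul_mul_smul_comm, map_smul, gaussFun_herm_mul_herm, if_neg, smul_zero]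
    rw [Finset.mem_range] at hi hm
    omega
  · exact fun h => absurd hm h

/-! ## Hermite functions and Laguerre functions -/

/-- The Hermite function `He_k(y) e^{-y²/4}`. -/
noncomputable def hermFun (k : ℕ) (y : ℝ) : ℝ := (herm ℝ k).eval y * Real.exp (-(1 / 4) * y ^ 2)

theorem contDiff_hermFun (k : ℕ) : ContDiff ℝ ∞ (hermFun k) := by
  unfold hermFun
  have := (herm ℝ k).contDiff_aeval (𝕜 := ℝ) (n := ∞)
  simp only [coe_aeval_eq_eval] at this
  exact this.mul (by fun_prop)

theorem continuous_hermFun (k : ℕ) : Continuous (hermFun k) := (contDiff_hermFun k).continuous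

theorem laguerre_eq_sum (k : ℕ) (v : ℝ) : laguerre k v =
    (∑ m ∈ Finset.range (k + 1), (k.choose m : ℝ) * ((-v) ^ m / (m.factorial : ℝ))) *
      Real.exp (-v / 2) := by
  rw [laguerre]
  congr 1
  refine Finset.sum_congr rfl fun m hm => ?_
  rw [Nat.choose_symm (Nat.lt_succ_iff.1 (Finset.mem_range.1 hm)), neg_pow v]
  ring

/-- The Fourier–Wigner transform of a Hermite function is a Laguerre function. -/
theorem integral_hermFun_mul_hermFun (k : ℕ) (p q : ℝ) :
    ∫ y : ℝ, ((hermFun k (y + p) * hermFun k (y - p) : ℝ) : ℂ) * Complex.exp (Complex.I * q * y) =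
      (Real.sqrt (2 * Real.pi) * (k.factorial : ℝ) * laguerre k (p ^ 2 + q ^ 2) : ℝ) := by
  have e : ∀ y : ℝ, ((hermFun k (y + p) * hermFun k (y - p) : ℝ) : ℂ) *
      Complex.exp (Complex.I * q * y) = (Real.exp (-p ^ 2 / 2) : ℂ) *
      (((herm ℂ k).comp (X + C (p : ℂ)) * (herm ℂ k).comp (X + C (-p : ℂ))).eval (y : ℂ) *
        Complex.exp (-(y : ℂ) ^ 2 / 2 + Complex.I * q * y)) := by
    intro y
    have h1 := herm_eval_ofReal k (y + p)
    have h2 := herm_eval_ofReal k (y - p)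
    push_cast at h1 h2
    rw [eval_mul, eval_comp, eval_comp]
    simp only [eval_add, eval_X, eval_C]
    rw [← sub_eq_add_neg, h1, h2]
    simp only [hermFun]
    push_cast
    -- By the parallelogram law the two shifted Gaussians multiply to e^{−y²/2} e^{−p²/2}.
    rw [show -(y : ℂ) ^ 2 / 2 + Complex.I * q * y = (p : ℂ) ^ 2 / 2 +
      ((-(1 / 4) * ((y : ℂ) + p) ^ 2) + (-(1 / 4) * ((y : ℂ) - p) ^ 2) + Complex.I * q * y) by ring]
    rw [Complex.exp_add ((p : ℂ) ^ 2 / 2), Complex.exp_add, Complex.exp_add]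
    have h3 : Complex.exp (-(p : ℂ) ^ 2 / 2) * Complex.exp ((p : ℂ) ^ 2 / 2) = 1 := by
      rw [← Complex.exp_add, neg_div, neg_add_cancel, Complex.exp_zero]
    linear_combination (-(((herm ℝ k).eval (y + p) : ℝ) : ℂ) * Complex.exp (-(1 / 4) * ((y : ℂ) + p) ^ 2)
      * (((herm ℝ k).eval (y - p) : ℝ) : ℂ) * Complex.exp (-(1 / 4) * ((y : ℂ) - p) ^ 2) *
      Complex.exp (Complex.I * q * y)) * h3
  simp_rw [e]
  -- The contour shift turns the frequency q into the imaginary translation iq, so the two shifts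
  -- become iq ± p, whose product is −(p² + q²).
  rw [integral_const_mul, ← gaussFun_apply, gaussFun_eq_comp, mul_comp, comp_assoc, comp_assoc]
  have e1 : ∀ z : ℂ, (X + C z).comp (X + C (Complex.I * q)) = X + C (Complex.I * q + z) := by
    intro z
    rw [add_comp, X_comp, C_comp, C_add, add_assoc]
  rw [e1, e1, gaussFun_herm_shift, laguerre_eq_sum]
  have e2 : (Complex.I * q + p) * (Complex.I * q + -p) = -((p : ℂ) ^ 2 + (q : ℂ) ^ 2) := by
    linear_combination (q : ℂ) ^ 2 * Complex.I_sq
  rw [e2, show -(p ^ 2 + q ^ 2) / 2 = -p ^ 2 / 2 + -q ^ 2 / 2 by ring, Real.exp_add]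
  push_cast
  ring

theorem integrable_eval_mul_gaussian_real (Q : ℝ[X]) {b : ℝ} (hb : 0 < b) :
    Integrable fun y : ℝ => Q.eval y * Real.exp (-b * y ^ 2) := by
  have h := (integrable_eval_mul_gaussian (Q.map Complex.ofRealHom) hb).re
  refine h.congr (Filter.Eventually.of_forall fun y => ?_)
  simp only [← Complex.ofRealHom_eq_coe, Polynomial.eval_map_apply]
  simp [← Complex.ofReal_mul, -Complex.ofReal_exp]

theorem integrable_hermFun_sq (k : ℕ) : Integrable fun y => hermFun k y ^ 2 := by
  refine (integrable_eval_mul_gaussian_real (herm ℝ k ^ 2) (b := 1 / 2) (by norm_num)).congr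
    (Filter.Eventually.of_forall fun y => ?_)
  simp only [hermFun, mul_pow, eval_pow, ← Real.exp_nat_mul]
  congr 2
  push_cast
  ring

theorem integral_hermFun_sq (k : ℕ) :
    ∫ y : ℝ, hermFun k y ^ 2 = Real.sqrt (2 * Real.pi) * (k.factorial : ℝ) := by
  have h := integral_hermFun_mul_hermFun k 0 0
  have h0 : laguerre k 0 = 1 := by
    rw [laguerre_eq_sum, Finset.sum_eq_single 0]
    · simp
    · intro m _ hm
      simp [hm]
    · simp
  simp only [add_zero, sub_zero, Complex.ofReal_zero, mul_zero, zero_mul, Complex.exp_zero,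
    mul_one, ne_eq, OfNat.ofNat_ne_zero, not_false_eq_true, zero_pow, h0] at h
  rw [integral_complex_ofReal] at h
  simpa [sq] using Complex.ofReal_injective h

/-- At frequency 0 the Fourier–Wigner formula exhibits the Laguerre function as the normalised
autocorrelation of a Hermite function, and |uw| ≤ (u² + w²)/2 bounds that by its value at zero
shift. -/
theorem abs_laguerre_le_one (k : ℕ) {v : ℝ} (hv : 0 ≤ v) : |laguerre k v| ≤ 1 := by
  have h := integral_hermFun_mul_hermFun k (Real.sqrt v) 0
  have hpos : 0 < Real.sqrt (2 * Real.pi) * (k.factorial : ℝ) := by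
    have : (0 : ℝ) < k.factorial := by exact_mod_cast k.factorial_pos
    positivity
  simp only [Complex.ofReal_zero, mul_zero, zero_mul, Complex.exp_zero, mul_one, Real.sq_sqrt hv,
    ne_eq, OfNat.ofNat_ne_zero, not_false_eq_true, zero_pow, add_zero] at h
  rw [integral_complex_ofReal] at h
  have h := Complex.ofReal_injective h
  set s := Real.sqrt v
  have i1 : Integrable fun y => hermFun k (y + s) ^ 2 := (integrable_hermFun_sq k).comp_add_right s
  have i2 : Integrable fun y => hermFun k (y - s) ^ 2 := (integrable_hermFun_sq k).comp_sub_right s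
  have b : |∫ y, hermFun k (y + s) * hermFun k (y - s)| ≤
      ∫ y, (hermFun k (y + s) ^ 2 + hermFun k (y - s) ^ 2) / 2 := by
    rw [← Real.norm_eq_abs]
    refine norm_integral_le_of_norm_le ((i1.add i2).div_const 2)
      (Filter.Eventually.of_forall fun y => ?_)
    rw [Real.norm_eq_abs, abs_le]
    constructor <;>
      nlinarith [sq_nonneg (hermFun k (y + s) + hermFun k (y - s)),
        sq_nonneg (hermFun k (y + s) - hermFun k (y - s))]
  rw [integral_div, integral_add i1 i2, integral_add_right_eq_self (fun y => hermFun k y ^ 2),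
    integral_sub_right_eq_self (fun y => hermFun k y ^ 2), integral_hermFun_sq, h, abs_mul,
    abs_of_pos hpos] at b
  have : Real.sqrt (2 * Real.pi) * (k.factorial : ℝ) * |laguerre k v| ≤
      Real.sqrt (2 * Real.pi) * (k.factorial : ℝ) * 1 := by linarith
  exact le_of_mul_le_mul_left this hpos

end Heis

/-! ### Lattice sums of squares of Laguerre functions -/

namespace Heis

/-- Each v^m/m! is at most 8^m e^{v/8}, and the binomial theorem sums the weights to (8 + 1)^k. The
factor e^{−v/2} then leaves the rate 1/2 − 1/8 = 3/8. The constant grows with k;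
`sq_abs_laguerre_le` removes that growth. -/
theorem abs_laguerre_le_exp (k : ℕ) {v : ℝ} (hv : 0 ≤ v) :
    |laguerre k v| ≤ 9 ^ k * Real.exp (-(3 / 8 * v)) := by
  rw [laguerre_eq_sum, abs_mul, Real.abs_exp]
  have h1 : |∑ m ∈ Finset.range (k + 1), (k.choose m : ℝ) * ((-v) ^ m / (m.factorial : ℝ))| ≤
      9 ^ k * Real.exp (v / 8) := by
    calc _ ≤ ∑ m ∈ Finset.range (k + 1), 8 ^ m * 1 ^ (k - m) * (k.choose m : ℝ) *
            Real.exp (v / 8) := by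
          refine (Finset.abs_sum_le_sum_abs _ _).trans (Finset.sum_le_sum fun m _ => ?_)
          have hm := Real.pow_div_factorial_le_exp (v / 8) (by positivity) m
          rw [abs_mul, abs_div, abs_pow, abs_neg, abs_of_nonneg hv, Nat.abs_cast, Nat.abs_cast]
          have e : v ^ m / (m.factorial : ℝ) = 8 ^ m * ((v / 8) ^ m / (m.factorial : ℝ)) := by
            rw [div_pow]
            field_simp
          rw [e]
          calc (k.choose m : ℝ) * (8 ^ m * ((v / 8) ^ m / (m.factorial : ℝ)))
              ≤ (k.choose m : ℝ) * (8 ^ m * Real.exp (v / 8)) := by gcongr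
            _ = _ := by ring
      _ = 9 ^ k * Real.exp (v / 8) := by
          rw [← Finset.sum_mul, ← add_pow]
          norm_num
  calc _ ≤ 9 ^ k * Real.exp (v / 8) * Real.exp (-v / 2) := by gcongr
    _ = _ := by
      rw [mul_assoc, ← Real.exp_add]
      congr 2
      ring

/-- Interpolation between the two preceding kinds of bound: in the power k + 1 all factors but one
are bounded by 1, and the last one by 81^k e^{−3v/4}. Taking the root makes the constant uniform in
k, at the price of decay on the scale v ~ k + 1. -/
theorem sq_abs_laguerre_le (k : ℕ) {v : ℝ} (hv : 0 ≤ v) :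
    |laguerre k v| ^ 2 ≤ 81 * Real.exp (-(3 / 4 * v / (k + 1))) := by
  have hk : (0 : ℝ) < k + 1 := by positivity
  refine le_of_pow_le_pow_left₀ (n := k + 1) (by omega) (by positivity) ?_
  calc (|laguerre k v| ^ 2) ^ (k + 1) ≤ |laguerre k v| ^ 2 := by
        refine pow_le_of_le_one (by positivity) ?_ (by omega)
        exact pow_le_one₀ (abs_nonneg _) (abs_laguerre_le_one k hv)
    _ ≤ (9 ^ k * Real.exp (-(3 / 8 * v))) ^ 2 := by
        gcongr
        exact abs_laguerre_le_exp k hv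
    _ = 81 ^ k * Real.exp (-(3 / 4 * v)) := by
        rw [mul_pow, ← pow_mul, mul_comm k 2, pow_mul, ← Real.exp_nat_mul]
        norm_num
        ring
    _ ≤ 81 ^ (k + 1) * Real.exp (-(3 / 4 * v)) := by
        gcongr
        · norm_num
        · omega
    _ = _ := by
        rw [mul_pow, ← Real.exp_nat_mul]
        congr 2
        push_cast
        field_simp

/-- Two geometric series of ratio r = e^{−1/s}, over a ≥ 0 and a < 0. From e^{1/s} ≥ 1 + 1/s follows
(1 − r)⁻¹ ≤ s + 1 ≤ 2s. -/
theorem exists_hasSum_exp_neg_natAbs {s : ℝ} (hs : 1 ≤ s) :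
    ∃ S : ℝ, S ≤ 4 * s ∧ HasSum (fun a : ℤ => Real.exp (-(|(a : ℝ)| / s))) S := by
  have hs0 : 0 < s := by linarith
  set r := Real.exp (-(1 / s)) with hr
  have hr0 : 0 < r := Real.exp_pos _
  have hr1 : r < 1 := by
    rw [hr, Real.exp_lt_one_iff]
    have : 0 < 1 / s := by positivity
    linarith
  have g := hasSum_geometric_of_lt_one hr0.le hr1
  have e1 : ∀ m : ℕ, r ^ m = Real.exp (-((m : ℝ) / s)) := by
    intro m
    rw [hr, ← Real.exp_nat_mul]
    congr 1
    ring
  refine ⟨(1 - r)⁻¹ + r * (1 - r)⁻¹, ?_, ?_⟩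
  · have h2 : r ≤ s / (s + 1) := by
      have h3 : 1 / s + 1 ≤ Real.exp (1 / s) := Real.add_one_le_exp _
      rw [hr, Real.exp_neg, inv_le_comm₀ (Real.exp_pos _) (by positivity), inv_div]
      refine le_trans (le_of_eq ?_) h3
      field_simp
      ring
    have h4 : 1 / (s + 1) ≤ 1 - r := by
      have : 1 / (s + 1) = 1 - s / (s + 1) := by
        field_simp
        ring
      linarith
    have h5 : (1 - r)⁻¹ ≤ s + 1 := by
      rw [inv_le_comm₀ (by linarith) (by positivity)]
      simpa using h4
    have h6 : 0 ≤ (1 - r)⁻¹ := inv_nonneg.2 (by linarith)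
    nlinarith
  · refine HasSum.of_nat_of_neg_add_one ?_ ?_
    · refine g.congr_fun ?_
      intro m
      simp [e1]
    · refine (g.mul_left r).congr_fun ?_
      intro m
      rw [← pow_succ', e1]
      congr 3
      push_cast
      rw [abs_neg, abs_of_nonneg (by positivity)]

theorem laguerreTerm_nonneg (k : ℕ) (n : ℤ) (p : ℤ × ℤ) : 0 ≤ laguerreTerm k n p := by
  unfold laguerreTerm
  positivity

/-- The lattice sum of squares of Laguerre functions converges and is `O(|n| (k + 1))`. -/
theorem summable_laguerreTerm_and_tsum_le (k : ℕ) {n : ℤ} (hn : n ≠ 0) :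
    Summable (laguerreTerm k n) ∧
      ∑' p : ℤ × ℤ, laguerreTerm k n p ≤ 2592 * (|(n : ℝ)| * (k + 1)) := by
  have hn1 : (1 : ℝ) ≤ |(n : ℝ)| := by exact_mod_cast Int.one_le_abs hn
  set D := |(n : ℝ)| * ((k : ℝ) + 1) with hD
  have hk1 : (1 : ℝ) ≤ (k : ℝ) + 1 := by
    have : (0 : ℝ) ≤ k := k.cast_nonneg
    linarith
  have hD1 : 1 ≤ D := one_le_mul_of_one_le_of_one_le hn1 hk1
  set s := Real.sqrt D with hs
  have hs1 : 1 ≤ s := Real.one_le_sqrt.2 hD1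
  have hsD : s ^ 2 = D := Real.sq_sqrt (by linarith)
  obtain ⟨S, hS, hsum⟩ := exists_hasSum_exp_neg_natAbs hs1
  have hS0 : 0 ≤ S := hsum.nonneg fun a => (Real.exp_pos _).le
  have hprod : HasSum (fun p : ℤ × ℤ =>
      Real.exp (-(|(p.1 : ℝ)| / s)) * Real.exp (-(|(p.2 : ℝ)| / s))) (S * S) :=
    hsum.mul hsum (hsum.summable.mul_of_nonneg hsum.summable
      (fun _ => (Real.exp_pos _).le) (fun _ => (Real.exp_pos _).le))
  -- Here 162 = 81 · 2. The quadratic exponent is replaced by a linear one through x²/D ≥ |x|/s −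
  -- 1/4, used in both variables; this costs e^{1/2} ≤ 2. The total is then at most 162 · (4s)² =
  -- 2592 D.
  have hb := hprod.mul_left 162
  have key : ∀ p : ℤ × ℤ, laguerreTerm k n p ≤
      162 * (Real.exp (-(|(p.1 : ℝ)| / s)) * Real.exp (-(|(p.2 : ℝ)| / s))) := by
    rintro ⟨a, b⟩
    have hv : 0 ≤ Real.pi * (((a : ℝ) ^ 2 + (b : ℝ) ^ 2) / |(n : ℝ)|) := by positivity
    refine (sq_abs_laguerre_le k hv).trans ?_
    have he : Real.exp (1 / 2) ≤ 2 := by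
      have h1 : Real.exp (1 / 2) ^ 2 = Real.exp 1 := by
        rw [← Real.exp_nat_mul]
        norm_num
      have h2 := Real.exp_one_lt_d9
      nlinarith [Real.exp_pos (1 / 2 : ℝ)]
    have hquad : ∀ x : ℝ, |x| / s - 1 / 4 ≤ x ^ 2 / D := by
      intro x
      rw [← hsD]
      have : x ^ 2 / s ^ 2 = (|x| / s) ^ 2 := by rw [div_pow, sq_abs]
      rw [this]
      nlinarith [sq_nonneg (|x| / s - 1 / 2)]
    have hpi : ((a : ℝ) ^ 2 + (b : ℝ) ^ 2) / D ≤
        3 / 4 * (Real.pi * (((a : ℝ) ^ 2 + (b : ℝ) ^ 2) / |(n : ℝ)|)) / (k + 1) := by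
      have e : 3 / 4 * (Real.pi * (((a : ℝ) ^ 2 + (b : ℝ) ^ 2) / |(n : ℝ)|)) / (k + 1) =
          (3 / 4 * Real.pi) * (((a : ℝ) ^ 2 + (b : ℝ) ^ 2) / D) := by
        rw [hD]
        field_simp
      rw [e]
      refine le_mul_of_one_le_left (by positivity) ?_
      nlinarith [Real.pi_gt_three]
    calc _ ≤ 81 * Real.exp (1 / 2 + (-(|(a : ℝ)| / s) + -(|(b : ℝ)| / s))) := by
          gcongr
          have h1 := hquad a
          have h2 := hquad b
          rw [add_div] at hpi
          linarith
      _ ≤ _ := by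
          rw [Real.exp_add, Real.exp_add]
          have := mul_pos (Real.exp_pos (-(|(a : ℝ)| / s))) (Real.exp_pos (-(|(b : ℝ)| / s)))
          simp only
          nlinarith
  have hsm : Summable (laguerreTerm k n) :=
    Summable.of_nonneg_of_le (laguerreTerm_nonneg k n) key hb.summable
  refine ⟨hsm, (hsm.tsum_le_tsum key hb.summable).trans ?_⟩
  rw [hb.tsum_eq]
  nlinarith

end Heis

namespace Heis

open Polynomial

/-! ## Completeness of the Hermite functions -/

theorem memLp_eval_mul_gaussian (P : ℝ[X]) {b : ℝ} (hb : 0 < b) :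
    MemLp (fun y : ℝ => P.eval y * Real.exp (-b * y ^ 2)) 2 := by
  rw [memLp_two_iff_integrable_sq (by fun_prop)]
  refine (integrable_eval_mul_gaussian_real (P ^ 2) (b := 2 * b) (by positivity)).congr
    (Filter.Eventually.of_forall fun y => ?_)
  simp only [mul_pow, eval_pow, ← Real.exp_nat_mul]
  congr 2
  push_cast
  ring

theorem memLp_hermFun (k : ℕ) : MemLp (hermFun k) 2 :=
  memLp_eval_mul_gaussian _ (by norm_num)

theorem integrable_ofReal_mul {f : ℝ → ℝ} {G : ℝ → ℂ} (hf : MemLp f 2) (hG : MemLp G 2) :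
    Integrable fun y => (f y : ℂ) * G y :=
  (hf.ofReal (K := ℂ)).integrable_mul hG

theorem integrable_mul_norm {f : ℝ → ℝ} {G : ℝ → ℂ} (hf : MemLp f 2) (hG : MemLp G 2) :
    Integrable fun y => f y * ‖G y‖ :=
  hf.integrable_mul hG.norm

/-- The Hermite polynomials are monic with one in each degree, hence span all polynomials. -/
theorem integral_eval_mul_gaussian_eq_zero {G : ℝ → ℂ} (hG : MemLp G 2)
    (h : ∀ k, ∫ y, (hermFun k y : ℂ) * G y = 0) (P : ℝ[X]) :
    ∫ y, ((P.eval y * Real.exp (-(1 / 4) * y ^ 2) : ℝ) : ℂ) * G y = 0 := by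
  let S : Polynomial.Sequence ℝ :=
    ⟨herm ℝ, fun i => by
      rw [Polynomial.degree_eq_natDegree (monic_herm ℝ i).ne_zero, natDegree_herm]⟩
  have hS : Submodule.span ℝ (Set.range S) = ⊤ := S.span fun i => by
    change IsUnit (herm ℝ i).leadingCoeff
    rw [monic_herm]
    exact isUnit_one
  have hP : P ∈ Submodule.span ℝ (Set.range S) := hS ▸ Submodule.mem_top
  have hi : ∀ Q : ℝ[X], Integrable fun y =>
      ((Q.eval y * Real.exp (-(1 / 4) * y ^ 2) : ℝ) : ℂ) * G y := fun Q =>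
    integrable_ofReal_mul (memLp_eval_mul_gaussian Q (by norm_num)) hG
  induction hP using Submodule.span_induction with
  | mem x hx =>
    obtain ⟨k, rfl⟩ := hx
    exact h k
  | zero => simp
  | add p q _ _ hp hq =>
    have e : ∀ y, (((p + q).eval y * Real.exp (-(1 / 4) * y ^ 2) : ℝ) : ℂ) * G y =
        ((p.eval y * Real.exp (-(1 / 4) * y ^ 2) : ℝ) : ℂ) * G y +
        ((q.eval y * Real.exp (-(1 / 4) * y ^ 2) : ℝ) : ℂ) * G y := by
      intro y
      rw [eval_add]
      push_cast
      ring
    simp_rw [e]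
    rw [integral_add (hi p) (hi q), hp, hq, add_zero]
  | smul a p _ hp =>
    have e : ∀ y, (((a • p).eval y * Real.exp (-(1 / 4) * y ^ 2) : ℝ) : ℂ) * G y =
        (a : ℂ) * (((p.eval y * Real.exp (-(1 / 4) * y ^ 2) : ℝ) : ℂ) * G y) := by
      intro y
      rw [eval_smul, smul_eq_mul]
      push_cast
      ring
    simp_rw [e]
    rw [integral_const_mul, hp, mul_zero]

theorem norm_sum_exp_le (z : ℂ) (N : ℕ) :
    ‖∑ m ∈ Finset.range N, z ^ m / (m.factorial : ℂ)‖ ≤ Real.exp ‖z‖ := by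
  refine (norm_sum_le _ _).trans ?_
  simp only [norm_div, norm_pow, Complex.norm_natCast]
  exact Real.sum_le_exp_of_nonneg (norm_nonneg z) N

/-- The partial sums of the exponential series are polynomials in y, so they pair to zero with G
against the Gaussian; dominated convergence passes to the limit. -/
theorem integral_exp_mul_gaussian_eq_zero {G : ℝ → ℂ} (hG : MemLp G 2)
    (h : ∀ k, ∫ y, (hermFun k y : ℂ) * G y = 0) (ξ : ℝ) :
    ∫ y : ℝ, Complex.exp (ξ * y * Complex.I) * ((Real.exp (-(1 / 4) * y ^ 2) : ℂ) * G y) = 0 := by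
  have hlim : Filter.Tendsto (fun N : ℕ => ∫ y : ℝ,
      (∑ m ∈ Finset.range N, (ξ * y * Complex.I) ^ m / (m.factorial : ℂ)) *
        ((Real.exp (-(1 / 4) * y ^ 2) : ℂ) * G y)) Filter.atTop
      (nhds (∫ y : ℝ, Complex.exp (ξ * y * Complex.I) *
        ((Real.exp (-(1 / 4) * y ^ 2) : ℂ) * G y))) := by
    -- The partial sums are bounded by e^{|ξ||y|}, and |ξ||y| ≤ 2ξ² + y²/8 leaves half of the
    -- Gaussian exponent.
    have hg : MemLp (fun y : ℝ => Real.exp (2 * ξ ^ 2) * Real.exp (-(1 / 8) * y ^ 2)) 2 := by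
      have := (memLp_eval_mul_gaussian 1 (b := 1 / 8) (by norm_num)).const_mul
        (Real.exp (2 * ξ ^ 2))
      simpa using this
    refine tendsto_integral_of_dominated_convergence
      (fun y => (Real.exp (2 * ξ ^ 2) * Real.exp (-(1 / 8) * y ^ 2)) * ‖G y‖) (fun N => ?_)
      (integrable_mul_norm hg hG) (fun N => ?_) ?_
    · refine AEStronglyMeasurable.mul (Continuous.aestronglyMeasurable (by fun_prop)) ?_
      exact (Continuous.aestronglyMeasurable (by fun_prop)).mul hG.1
    · refine Filter.Eventually.of_forall fun y => ?_
      rw [norm_mul, norm_mul, ← mul_assoc]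
      refine mul_le_mul_of_nonneg_right ?_ (norm_nonneg _)
      have h1 := norm_sum_exp_le (ξ * y * Complex.I) N
      have h2 : ‖(ξ * y * Complex.I : ℂ)‖ = |ξ| * |y| := by simp
      rw [Complex.norm_real, Real.norm_of_nonneg (Real.exp_pos _).le, ← Real.exp_add]
      rw [h2] at h1
      refine (mul_le_mul_of_nonneg_right h1 (Real.exp_pos _).le).trans ?_
      rw [← Real.exp_add]
      refine Real.exp_le_exp.2 ?_
      rw [← sq_abs ξ, ← sq_abs y]
      nlinarith [sq_nonneg (4 * |ξ| - |y|)]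
    · refine Filter.Eventually.of_forall fun y => ?_
      refine Filter.Tendsto.mul_const _ ?_
      have := (NormedSpace.expSeries_div_hasSum_exp (𝔸 := ℂ) (ξ * y * Complex.I)).tendsto_sum_nat
      rwa [← Complex.exp_eq_exp_ℂ] at this
  refine tendsto_nhds_unique hlim ?_
  have hz : ∀ N : ℕ, ∫ y : ℝ,
      (∑ m ∈ Finset.range N, (ξ * y * Complex.I) ^ m / (m.factorial : ℂ)) *
        ((Real.exp (-(1 / 4) * y ^ 2) : ℂ) * G y) = 0 := by
    intro N
    simp_rw [Finset.sum_mul]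
    have e : ∀ (m : ℕ) (y : ℝ), (ξ * y * Complex.I) ^ m / (m.factorial : ℂ) *
        ((Real.exp (-(1 / 4) * y ^ 2) : ℂ) * G y) = ((ξ * Complex.I) ^ m / (m.factorial : ℂ)) *
        ((((X ^ m : ℝ[X]).eval y * Real.exp (-(1 / 4) * y ^ 2) : ℝ) : ℂ) * G y) := by
      intro m y
      rw [eval_pow, eval_X]
      push_cast
      ring
    simp_rw [e]
    rw [integral_finsetSum]
    · refine Finset.sum_eq_zero fun m _ => ?_
      rw [integral_const_mul, integral_eval_mul_gaussian_eq_zero hG h, mul_zero]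
    · intro m _
      exact (integrable_ofReal_mul (memLp_eval_mul_gaussian _ (by norm_num)) hG).const_mul _
  simp_rw [hz]
  exact tendsto_const_nhds

open FourierTransform in
/-- An integrable function with vanishing Fourier transform is zero. -/
theorem ae_eq_zero_of_fourier_eq_zero {f : ℝ → ℂ} (hf : Integrable f)
    (h : ∀ ξ, 𝓕 f ξ = 0) : ∀ᵐ y, f y = 0 := by
  refine ae_eq_zero_of_integral_contDiff_smul_eq_zero hf.locallyIntegrable fun g hg hgc => ?_
  have hgC : HasCompactSupport fun y => (g y : ℂ) := hgc.comp_left (g := Complex.ofReal) rfl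
  have hgC' : ContDiff ℝ ∞ fun y => (g y : ℂ) := Complex.ofRealCLM.contDiff.comp hg
  -- A test function is the Fourier transform of a Schwartz function φ, so its pairing with f equals
  -- the pairing of φ with the Fourier transform of f, which vanishes.
  let ψ : SchwartzMap ℝ ℂ := hgC.toSchwartzMap hgC'
  let φ : SchwartzMap ℝ ℂ := 𝓕⁻ ψ
  have hφ : 𝓕 φ = ψ := FourierTransform.fourier_fourierInv_eq ψ
  have key := VectorFourier.integral_fourierIntegral_smul_eq_flip (L := innerₗ ℝ) (μ := volume)
    (ν := volume) Real.continuous_fourierChar continuous_inner φ.integrable hf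
  have e1 : ∀ ξ, VectorFourier.fourierIntegral Real.fourierChar volume (innerₗ ℝ) φ ξ = g ξ := by
    intro ξ
    change 𝓕 (φ : ℝ → ℂ) ξ = g ξ
    rw [← SchwartzMap.fourier_coe, hφ]
    rfl
  have e2 : ∀ ξ, VectorFourier.fourierIntegral Real.fourierChar volume (innerₗ ℝ).flip f ξ = 0 := by
    intro ξ
    rw [flip_innerₗ]
    exact h ξ
  simp_rw [e1, e2] at key
  simpa using key

/-- Completeness of the Hermite functions in `L²(ℝ)`. -/
theorem ae_eq_zero_of_integral_hermFun_eq_zero {G : ℝ → ℂ} (hG : MemLp G 2)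
    (h : ∀ k, ∫ y, (hermFun k y : ℂ) * G y = 0) : ∀ᵐ y, G y = 0 := by
  have hint : Integrable fun y : ℝ => (Real.exp (-(1 / 4) * y ^ 2) : ℂ) * G y := by
    have := integrable_ofReal_mul (memLp_eval_mul_gaussian 1 (b := 1 / 4) (by norm_num)) hG
    simpa using this
  have := ae_eq_zero_of_fourier_eq_zero hint fun ξ => by
    rw [Real.fourier_real_eq_integral_exp_smul, ← integral_exp_mul_gaussian_eq_zero hG h
      (-2 * Real.pi * ξ)]
    refine integral_congr_ae (Filter.Eventually.of_forall fun y => ?_)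
    simp only [smul_eq_mul]
    congr 2
    push_cast
    ring
  filter_upwards [this] with y hy
  exact (mul_eq_zero.1 hy).resolve_left (by exact_mod_cast (Real.exp_pos _).ne')

end Heis

namespace Heis

open Polynomial

/-! ## Weak square integrable eigenfunctions of the harmonic oscillator -/

theorem hasDerivAt_eval_mul_gaussian (P : ℝ[X]) (y : ℝ) :
    HasDerivAt (fun y : ℝ => P.eval y * Real.exp (-(1 / 4) * y ^ 2))
      ((derivative P - C (1 / 2) * X * P).eval y * Real.exp (-(1 / 4) * y ^ 2)) y := by
  have h : HasDerivAt (fun y : ℝ => -(1 / 4) * y ^ 2) (-(1 / 2) * y) y := by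
    refine (((hasDerivAt_id y).pow 2).const_mul (-(1 / 4) : ℝ)).congr_deriv ?_
    simp
    ring
  refine ((P.hasDerivAt y).mul h.exp).congr_deriv ?_
  simp
  ring

/-- The derivative of the Hermite function. -/
noncomputable def hermFunDeriv (k : ℕ) (y : ℝ) : ℝ :=
  (derivative (herm ℝ k) - C (1 / 2) * X * herm ℝ k).eval y * Real.exp (-(1 / 4) * y ^ 2)

theorem hasDerivAt_hermFun (k : ℕ) (y : ℝ) : HasDerivAt (hermFun k) (hermFunDeriv k y) y :=
  hasDerivAt_eval_mul_gaussian _ y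

/-- Conjugating the Hermite equation by e^{−y²/4} gives the oscillator equation with energy k + 1/2.
-/
theorem hasDerivAt_hermFunDeriv (k : ℕ) (y : ℝ) :
    HasDerivAt (hermFunDeriv k) ((y ^ 2 / 4 - (k + 1 / 2)) * hermFun k y) y := by
  refine (hasDerivAt_eval_mul_gaussian _ y).congr_deriv ?_
  have e : derivative (derivative (herm ℝ k) - C (1 / 2) * X * herm ℝ k) -
      C (1 / 2) * X * (derivative (herm ℝ k) - C (1 / 2) * X * herm ℝ k) =
      (C (1 / 4) * X ^ 2 - (C (k : ℝ) + C (1 / 2))) * herm ℝ k := by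
    have h := herm_ode ℝ k
    have h2 : (C (1 / 2 : ℝ) : ℝ[X]) * C (1 / 2) = C (1 / 4) := by
      rw [← C_mul]
      norm_num
    have h3 : (C (1 / 2 : ℝ) : ℝ[X]) + C (1 / 2) = 1 := by
      rw [← C_add]
      norm_num
    have h4 : (C (k : ℝ) : ℝ[X]) = (k : ℝ[X]) := by simp
    rw [derivative_sub, derivative_mul, derivative_mul, derivative_C, derivative_X, h, h4]
    linear_combination (X ^ 2 * herm ℝ k) * h2 - (X * derivative (herm ℝ k)) * h3
  rw [e, hermFun]
  simp
  ring

theorem memLp_hermFunDeriv (k : ℕ) : MemLp (hermFunDeriv k) 2 :=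
  memLp_eval_mul_gaussian _ (by norm_num)

/-- Eigenfunctions of a symmetric operator for different eigenvalues are orthogonal. The Hermite
function lacks compact support, so it is tested through the cutoffs β(s_N y) with s_N → 0; in the
limit (k + 1/2 − E) ∫ h_k G = 0. -/
theorem integral_hermFun_mul_eq_zero {G : ℝ → ℂ} (hG : MemLp G 2) {E : ℝ}
    (h : ∀ χ : ℝ → ℝ, ContDiff ℝ ∞ χ → HasCompactSupport χ →
      ∫ y, ((-(deriv (deriv χ) y) + y ^ 2 / 4 * χ y - E * χ y : ℝ) : ℂ) * G y = 0) (k : ℕ)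
    (hE : E ≠ k + 1 / 2) : ∫ y, (hermFun k y : ℂ) * G y = 0 := by
  let β : ContDiffBump (0 : ℝ) := ⟨1, 2, by norm_num, by norm_num⟩
  have hβ : ContDiff ℝ ∞ β := β.contDiff
  have hβ' : ContDiff ℝ ∞ (deriv β) := by
    exact (contDiff_infty_iff_deriv.1 hβ).2
  have hβ'' : ContDiff ℝ ∞ (deriv (deriv β)) := (contDiff_infty_iff_deriv.1 hβ').2
  have hcs : HasCompactSupport β := β.hasCompactSupport
  obtain ⟨C1, hC1⟩ := hβ'.continuous.bounded_above_of_compact_support hcs.deriv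
  obtain ⟨C2, hC2⟩ := hβ''.continuous.bounded_above_of_compact_support hcs.deriv.deriv
  have hC1' : 0 ≤ C1 := (norm_nonneg _).trans (hC1 0)
  have hC2' : 0 ≤ C2 := (norm_nonneg _).trans (hC2 0)
  let s : ℕ → ℝ := fun N => 1 / ((N : ℝ) + 1)
  have hs0 : ∀ N, 0 < s N := fun N => by positivity
  have hs1 : ∀ N, s N ≤ 1 := fun N => by
    have : (0 : ℝ) ≤ N := N.cast_nonneg
    exact (div_le_one (by positivity)).2 (by linarith)
  have hslim : Filter.Tendsto s Filter.atTop (nhds 0) := tendsto_one_div_add_atTop_nhds_zero_nat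
  -- This is the oscillator minus E, applied to the truncated Hermite function. Every commutator
  -- term carries a factor s_N or s_N² and disappears in the limit.
  let Φ : ℕ → ℝ → ℝ := fun N y => (k + 1 / 2 - E) * (β (s N * y) * hermFun k y) -
    2 * s N * deriv β (s N * y) * hermFunDeriv k y - s N ^ 2 * deriv (deriv β) (s N * y) * hermFun k y
  have hzero : ∀ N, ∫ y, (Φ N y : ℂ) * G y = 0 := by
    intro N
    have hd : ∀ (f : ℝ → ℝ), ContDiff ℝ ∞ f → ∀ y,
        HasDerivAt (fun y => f (s N * y)) (s N * deriv f (s N * y)) y := by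
      intro f hf y
      have h1 := (hf.differentiable (by simp) (s N * y)).hasDerivAt
      have h2 : HasDerivAt (fun y : ℝ => s N * y) (s N) y := by
        simpa using (hasDerivAt_id y).const_mul (s N)
      exact (h1.comp y h2).congr_deriv (mul_comm _ _)
    have d1 : deriv (fun y => β (s N * y) * hermFun k y) = fun y =>
        s N * deriv β (s N * y) * hermFun k y + β (s N * y) * hermFunDeriv k y :=
      funext fun y => ((hd β hβ y).mul (hasDerivAt_hermFun k y)).deriv
    have d2 : ∀ y, deriv (deriv (fun y => β (s N * y) * hermFun k y)) y =
        s N * (s N * deriv (deriv β) (s N * y)) * hermFun k y +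
          s N * deriv β (s N * y) * hermFunDeriv k y +
        (s N * deriv β (s N * y) * hermFunDeriv k y +
          β (s N * y) * ((y ^ 2 / 4 - (k + 1 / 2)) * hermFun k y)) := by
      intro y
      rw [d1]
      exact ((((hd _ hβ' y).const_mul (s N)).mul (hasDerivAt_hermFun k y)).add
        ((hd β hβ y).mul (hasDerivAt_hermFunDeriv k y))).deriv
    have h0 := h (fun y => β (s N * y) * hermFun k y)
      ((hβ.comp (contDiff_const.mul contDiff_id)).mul (contDiff_hermFun k))
      ((hcs.comp_smul (hs0 N).ne').mul_right)
    rw [← h0]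
    refine integral_congr_ae (Filter.Eventually.of_forall fun y => ?_)
    simp only [d2, Φ]
    congr 2
    ring
  have hlim : Filter.Tendsto (fun N => ∫ y, (Φ N y : ℂ) * G y) Filter.atTop
      (nhds (∫ y, (((k + 1 / 2 - E) * hermFun k y : ℝ) : ℂ) * G y)) := by
    refine tendsto_integral_of_dominated_convergence (fun y => (|k + 1 / 2 - E| + C2) *
      (|hermFun k y| * ‖G y‖) + 2 * C1 * (|hermFunDeriv k y| * ‖G y‖)) (fun N => ?_) ?_
      (fun N => ?_) ?_
    · refine AEStronglyMeasurable.mul (Continuous.aestronglyMeasurable ?_) hG.1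
      have c1 := hβ.continuous
      have c2 := hβ'.continuous
      have c3 := hβ''.continuous
      have c4 := continuous_hermFun k
      have c5 : Continuous (hermFunDeriv k) := by
        unfold hermFunDeriv
        fun_prop
      fun_prop
    · exact ((integrable_mul_norm (memLp_hermFun k).abs hG).const_mul _).add
        ((integrable_mul_norm (memLp_hermFunDeriv k).abs hG).const_mul _)
    · refine Filter.Eventually.of_forall fun y => ?_
      have a1 : |(k + 1 / 2 - E) * (β (s N * y) * hermFun k y)| ≤
          |k + 1 / 2 - E| * |hermFun k y| := by
        rw [abs_mul, abs_mul]
        refine mul_le_mul_of_nonneg_left (mul_le_of_le_one_left (abs_nonneg _) ?_) (abs_nonneg _)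
        rw [abs_of_nonneg β.nonneg]
        exact β.le_one
      have a2 : |2 * s N * deriv β (s N * y) * hermFunDeriv k y| ≤
          2 * C1 * |hermFunDeriv k y| := by
        rw [abs_mul, abs_mul, abs_of_nonneg (by have := hs0 N; positivity : 0 ≤ 2 * s N)]
        refine mul_le_mul_of_nonneg_right ?_ (abs_nonneg _)
        have := hC1 (s N * y)
        rw [Real.norm_eq_abs] at this
        nlinarith [hs0 N, hs1 N, abs_nonneg (deriv β (s N * y))]
      have a3 : |s N ^ 2 * deriv (deriv β) (s N * y) * hermFun k y| ≤ C2 * |hermFun k y| := by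
        rw [abs_mul, abs_mul, abs_of_nonneg (sq_nonneg _)]
        refine mul_le_mul_of_nonneg_right ?_ (abs_nonneg _)
        have := hC2 (s N * y)
        rw [Real.norm_eq_abs] at this
        have h1 : s N ^ 2 ≤ 1 := pow_le_one₀ (hs0 N).le (hs1 N)
        calc _ ≤ 1 * |deriv (deriv β) (s N * y)| := by gcongr
          _ ≤ C2 := by rwa [one_mul]
      have a4 : |Φ N y| ≤ (|k + 1 / 2 - E| + C2) * |hermFun k y| + 2 * C1 * |hermFunDeriv k y| := by
        have b1 := abs_sub ((k + 1 / 2 - E) * (β (s N * y) * hermFun k y) -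
          2 * s N * deriv β (s N * y) * hermFunDeriv k y)
          (s N ^ 2 * deriv (deriv β) (s N * y) * hermFun k y)
        have b2 := abs_sub ((k + 1 / 2 - E) * (β (s N * y) * hermFun k y))
          (2 * s N * deriv β (s N * y) * hermFunDeriv k y)
        simp only [Φ]
        linarith
      rw [norm_mul, Complex.norm_real, Real.norm_eq_abs]
      refine (mul_le_mul_of_nonneg_right a4 (norm_nonneg _)).trans (le_of_eq ?_)
      ring
    · refine Filter.Eventually.of_forall fun y => ?_
      refine Filter.Tendsto.mul_const _ ?_
      refine (Complex.continuous_ofReal.tendsto _).comp ?_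
      have t0 : Filter.Tendsto (fun N => s N * y) Filter.atTop (nhds 0) := by
        simpa using hslim.mul_const y
      have t1 : Filter.Tendsto (fun N => β (s N * y)) Filter.atTop (nhds 1) := by
        have := (hβ.continuous.tendsto 0).comp t0
        rwa [β.one_of_mem_closedBall (by simp [β.rIn_pos.le])] at this
      have t2 := (hβ'.continuous.tendsto 0).comp t0
      have t3 := (hβ''.continuous.tendsto 0).comp t0
      have := (((t1.mul_const (hermFun k y)).const_mul (k + 1 / 2 - E)).sub
        (((hslim.const_mul 2).mul t2).mul_const (hermFunDeriv k y))).sub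
        (((hslim.pow 2).mul t3).mul_const (hermFun k y))
      simpa [Φ, Function.comp_def] using this
  simp_rw [hzero] at hlim
  have := tendsto_nhds_unique hlim tendsto_const_nhds
  have e : ∀ y, (((k + 1 / 2 - E) * hermFun k y : ℝ) : ℂ) * G y =
      ((k + 1 / 2 - E : ℝ) : ℂ) * ((hermFun k y : ℂ) * G y) := by
    intro y
    push_cast
    ring
  simp_rw [e] at this
  rw [integral_const_mul] at this
  refine (mul_eq_zero.1 this).resolve_left ?_
  exact_mod_cast sub_ne_zero.2 hE.symm

theorem integral_hermFun_mul_hermFun_of_ne {j k : ℕ} (hjk : j ≠ k) :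
    ∫ y : ℝ, (hermFun j y : ℂ) * (hermFun k y : ℂ) = 0 := by
  have h := gaussFun_herm_mul_herm j k
  rw [if_neg hjk, gaussFun_apply] at h
  rw [← h]
  refine integral_congr_ae (Filter.Eventually.of_forall fun y => ?_)
  simp only [eval_mul, herm_eval_ofReal, hermFun]
  push_cast
  rw [show -(y : ℂ) ^ 2 / 2 + Complex.I * 0 * y = -(1 / 4) * (y : ℂ) ^ 2 + -(1 / 4) * (y : ℂ) ^ 2 by
    ring, Complex.exp_add]
  ring

/-- Square integrable weak eigenfunctions of the harmonic oscillator are Hermite functions. -/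
theorem ae_eq_hermFun_of_weak_eigenfunction {G : ℝ → ℂ} (hG : MemLp G 2) {E : ℝ}
    (h : ∀ χ : ℝ → ℝ, ContDiff ℝ ∞ χ → HasCompactSupport χ →
      ∫ y, ((-(deriv (deriv χ) y) + y ^ 2 / 4 * χ y - E * χ y : ℝ) : ℂ) * G y = 0) :
    (∀ᵐ y, G y = 0) ∨ ∃ ℓ : ℕ, E = ℓ + 1 / 2 ∧ ∃ c : ℂ, ∀ᵐ y, G y = c * hermFun ℓ y := by
  by_cases hE : ∃ ℓ : ℕ, E = ℓ + 1 / 2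
  · right
    obtain ⟨ℓ, hℓ⟩ := hE
    refine ⟨ℓ, hℓ, ?_⟩
    set A : ℂ := ∫ y : ℝ, (hermFun ℓ y : ℂ) * (hermFun ℓ y : ℂ) with hA
    have hA0 : A ≠ 0 := by
      have : A = ((Real.sqrt (2 * Real.pi) * (ℓ.factorial : ℝ) : ℝ) : ℂ) := by
        rw [hA, ← integral_hermFun_sq, ← integral_complex_ofReal]
        simp [sq]
      rw [this]
      have hf : (0 : ℝ) < ℓ.factorial := by exact_mod_cast ℓ.factorial_pos
      have : 0 < Real.sqrt (2 * Real.pi) * (ℓ.factorial : ℝ) := by positivity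
      exact_mod_cast this.ne'
    -- Subtracting the component along h_ℓ leaves a function orthogonal to every Hermite function,
    -- which is zero by completeness.
    set c : ℂ := (∫ y, (hermFun ℓ y : ℂ) * G y) / A with hc
    have hL : MemLp (fun y => c * (hermFun ℓ y : ℂ)) 2 :=
      ((memLp_hermFun ℓ).ofReal (K := ℂ)).const_mul c
    have := ae_eq_zero_of_integral_hermFun_eq_zero (hG.sub hL) fun k => by
      simp only [Pi.sub_apply, mul_sub]
      rw [integral_sub (integrable_ofReal_mul (memLp_hermFun k) hG)
        (integrable_ofReal_mul (memLp_hermFun k) hL)]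
      simp_rw [mul_left_comm _ c]
      rw [integral_const_mul]
      by_cases hk : k = ℓ
      · subst hk
        rw [← hA, hc, div_mul_cancel₀ _ hA0, sub_self]
      · rw [integral_hermFun_mul_hermFun_of_ne hk, mul_zero, sub_zero]
        refine integral_hermFun_mul_eq_zero hG h k ?_
        rw [hℓ]
        intro h'
        have : (ℓ : ℝ) = k := by linarith
        exact hk (by exact_mod_cast this.symm)
    exact ⟨c, this.mono fun y hy => sub_eq_zero.1 hy⟩
  · left
    refine ae_eq_zero_of_integral_hermFun_eq_zero hG fun k => ?_
    exact integral_hermFun_mul_eq_zero hG h k fun h' => hE ⟨k, h'⟩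

end Heis

namespace Heis

/-! ## Fourier series on the unit interval -/

/-- The character `x ↦ e^{2πimx}`. -/
noncomputable def chr (m : ℤ) (x : ℝ) : ℂ := Complex.exp (2 * Real.pi * Complex.I * m * x)

theorem continuous_chr (m : ℤ) : Continuous (chr m) := by
  unfold chr
  fun_prop

theorem contDiff_chr (m : ℤ) : ContDiff ℝ ∞ (chr m) := by
  unfold chr
  exact Complex.contDiff_exp.comp (contDiff_const.mul Complex.ofRealCLM.contDiff)

theorem norm_chr (m : ℤ) (x : ℝ) : ‖chr m x‖ = 1 := by
  rw [chr, show (2 * Real.pi * Complex.I * m * x : ℂ) = ((2 * Real.pi * m * x : ℝ) : ℂ) * Complex.I by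
    push_cast; ring, Complex.norm_exp_ofReal_mul_I]

theorem chr_ne_zero (m : ℤ) (x : ℝ) : chr m x ≠ 0 := Complex.exp_ne_zero _

theorem chr_add (m : ℤ) (x y : ℝ) : chr m (x + y) = chr m x * chr m y := by
  rw [chr, chr, chr, ← Complex.exp_add]
  congr 1
  push_cast
  ring

theorem chr_add_index (m k : ℤ) (x : ℝ) : chr (m + k) x = chr m x * chr k x := by
  rw [chr, chr, chr, ← Complex.exp_add]
  congr 1
  push_cast
  ring

theorem chr_zero (m : ℤ) : chr m 0 = 1 := by simp [chr]

theorem chr_zero_index (x : ℝ) : chr 0 x = 1 := by simp [chr]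

theorem chr_int (m k : ℤ) : chr m k = 1 := by
  rw [chr, Complex.exp_eq_one_iff]
  exact ⟨m * k, by push_cast; ring⟩

theorem chr_neg_index (m : ℤ) (x : ℝ) : chr (-m) x = (chr m x)⁻¹ := by
  rw [chr, chr, ← Complex.exp_neg]
  congr 1
  push_cast
  ring

theorem conj_chr (m : ℤ) (x : ℝ) : (starRingEnd ℂ) (chr m x) = chr (-m) x := by
  rw [chr, chr, ← Complex.exp_conj]
  congr 1
  simp [Complex.conj_ofNat]

theorem hasDerivAt_chr (m : ℤ) (x : ℝ) :
    HasDerivAt (chr m) (2 * Real.pi * Complex.I * m * chr m x) x := by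
  have h : HasDerivAt (fun x : ℝ => 2 * Real.pi * Complex.I * m * (x : ℂ))
      (2 * Real.pi * Complex.I * m) x := by
    simpa using (Complex.ofRealCLM.hasDerivAt (x := x)).const_mul (2 * Real.pi * Complex.I * m)
  exact h.cexp.congr_deriv (mul_comm _ _)

/-- Lebesgue measure on `[0, 1)`. -/
noncomputable def unitMeas : Measure ℝ := volume.restrict (Set.Ico 0 1)

instance : IsProbabilityMeasure unitMeas := ⟨by simp [unitMeas]⟩

theorem unitMeas_eq_Ioc : unitMeas = volume.restrict (Set.Ioc 0 1) :=
  Measure.restrict_congr_set Ico_ae_eq_Ioc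

theorem integral_unitMeas (f : ℝ → ℂ) : ∫ b, f b ∂unitMeas = ∫ b in (0 : ℝ)..1, f b := by
  rw [unitMeas_eq_Ioc, intervalIntegral.integral_of_le zero_le_one]

/-- The Fourier coefficient of a function on `[0, 1)`. -/
noncomputable def fcoeff (f : ℝ → ℂ) (m : ℤ) : ℂ := ∫ b, chr (-m) b * f b ∂unitMeas

theorem fourierCoeff_liftIoc_eq_fcoeff (f : ℝ → ℂ) (m : ℤ) :
    fourierCoeff (AddCircle.liftIoc (1 : ℝ) 0 f) m = fcoeff f m := by
  rw [fourierCoeff_liftIoc_eq, fourierCoeffOn_eq_integral, fcoeff, integral_unitMeas]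
  simp only [zero_add, sub_zero, div_one, one_smul, smul_eq_mul]
  refine intervalIntegral.integral_congr fun x _ => ?_
  rw [fourier_coe_apply, chr]
  congr 2
  push_cast
  simp

theorem norm_fcoeff_le (f : ℝ → ℂ) (m : ℤ) : ‖fcoeff f m‖ ≤ ∫ b, ‖f b‖ ∂unitMeas := by
  refine (norm_integral_le_integral_norm _).trans (le_of_eq ?_)
  simp [norm_chr]

/-- Parseval's identity on the unit interval, for inner products. -/
theorem hasSum_fcoeff_mul_fcoeff {f g : ℝ → ℂ} (hf : MemLp f 2 unitMeas)
    (hg : MemLp g 2 unitMeas) :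
    HasSum (fun m => fcoeff f m * (starRingEnd ℂ) (fcoeff g m))
      (∫ b, f b * (starRingEnd ℂ) (g b) ∂unitMeas) := by
  have key : ∀ {f : ℝ → ℂ}, MemLp f 2 unitMeas →
      MemLp (AddCircle.liftIoc (1 : ℝ) 0 f) 2 AddCircle.haarAddCircle := by
    intro f hf
    rw [unitMeas_eq_Ioc] at hf
    have h1 : MemLp f 2 (volume.restrict (Set.Ioc (0 : ℝ) (0 + 1))) := by rwa [zero_add]
    exact h1.memLp_liftIoc.haarAddCircle
  have hf' := key hf
  have hg' := key hg
  have h := (fourierBasis (T := (1 : ℝ))).hasSum_inner_mul_inner hg'.toLp hf'.toLp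
  have e : ∀ {f : ℝ → ℂ} (hf : MemLp (AddCircle.liftIoc (1 : ℝ) 0 f) 2 AddCircle.haarAddCircle)
      (m : ℤ), inner ℂ (fourierBasis (T := (1 : ℝ)) m) hf.toLp = fcoeff f m := by
    intro f hf m
    rw [← HilbertBasis.repr_apply_apply, fourierBasis_repr, fourierCoeff_congr_ae hf.coeFn_toLp,
      fourierCoeff_liftIoc_eq_fcoeff]
  have h1 : (fun m => fcoeff f m * (starRingEnd ℂ) (fcoeff g m)) = fun m =>
      inner ℂ hg'.toLp (fourierBasis (T := (1 : ℝ)) m) *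
        inner ℂ (fourierBasis (T := (1 : ℝ)) m) hf'.toLp := by
    funext m
    rw [e, ← inner_conj_symm, e, mul_comm]
  have h2 : ∫ b, f b * (starRingEnd ℂ) (g b) ∂unitMeas = inner ℂ hg'.toLp hf'.toLp := by
    rw [L2.inner_def]
    have h2 : ∀ᵐ x ∂(AddCircle.haarAddCircle (T := (1 : ℝ))),
        inner ℂ ((hg'.toLp _ : Lp ℂ 2 AddCircle.haarAddCircle) x)
          ((hf'.toLp _ : Lp ℂ 2 AddCircle.haarAddCircle) x) =
          AddCircle.liftIoc (1 : ℝ) 0 (fun b => f b * (starRingEnd ℂ) (g b)) x := by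
      filter_upwards [hf'.coeFn_toLp, hg'.coeFn_toLp] with x h1 h2
      rw [h1, h2]
      rfl
    rw [integral_congr_ae h2, AddCircle.integral_haarAddCircle,
      AddCircle.integral_liftIoc_eq_intervalIntegral, zero_add, integral_unitMeas,
      inv_one, one_smul]
  rw [h1, h2]
  exact h

/-- Parseval's identity on the unit interval. -/
theorem hasSum_norm_fcoeff_sq {f : ℝ → ℂ} (hf : MemLp f 2 unitMeas) :
    HasSum (fun m => ‖fcoeff f m‖ ^ 2) (∫ b, ‖f b‖ ^ 2 ∂unitMeas) := by
  have h := hasSum_fcoeff_mul_fcoeff hf hf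
  simp only [Complex.mul_conj, Complex.normSq_eq_norm_sq] at h
  rw [integral_complex_ofReal] at h
  exact_mod_cast h

theorem fcoeff_chr (m k : ℤ) : fcoeff (chr m) k = if m = k then 1 else 0 := by
  have e : ∀ b, chr (-k) b * chr m b = chr (m - k) b := by
    intro b
    rw [← chr_add_index]
    congr 1
    ring
  simp_rw [fcoeff, e]
  split_ifs with h
  · simp [h, chr_zero_index]
  · rw [integral_unitMeas]
    have h0 : (2 * Real.pi * Complex.I * ((m - k : ℤ) : ℂ)) ≠ 0 := by
      have : ((m - k : ℤ) : ℂ) ≠ 0 := by exact_mod_cast sub_ne_zero.2 h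
      exact mul_ne_zero Complex.two_pi_I_ne_zero this
    have hd : ∀ x : ℝ, HasDerivAt
        (fun x => (2 * Real.pi * Complex.I * ((m - k : ℤ) : ℂ))⁻¹ * chr (m - k) x) (chr (m - k) x) x := by
      intro x
      refine ((hasDerivAt_chr (m - k) x).const_mul _).congr_deriv ?_
      rw [inv_mul_cancel_left₀ h0]
    rw [intervalIntegral.integral_eq_sub_of_hasDerivAt (fun x _ => hd x)
      ((continuous_chr _).intervalIntegrable _ _)]
    have h1 := chr_int (m - k) 1
    rw [Int.cast_one] at h1
    rw [h1, chr_zero, sub_self]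

/-- A square integrable function with absolutely summable Fourier coefficients is essentially
bounded by the sum of their absolute values. -/
theorem ae_norm_le_tsum_norm_fcoeff {f : ℝ → ℂ} (hf : MemLp f 2 unitMeas)
    (hs : Summable fun m => ‖fcoeff f m‖) :
    ∀ᵐ b ∂unitMeas, ‖f b‖ ≤ ∑' m, ‖fcoeff f m‖ := by
  -- S is a uniform limit, bounded everywhere by the sum of the absolute values. It has the Fourier
  -- coefficients of f, so f − S vanishes almost everywhere by Parseval.
  set S : ℝ → ℂ := fun b => ∑' m, fcoeff f m * chr m b with hS
  have hn : ∀ m b, ‖fcoeff f m * chr m b‖ = ‖fcoeff f m‖ := fun m b => by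
    rw [norm_mul, norm_chr, mul_one]
  have hScont : Continuous S := continuous_tsum
    (fun m => continuous_const.mul (continuous_chr m)) hs (fun m b => (hn m b).le)
  have hSle : ∀ b, ‖S b‖ ≤ ∑' m, ‖fcoeff f m‖ := fun b => by
    refine (norm_tsum_le_tsum_norm (by simpa only [hn] using hs)).trans ?_
    simp only [hn]
    exact le_rfl
  have hSL : MemLp S 2 unitMeas :=
    MemLp.of_bound hScont.aestronglyMeasurable _ (Filter.Eventually.of_forall hSle)
  have hSc : ∀ k, fcoeff S k = fcoeff f k := by
    intro k
    have h1 : HasSum (fun m => ∫ b, chr (-k) b * (fcoeff f m * chr m b) ∂unitMeas)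
        (∫ b, ∑' m, chr (-k) b * (fcoeff f m * chr m b) ∂unitMeas) := by
      refine hasSum_integral_of_summable_integral_norm (fun m => ?_) ?_
      · refine Integrable.of_bound (C := ‖fcoeff f m‖) (Continuous.aestronglyMeasurable ?_)
          (Filter.Eventually.of_forall fun b => ?_)
        · exact (continuous_chr _).mul (continuous_const.mul (continuous_chr m))
        · rw [norm_mul, norm_chr, one_mul, hn]
      · simp only [norm_mul, norm_chr, one_mul, mul_one]
        simpa using hs
    have h2 : ∀ m, ∫ b, chr (-k) b * (fcoeff f m * chr m b) ∂unitMeas =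
        if m = k then fcoeff f k else 0 := by
      intro m
      simp_rw [mul_left_comm _ (fcoeff f m)]
      rw [integral_const_mul]
      have := fcoeff_chr m k
      rw [fcoeff] at this
      rw [this]
      split_ifs with h <;> simp [h]
    simp_rw [h2, tsum_mul_left] at h1
    exact h1.unique (hasSum_ite_eq k _)
  have hz : ∀ k, fcoeff (f - S) k = 0 := by
    intro k
    rw [← sub_self (fcoeff f k)]
    nth_rewrite 2 [← hSc k]
    rw [fcoeff, fcoeff, fcoeff, ← integral_sub]
    · simp [mul_sub]
    · exact (hf.integrable (by norm_num)).bdd_mul (c := 1)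
        (continuous_chr _).aestronglyMeasurable (Filter.Eventually.of_forall fun b => (norm_chr _ b).le)
    · exact (hSL.integrable (by norm_num)).bdd_mul (c := 1)
        (continuous_chr _).aestronglyMeasurable (Filter.Eventually.of_forall fun b => (norm_chr _ b).le)
  have h0 := hasSum_norm_fcoeff_sq (hf.sub hSL)
  simp only [hz, norm_zero, ne_eq, OfNat.ofNat_ne_zero, not_false_eq_true, zero_pow] at h0
  have h1 := h0.unique hasSum_zero
  rw [integral_eq_zero_iff_of_nonneg (fun b => by positivity)
    ((memLp_two_iff_integrable_sq_norm (hf.sub hSL).1).1 (hf.sub hSL))] at h1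
  filter_upwards [h1] with b hb
  have : f b = S b := by
    simpa [sub_eq_zero] using hb
  rw [this]
  exact hSle b

end Heis

namespace Heis

/-! ## Unfolding sums over integers -/

theorem lintegral_unit_translate (f : ℝ → ℝ≥0∞) (k : ℤ) :
    ∫⁻ x, f (x + k) ∂unitMeas = ∫⁻ x in Set.Ico (k : ℝ) (k + 1), f x := by
  have h := (measurePreserving_add_right (volume : Measure ℝ) (k : ℝ)).setLIntegral_comp_preimage_emb
    (measurableEmbedding_addRight (k : ℝ)) f (Set.Ico (k : ℝ) (k + 1))
  rw [← h, unitMeas]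
  simp

theorem integral_unit_translate (f : ℝ → ℂ) (k : ℤ) :
    ∫ x, f (x + k) ∂unitMeas = ∫ x in Set.Ico (k : ℝ) (k + 1), f x := by
  have h := (measurePreserving_add_right (volume : Measure ℝ) (k : ℝ)).setIntegral_preimage_emb
    (measurableEmbedding_addRight (k : ℝ)) f (Set.Ico (k : ℝ) (k + 1))
  rw [← h, unitMeas]
  simp

theorem lintegral_eq_tsum_unit (f : ℝ → ℝ≥0∞) :
    ∫⁻ x, f x = ∑' k : ℤ, ∫⁻ x, f (x + k) ∂unitMeas := by
  simp_rw [lintegral_unit_translate]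
  rw [← lintegral_iUnion (fun k => measurableSet_Ico) (Set.pairwise_disjoint_Ico_intCast ℝ),
    iUnion_Ico_intCast, setLIntegral_univ]

theorem hasSum_integral_unit {f : ℝ → ℂ} (hf : Integrable f) :
    HasSum (fun k : ℤ => ∫ x, f (x + k) ∂unitMeas) (∫ x, f x) := by
  simp_rw [integral_unit_translate]
  have h := hasSum_integral_iUnion (f := f) (μ := volume) (s := fun k : ℤ => Set.Ico (k : ℝ) (k + 1))
    (fun k => measurableSet_Ico) (Set.pairwise_disjoint_Ico_intCast ℝ) hf.integrableOn
  rwa [iUnion_Ico_intCast, setIntegral_univ] at h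

/-- Integers as pairs of a residue and a multiple of `n`. -/
theorem exists_residue_equiv {n : ℤ} (hn : n ≠ 0) :
    ∃ e : ℤ × Fin n.natAbs ≃ ℤ, ∀ k r, e (k, r) = (r : ℤ) + k * n := by
  have : NeZero n.natAbs := ⟨Int.natAbs_ne_zero.2 hn⟩
  rcases lt_or_gt_of_ne hn with h | h
  · refine ⟨((Equiv.neg ℤ).prodCongr (Equiv.refl _)).trans (Int.divModEquiv n.natAbs).symm,
      fun k r => ?_⟩
    simp [abs_of_neg h]
    ring
  · refine ⟨(Int.divModEquiv n.natAbs).symm, fun k r => ?_⟩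
    simp [abs_of_pos h]
    ring

theorem shift_mul {α : Type*} {n : ℤ} {f : ℤ → ℝ → α} (h : ∀ m a, f (m + n) a = f m (a + 1))
    (m k : ℤ) (a : ℝ) : f (m + k * n) a = f m (a + k) := by
  induction k using Int.induction_on generalizing a with
  | zero => simp
  | succ i ih =>
    rw [add_mul, one_mul, ← add_assoc, h, ih]
    congr 1
    push_cast
    ring
  | pred i ih =>
    have h1 := h (m + (-(i : ℤ) - 1) * n) (a - 1)
    rw [sub_add_cancel] at h1
    rw [← h1, show m + (-(i : ℤ) - 1) * n + n = m + -(i : ℤ) * n by ring, ih]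
    congr 1
    push_cast
    ring

/-- Writing m = r + kn, the function of index m on [0, 1) is that of index r on [k, k + 1). Summing
over k rebuilds an integral over the line for each residue r. -/
theorem tsum_lintegral_unit_eq {n : ℤ} (hn : n ≠ 0) {f : ℤ → ℝ → ℝ≥0∞}
    (h : ∀ m a, f (m + n) a = f m (a + 1)) :
    ∑' m, ∫⁻ a, f m a ∂unitMeas = ∑ r : Fin n.natAbs, ∫⁻ x, f r x := by
  obtain ⟨e, he⟩ := exists_residue_equiv hn
  rw [← e.tsum_eq, ENNReal.tsum_prod', ENNReal.tsum_comm, tsum_fintype]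
  refine Finset.sum_congr rfl fun r _ => ?_
  rw [lintegral_eq_tsum_unit]
  simp only [he, shift_mul h]

theorem tsum_integral_unit_eq {n : ℤ} (hn : n ≠ 0) {f : ℤ → ℝ → ℂ}
    (h : ∀ m a, f (m + n) a = f m (a + 1)) (hi : ∀ m, Integrable (f m))
    (hs : Summable fun m => ∫ a, f m a ∂unitMeas) :
    ∑' m, ∫ a, f m a ∂unitMeas = ∑ r : Fin n.natAbs, ∫ x, f r x := by
  obtain ⟨e, he⟩ := exists_residue_equiv hn
  have hs' : Summable fun c : Fin n.natAbs × ℤ => ∫ a, f (e (c.2, c.1)) a ∂unitMeas :=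
    (Equiv.prodComm _ _).summable_iff.2 (e.summable_iff.2 hs)
  rw [← e.tsum_eq, ← (Equiv.prodComm _ _).tsum_eq]
  refine hs'.tsum_prod.trans ?_
  rw [tsum_fintype]
  refine Finset.sum_congr rfl fun r _ => ?_
  rw [← (hasSum_integral_unit (hi r)).tsum_eq]
  simp only [he, shift_mul h]

end Heis

namespace Heis

/-! ## Theta-like test functions on the nilmanifold -/

/-- The sum `∑_k ψ(a + k) e^{2πi(j + nk)b}`. -/
noncomputable def thetaSum (n j : ℤ) (ψ : ℝ → ℂ) (a b : ℝ) : ℂ :=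
  ∑' k : ℤ, ψ (a + k) * chr (j + n * k) b

theorem chr_mul_int (n i : ℤ) (b : ℝ) : chr n (i * b) = chr (n * i) b := by
  rw [chr, chr]
  congr 1
  push_cast
  ring

/-- Reindexing k by the shift i changes the frequency by ni, which the prefactor compensates. This
is the invariance that lets `testFun` descend to the quotient by Γ. -/
theorem thetaSum_add_int (n j : ℤ) (ψ : ℝ → ℂ) (a b : ℝ) (i p : ℤ) :
    chr n (i * b) * thetaSum n j ψ (i + a) (p + b) = thetaSum n j ψ a b := by
  rw [thetaSum, thetaSum, ← tsum_mul_left, ← (Equiv.addRight i).tsum_eq (fun k : ℤ =>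
    ψ (a + k) * chr (j + n * k) b)]
  refine tsum_congr fun k => ?_
  rw [chr_mul_int, chr_add, chr_int, one_mul, mul_left_comm, ← chr_add_index]
  simp only [Equiv.coe_addRight]
  congr 2
  · push_cast
    ring
  · ring

/-- The function `Γ(a, b, c) ↦ e^{2πinc} ∑_k ψ(a + k) e^{2πi(j + nk)b}` on the nilmanifold. -/
noncomputable def testFun (n j : ℤ) (ψ : ℝ → ℂ) : M → ℂ :=
  Quotient.lift (fun x : Heis => chr n x.c * thetaSum n j ψ x.a x.b) (by
    rintro x y ⟨⟨γ, ⟨i, hi⟩, ⟨p, hp⟩, ⟨q, hq⟩⟩, rfl⟩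
    change chr n (γ * y).c * thetaSum n j ψ (γ * y).a (γ * y).b = _
    rw [mul_a, mul_b, mul_c, hi, hp, hq, chr_add, chr_add, chr_int, one_mul, mul_assoc,
      thetaSum_add_int])

theorem testFun_cls (n j : ℤ) (ψ : ℝ → ℂ) (a b c : ℝ) :
    testFun n j ψ (cls a b c) = chr n c * thetaSum n j ψ a b := rfl

theorem rightTranslate_cls (g : Heis) (a b c : ℝ) :
    rightTranslate g (cls a b c) = cls (a + g.a) (b + g.b) (c + g.c + a * g.b) := rfl

theorem exists_cls (x : M) : ∃ a b c, x = cls a b c := by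
  induction x using Quotient.inductionOn with
  | h x => exact ⟨x.a, x.b, x.c, rfl⟩

theorem eq_zero_of_forall_notMem_Icc {ψ : ℝ → ℂ} {R A a : ℝ} (hR : ∀ x, R < |x| → ψ x = 0)
    (ha : |a| ≤ A) {K : ℕ} (hK : R + A < K) {k : ℤ} (hk : k ∉ Finset.Icc (-(K : ℤ)) K) :
    ψ (a + k) = 0 := by
  refine hR _ ?_
  have h1 : (K : ℤ) < |k| := by
    by_contra h
    rw [not_lt, abs_le] at h
    exact hk (Finset.mem_Icc.2 h)
  have h2 : (K : ℝ) < |(k : ℝ)| := by exact_mod_cast h1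
  have h3 : |(k : ℝ)| ≤ |a + k| + |a| := by
    have := abs_sub (a + k) a
    rwa [add_sub_cancel_left] at this
  linarith

/-- The range K depends on a only through the bound A, so near any point the series is one fixed
finite sum and may be differentiated term by term. -/
theorem thetaSum_eq_sum (n j : ℤ) {ψ : ℝ → ℂ} {R A a : ℝ} (hR : ∀ x, R < |x| → ψ x = 0)
    (ha : |a| ≤ A) {K : ℕ} (hK : R + A < K) (b : ℝ) :
    thetaSum n j ψ a b = ∑ k ∈ Finset.Icc (-(K : ℤ)) K, ψ (a + k) * chr (j + n * k) b :=
  tsum_eq_sum fun k hk => by rw [eq_zero_of_forall_notMem_Icc hR ha hK hk, zero_mul]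

theorem HasCompactSupport.exists_bound {ψ : ℝ → ℂ} (h : HasCompactSupport ψ) :
    ∃ R, ∀ x, R < |x| → ψ x = 0 := by
  obtain ⟨R, -, hR⟩ := h.exists_pos_le_norm
  exact ⟨R, fun x hx => hR x (by rw [Real.norm_eq_abs]; exact hx.le)⟩

theorem isSmooth_testFun (n j : ℤ) {ψ : ℝ → ℂ} (hψ : ContDiff ℝ ∞ ψ) (hc : HasCompactSupport ψ) :
    IsSmooth (testFun n j ψ) := by
  obtain ⟨R, hR⟩ := HasCompactSupport.exists_bound hc
  unfold IsSmooth
  simp only [testFun_cls]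
  refine ((contDiff_chr n).comp (contDiff_snd.comp contDiff_snd)).mul ?_
  rw [contDiff_iff_contDiffAt]
  intro p
  obtain ⟨K, hK⟩ := exists_nat_gt (R + (|p.1| + 1))
  have hsum : ContDiff ℝ ∞ fun q : ℝ × ℝ × ℝ =>
      ∑ k ∈ Finset.Icc (-(K : ℤ)) K, ψ (q.1 + k) * chr (j + n * k) q.2.1 :=
    ContDiff.sum fun k _ => (hψ.comp (contDiff_fst.add contDiff_const)).mul
      ((contDiff_chr _).comp (contDiff_fst.comp contDiff_snd))
  refine hsum.contDiffAt.congr_of_eventuallyEq ?_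
  have hcont : Continuous fun q : ℝ × ℝ × ℝ => |q.1| := by fun_prop
  filter_upwards [hcont.continuousAt.eventually_lt continuousAt_const
    (show |p.1| < |p.1| + 1 by linarith)] with q hq
  exact thetaSum_eq_sum n j hR hq.le hK _

theorem fieldA_testFun (n j : ℤ) {ψ : ℝ → ℂ} (hψ : ContDiff ℝ ∞ ψ) (hc : HasCompactSupport ψ) :
    fieldA (testFun n j ψ) = testFun n j (deriv ψ) := by
  obtain ⟨R, hR⟩ := HasCompactSupport.exists_bound hc
  obtain ⟨R', hR'⟩ := HasCompactSupport.exists_bound hc.deriv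
  funext x
  obtain ⟨a, b, c, rfl⟩ := exists_cls x
  simp only [fieldA, rightTranslate_cls, testFun_cls, mul_zero, add_zero]
  obtain ⟨K, hK⟩ := exists_nat_gt (max R R' + (|a| + 1))
  have hK1 : R + (|a| + 1) < K := lt_of_le_of_lt (by gcongr; exact le_max_left _ _) hK
  have hK2 : R' + (|a| + 1) < K := lt_of_le_of_lt (by gcongr; exact le_max_right _ _) hK
  rw [thetaSum_eq_sum n j hR' (by linarith : |a| ≤ |a| + 1) hK2]
  refine HasDerivAt.deriv (HasDerivAt.const_mul _ ?_)
  have hd : HasDerivAt (fun t : ℝ => ∑ k ∈ Finset.Icc (-(K : ℤ)) K,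
      ψ (a + t + k) * chr (j + n * k) b)
      (∑ k ∈ Finset.Icc (-(K : ℤ)) K, deriv ψ (a + k) * chr (j + n * k) b) 0 := by
    refine HasDerivAt.fun_sum fun k _ => HasDerivAt.mul_const ?_ _
    have h1 : HasDerivAt ψ (deriv ψ (a + k)) (a + 0 + k) := by
      rw [add_zero]
      exact (hψ.differentiable (by simp) _).hasDerivAt
    have h2 : HasDerivAt (fun t : ℝ => a + t + k) 1 0 :=
      ((hasDerivAt_id (0 : ℝ)).const_add a).add_const _
    exact (h1.scomp (0 : ℝ) h2).congr_deriv (one_smul _ _)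
  refine hd.congr_of_eventuallyEq ?_
  have hcont : Continuous fun t : ℝ => |a + t| := by fun_prop
  filter_upwards [hcont.continuousAt.eventually_lt continuousAt_const
    (show |a + 0| < |a| + 1 by rw [add_zero]; linarith)] with t ht
  exact thetaSum_eq_sum n j hR ht.le hK1 _

/-- The derivative in b brings down the frequency j + nk and the part a∂_c brings down na. Together
they make n(a + k) + j, a function of the argument a + k of ψ alone. -/
theorem fieldB_testFun (n j : ℤ) {ψ : ℝ → ℂ} (hc : HasCompactSupport ψ) :
    fieldB (testFun n j ψ) =
      testFun n j (fun x => 2 * Real.pi * Complex.I * (n * x + j) * ψ x) := by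
  obtain ⟨R, hR⟩ := HasCompactSupport.exists_bound hc
  have hR' : ∀ x, R < |x| → 2 * Real.pi * Complex.I * (n * x + j) * ψ x = 0 := fun x hx => by
    rw [hR x hx, mul_zero]
  funext x
  obtain ⟨a, b, c, rfl⟩ := exists_cls x
  simp only [fieldB, rightTranslate_cls, testFun_cls, add_zero]
  obtain ⟨K, hK⟩ := exists_nat_gt (R + |a|)
  simp only [thetaSum_eq_sum n j hR le_rfl hK, thetaSum_eq_sum n j hR' le_rfl hK]
  have h1 : HasDerivAt (fun t : ℝ => chr n (c + a * t))
      (2 * Real.pi * Complex.I * n * a * chr n c) 0 := by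
    have h2 : HasDerivAt (fun t : ℝ => c + a * t) a 0 := by
      simpa using ((hasDerivAt_id (0 : ℝ)).const_mul a).const_add c
    have h3 : HasDerivAt (chr n) (2 * Real.pi * Complex.I * n * chr n c) (c + a * 0) := by
      rw [mul_zero, add_zero]
      exact hasDerivAt_chr n c
    refine (h3.scomp (0 : ℝ) h2).congr_deriv ?_
    rw [Complex.real_smul]
    ring
  have h4 : ∀ m : ℤ, HasDerivAt (fun t : ℝ => chr m (b + t))
      (2 * Real.pi * Complex.I * m * chr m b) 0 := by
    intro m
    have h3 : HasDerivAt (chr m) (2 * Real.pi * Complex.I * m * chr m b) (b + 0) := by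
      rw [add_zero]
      exact hasDerivAt_chr m b
    exact (h3.scomp (0 : ℝ) ((hasDerivAt_id (0 : ℝ)).const_add b)).congr_deriv (one_smul _ _)
  have h5 : HasDerivAt (fun t : ℝ => ∑ k ∈ Finset.Icc (-(K : ℤ)) K,
      ψ (a + k) * chr (j + n * k) (b + t)) (∑ k ∈ Finset.Icc (-(K : ℤ)) K,
      ψ (a + k) * (2 * Real.pi * Complex.I * (j + n * k : ℤ) * chr (j + n * k) b)) 0 :=
    HasDerivAt.fun_sum fun k _ => (h4 _).const_mul _
  refine ((h1.mul h5).congr_deriv ?_).deriv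
  simp only [mul_zero, add_zero]
  rw [Finset.mul_sum, Finset.mul_sum, ← Finset.sum_add_distrib, Finset.mul_sum]
  refine Finset.sum_congr rfl fun k _ => ?_
  push_cast
  ring

theorem testFun_add (n j : ℤ) {ψ φ : ℝ → ℂ} (hψ : HasCompactSupport ψ) (hφ : HasCompactSupport φ)
    (x : M) : testFun n j (fun y => ψ y + φ y) x = testFun n j ψ x + testFun n j φ x := by
  obtain ⟨R, hR⟩ := HasCompactSupport.exists_bound hψ
  obtain ⟨R', hR'⟩ := HasCompactSupport.exists_bound hφ
  obtain ⟨a, b, c, rfl⟩ := exists_cls x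
  obtain ⟨K, hK⟩ := exists_nat_gt (max R R' + |a|)
  have h1 : ∀ x, max R R' < |x| → ψ x = 0 := fun x hx => hR x ((le_max_left _ _).trans_lt hx)
  have h2 : ∀ x, max R R' < |x| → φ x = 0 := fun x hx => hR' x ((le_max_right _ _).trans_lt hx)
  simp only [testFun_cls]
  rw [thetaSum_eq_sum n j h1 le_rfl hK, thetaSum_eq_sum n j h2 le_rfl hK,
    thetaSum_eq_sum n j (R := max R R') (fun x hx => by rw [h1 x hx, h2 x hx, add_zero]) le_rfl hK,
    ← mul_add, ← Finset.sum_add_distrib]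
  simp only [add_mul]

theorem testFun_neg (n j : ℤ) (ψ : ℝ → ℂ) (x : M) :
    testFun n j (fun y => -ψ y) x = -testFun n j ψ x := by
  obtain ⟨a, b, c, rfl⟩ := exists_cls x
  simp only [testFun_cls, thetaSum, neg_mul, tsum_neg, mul_neg]

/-- On these test functions the sub-Laplacian is a harmonic oscillator acting on ψ; this carries the
eigenvalue equation from the nilmanifold to the line. -/
theorem subLaplacian_testFun (n j : ℤ) {ψ : ℝ → ℂ} (hψ : ContDiff ℝ ∞ ψ)
    (hc : HasCompactSupport ψ) :
    subLaplacian (testFun n j ψ) = testFun n j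
      (fun x => -deriv (deriv ψ) x + 4 * Real.pi ^ 2 * (n * x + j) ^ 2 * ψ x) := by
  have hψ' : ContDiff ℝ ∞ (deriv ψ) := (contDiff_infty_iff_deriv.1 hψ).2
  have e : (fun x : ℝ => 2 * Real.pi * Complex.I * (n * x + j) *
      (2 * Real.pi * Complex.I * (n * x + j) * ψ x)) =
      fun x : ℝ => -(4 * Real.pi ^ 2 * (n * x + j) ^ 2 * ψ x) := by
    funext x
    linear_combination (4 * Real.pi ^ 2 * (n * x + j) ^ 2 * ψ x : ℂ) * Complex.I_sq
  have hc' : HasCompactSupport fun x : ℝ => 2 * Real.pi * Complex.I * (n * x + j) * ψ x :=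
    hc.mul_left
  have h1 : HasCompactSupport fun x : ℝ => -deriv (deriv ψ) x :=
    hc.deriv.deriv.comp_left (g := fun z => -z) neg_zero
  have h2 : HasCompactSupport fun x : ℝ => 4 * Real.pi ^ 2 * (n * x + j) ^ 2 * ψ x :=
    hc.mul_left
  funext x
  rw [subLaplacian, fieldA_testFun n j hψ hc, fieldA_testFun n j hψ' hc.deriv,
    fieldB_testFun n j hc, fieldB_testFun n j hc', e, testFun_neg,
    testFun_add n j h1 h2, testFun_neg, neg_add, neg_neg]

end Heis

namespace Heis

/-! ## Integration on the nilmanifold -/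

/-- Lebesgue measure on the unit cube. -/
noncomputable def cubeMeas : Measure (ℝ × ℝ × ℝ) := unitMeas.prod (unitMeas.prod unitMeas)

instance : IsProbabilityMeasure cubeMeas := by
  unfold cubeMeas
  infer_instance

theorem vol_eq : vol = Measure.map (fun p : ℝ × ℝ × ℝ => cls p.1 p.2.1 p.2.2) cubeMeas := by
  rw [vol, cubeMeas, unitMeas, Measure.prod_restrict, Measure.prod_restrict, Measure.volume_eq_prod,
    Measure.volume_eq_prod]

instance : IsProbabilityMeasure vol := by
  rw [vol_eq]
  exact Measure.isProbabilityMeasure_map measurable_cls.aemeasurable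

theorem measurable_of_comp_cls {β : Type*} [MeasurableSpace β] {f : M → β}
    (h : Measurable fun p : ℝ × ℝ × ℝ => f (cls p.1 p.2.1 p.2.2)) : Measurable f := by
  refine measurable_from_quotient.2 ?_
  have h1 : Measurable fun x : Heis => (x.a, x.b, x.c) := comap_measurable _
  exact h.comp h1

theorem lintegral_vol {h : M → ℝ≥0∞} (hh : Measurable h) :
    ∫⁻ x, h x ∂vol = ∫⁻ a, ∫⁻ b, ∫⁻ c, h (cls a b c) ∂unitMeas ∂unitMeas ∂unitMeas := by
  have hm : Measurable fun p : ℝ × ℝ × ℝ => h (cls p.1 p.2.1 p.2.2) := hh.comp measurable_cls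
  rw [vol_eq, lintegral_map hh measurable_cls, cubeMeas, lintegral_prod _ hm.aemeasurable]
  refine lintegral_congr fun a => ?_
  rw [lintegral_prod]
  exact (hm.comp measurable_prodMk_left).aemeasurable

theorem lintegral_unit_periodic {f : ℝ → ℝ≥0∞} (hf : Function.Periodic f 1) (t : ℝ) :
    ∫⁻ c, f (c + t) ∂unitMeas = ∫⁻ c, f c ∂unitMeas := by
  have h := (measurePreserving_add_right (volume : Measure ℝ) t).setLIntegral_comp_preimage_emb
    (measurableEmbedding_addRight t) f (Set.Ioc t (t + 1))
  rw [unitMeas_eq_Ioc]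
  have e : (fun x : ℝ => x + t) ⁻¹' Set.Ioc t (t + 1) = Set.Ioc 0 1 := by
    ext x
    simp only [Set.mem_preimage, Set.mem_Ioc]
    constructor <;> rintro ⟨h1, h2⟩ <;> constructor <;> linarith
  rw [e] at h
  rw [h]
  have d := (isAddFundamentalDomain_Ioc (zero_lt_one' ℝ) t).setLIntegral_eq
    (isAddFundamentalDomain_Ioc (zero_lt_one' ℝ) 0) f hf.map_vadd_zmultiples
  rwa [zero_add] at d

theorem cls_add_one_c (a b c : ℝ) : cls a b (c + 1) = cls a b c := by
  refine Quotient.sound ?_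
  refine ⟨⟨⟨0, 0, 1⟩, ⟨0, by simp⟩, ⟨0, by simp⟩, ⟨1, by simp⟩⟩, ?_⟩
  change (⟨0, 0, 1⟩ : Heis) * ⟨a, b, c⟩ = _
  ext <;> simp [add_comm]

theorem cls_add_one_a (a b c : ℝ) : cls (a + 1) b (c + b) = cls a b c := by
  refine Quotient.sound ?_
  refine ⟨⟨⟨1, 0, 0⟩, ⟨1, by simp⟩, ⟨0, by simp⟩, ⟨0, by simp⟩⟩, ?_⟩
  change (⟨1, 0, 0⟩ : Heis) * ⟨a, b, c⟩ = _
  ext <;> simp [add_comm]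

/-! ## Central translations -/

/-- Right translation by the central element `(0, 0, t)`. -/
noncomputable def central (t : ℝ) : M → M := rightTranslate ⟨0, 0, t⟩

theorem central_cls (t a b c : ℝ) : central t (cls a b c) = cls a b (c + t) := by
  simp [central, rightTranslate_cls]

theorem central_rightTranslate (t : ℝ) (g : Heis) (x : M) :
    central t (rightTranslate g x) = rightTranslate g (central t x) := by
  obtain ⟨a, b, c, rfl⟩ := exists_cls x
  simp only [rightTranslate_cls, central_cls]
  congr 1
  ring

theorem central_central (s t : ℝ) (x : M) : central s (central t x) = central (s + t) x := by
  obtain ⟨a, b, c, rfl⟩ := exists_cls x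
  simp only [central_cls]
  congr 1
  ring

theorem measurable_central (t : ℝ) : Measurable (central t) := by
  refine measurable_of_comp_cls ?_
  simp only [central_cls]
  exact measurable_cls.comp (by fun_prop : Measurable fun p : ℝ × ℝ × ℝ => (p.1, p.2.1, p.2.2 + t))

/-- Only the coordinate c moves, and functions on the nilmanifold are 1-periodic in c. -/
theorem measurePreserving_central (t : ℝ) : MeasurePreserving (central t) vol vol := by
  refine ⟨measurable_central t, ?_⟩
  ext S hS
  have h1 : Measurable (S.indicator (1 : M → ℝ≥0∞)) := measurable_one.indicator hS
  rw [← lintegral_indicator_one hS, ← lintegral_indicator_one hS (μ := vol),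
    lintegral_map h1 (measurable_central t), lintegral_vol h1,
    lintegral_vol (h := fun x => S.indicator (1 : M → ℝ≥0∞) (central t x))
      (h1.comp (measurable_central t))]
  refine lintegral_congr fun a => lintegral_congr fun b => ?_
  simp only [central_cls]
  exact lintegral_unit_periodic (f := fun c => S.indicator 1 (cls a b c))
    (fun c => by simp only [cls_add_one_c]) t

/-- The unitary operator on `L²` of a central translation. -/
noncomputable def centralOp (t : ℝ) : L2 →ₗᵢ[ℂ] L2 :=
  Lp.compMeasurePreservingₗᵢ ℂ (central t) (measurePreserving_central t)

theorem coeFn_centralOp (t : ℝ) (f : L2) : centralOp t f =ᵐ[vol] fun x => f (central t x) :=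
  Lp.coeFn_compMeasurePreserving f (measurePreserving_central t)

theorem ae_eq_comp_central {f : M → ℂ} {g : M → ℂ} (h : f =ᵐ[vol] g) (t : ℝ) :
    (fun x => f (central t x)) =ᵐ[vol] fun x => g (central t x) :=
  (measurePreserving_central t).quasiMeasurePreserving.ae_eq_comp h

theorem centralOp_neg_centralOp (t : ℝ) (f : L2) : centralOp (-t) (centralOp t f) = f := by
  refine Lp.ext ?_
  refine (coeFn_centralOp _ _).trans ((ae_eq_comp_central (coeFn_centralOp t f) (-t)).trans ?_)
  refine Filter.Eventually.of_forall fun x => ?_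
  simp only
  rw [central_central, add_neg_cancel]
  congr 1
  obtain ⟨a, b, c, rfl⟩ := exists_cls x
  rw [central_cls, add_zero]

theorem inner_centralOp_right (t : ℝ) (f g : L2) :
    inner ℂ f (centralOp t g) = inner ℂ (centralOp (-t) f) g := by
  rw [← (centralOp (-t)).inner_map_map, centralOp_neg_centralOp]

theorem isSmooth_comp_central {φ : M → ℂ} (hφ : IsSmooth φ) (t : ℝ) :
    IsSmooth fun x => φ (central t x) := by
  unfold IsSmooth at *
  simp only [central_cls]
  exact hφ.comp (by fun_prop : ContDiff ℝ ∞ fun p : ℝ × ℝ × ℝ => (p.1, p.2.1, p.2.2 + t))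

/-- The two fields are generated by right translations, with which central translations commute. -/
theorem subLaplacian_comp_central (φ : M → ℂ) (t : ℝ) :
    subLaplacian (fun x => φ (central t x)) = fun x => subLaplacian φ (central t x) := by
  have hA : ∀ φ : M → ℂ, fieldA (fun x => φ (central t x)) = fun x => fieldA φ (central t x) := by
    intro φ
    funext x
    simp only [fieldA, central_rightTranslate]
  have hB : ∀ φ : M → ℂ, fieldB (fun x => φ (central t x)) = fun x => fieldB φ (central t x) := by
    intro φ
    funext x
    simp only [fieldB, central_rightTranslate]
  funext x
  simp only [subLaplacian, hA, hB]

theorem centralOp_mem_graph {p : L2 × L2} (hp : p ∈ subLaplacianGraph) (t : ℝ) :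
    (centralOp t p.1, centralOp t p.2) ∈ subLaplacianGraph := by
  obtain ⟨φ, hφ, h1, h2⟩ := hp
  refine ⟨fun x => φ (central t x), isSmooth_comp_central hφ t,
    (coeFn_centralOp _ _).trans (ae_eq_comp_central h1 t), ?_⟩
  rw [subLaplacian_comp_central]
  exact (coeFn_centralOp _ _).trans (ae_eq_comp_central h2 t)

theorem centralOp_mem_eigenspace {e : ℝ} {f : L2} (hf : f ∈ eigenspace e) (t : ℝ) :
    centralOp t f ∈ eigenspace e := by
  intro p hp
  rw [inner_centralOp_right, ← map_smul, inner_centralOp_right]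
  exact hf _ (centralOp_mem_graph hp (-t))

/-- The unitary group of central translations preserves the eigenspace. Invariance under −t gives
invariance of the orthogonal complement as well, so the projection commutes with the group. -/
theorem specProj_centralOp (m : ℝ) (t : ℝ) (f : L2) :
    specProj m (centralOp t f) = centralOp t (specProj m f) := by
  refine Submodule.eq_starProjection_of_mem_of_inner_eq_zero
    (centralOp_mem_eigenspace (Submodule.starProjection_apply_mem _ _) t) fun w hw => ?_
  rw [← map_sub, ← inner_conj_symm, inner_centralOp_right]
  have h := Submodule.sub_starProjection_mem_orthogonal (K := eigenspace (m ^ 2)) f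
  rw [Submodule.mem_orthogonal] at h
  rw [specProj, h _ (centralOp_mem_eigenspace hw (-t)), map_zero]

theorem centralOp_of_mem_fourierSpace {n : ℤ} {f : L2} (hf : f ∈ fourierSpace n) (t : ℝ) :
    centralOp t f = chr n t • f := by
  obtain ⟨φ, h1, h2⟩ := hf
  refine Lp.ext ?_
  refine (coeFn_centralOp _ _).trans ((ae_eq_comp_central h1 t).trans ?_)
  filter_upwards [Lp.coeFn_smul (chr n t) f, h1] with x hx hx'
  rw [hx, Pi.smul_apply, hx', smul_eq_mul]
  obtain ⟨a, b, c, rfl⟩ := exists_cls x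
  rw [central_cls, h2 a b (c + t), h2 a b c]
  change _ * chr n (c + t) = chr n t * (_ * chr n c)
  rw [chr_add]
  ring

/-- The spectral projection keeps the central character. This makes the image a joint eigenfunction
without any commutation of the two projections. -/
theorem centralOp_specProj_fourierProj (m : ℝ) (n : ℤ) (f : L2) (t : ℝ) :
    centralOp t (specProj m (fourierProj n f)) = chr n t • specProj m (fourierProj n f) := by
  have h : fourierProj n f ∈ fourierSpace n := Submodule.starProjection_apply_mem _ _
  rw [← specProj_centralOp, centralOp_of_mem_fourierSpace h, map_smul]

/-! ### Representatives with exact central character -/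

theorem ae_vol_of_ae_cube {P : M → Prop} (hP : MeasurableSet {x | P x})
    (h : ∀ᵐ p ∂cubeMeas, P (cls p.1 p.2.1 p.2.2)) : ∀ᵐ x ∂vol, P x := by
  rw [vol_eq, ae_map_iff measurable_cls.aemeasurable hP]
  exact h

theorem ae_cube_of_ae_vol {P : M → Prop} (h : ∀ᵐ x ∂vol, P x) :
    ∀ᵐ p ∂cubeMeas, P (cls p.1 p.2.1 p.2.2) := by
  rw [vol_eq] at h
  exact ae_of_ae_map measurable_cls.aemeasurable h

/-- An element of `L²` on which the centre acts by the `n`-th character has a measurable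
representative on which it does so everywhere. -/
theorem exists_measurable_representative {n : ℤ} {f : L2}
    (hf : ∀ t, centralOp t f = chr n t • f) :
    ∃ φ : M → ℂ, Measurable φ ∧ f =ᵐ[vol] φ ∧
      ∀ a b c, φ (cls a b c) = φ (cls a b 0) * chr n c := by
  set F : M → ℂ := fun x => f x with hF
  have hFm : Measurable F := (Lp.stronglyMeasurable f).measurable
  have hjoint : Measurable fun q : (ℝ × ℝ × ℝ) × ℝ =>
      F (cls q.1.1 q.1.2.1 (q.1.2.2 + q.2)) * chr (-n) q.2 := by
    refine Measurable.mul ?_ ((continuous_chr _).measurable.comp measurable_snd)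
    exact hFm.comp (measurable_cls.comp (by fun_prop :
      Measurable fun q : (ℝ × ℝ × ℝ) × ℝ => (q.1.1, q.1.2.1, q.1.2.2 + q.2)))
  -- Averaging over the centre against the inverse character projects onto frequency n at every
  -- point. Where the integrand is not integrable the integral is 0 along the whole central orbit,
  -- so the identity holds there too.
  set φ : M → ℂ := fun x => ∫ t, F (central t x) * chr (-n) t ∂unitMeas with hφ
  have hφm : Measurable φ := by
    refine measurable_of_comp_cls ?_
    simp only [hφ, central_cls]
    exact (hjoint.stronglyMeasurable.integral_prod_right (ν := unitMeas)).measurable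
  refine ⟨φ, hφm, ?_, ?_⟩
  · refine ae_vol_of_ae_cube (measurableSet_eq_fun hFm hφm) ?_
    have h1 : ∀ t : ℝ, ∀ᵐ p ∂cubeMeas,
        F (cls p.1 p.2.1 (p.2.2 + t)) * chr (-n) t = F (cls p.1 p.2.1 p.2.2) := by
      intro t
      have h2 : ∀ᵐ x ∂vol, F (central t x) = chr n t * F x := by
        have h3 := coeFn_centralOp t f
        rw [hf t] at h3
        filter_upwards [h3, Lp.coeFn_smul (chr n t) f] with x hx hx'
        exact hx.symm.trans hx'
      filter_upwards [ae_cube_of_ae_vol h2] with p hp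
      rw [central_cls] at hp
      rw [hp, chr_neg_index]
      field_simp [chr_ne_zero]
    have hms : MeasurableSet {q : (ℝ × ℝ × ℝ) × ℝ |
        F (cls q.1.1 q.1.2.1 (q.1.2.2 + q.2)) * chr (-n) q.2 = F (cls q.1.1 q.1.2.1 q.1.2.2)} :=
      measurableSet_eq_fun hjoint (hFm.comp (measurable_cls.comp measurable_fst))
    have h4 : ∀ᵐ q ∂(unitMeas.prod cubeMeas),
        F (cls q.2.1 q.2.2.1 (q.2.2.2 + q.1)) * chr (-n) q.1 = F (cls q.2.1 q.2.2.1 q.2.2.2) := by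
      exact (Measure.ae_prod_iff_ae_ae (measurable_swap hms)).2 (Filter.Eventually.of_forall h1)
    -- The exceptional null set depends on t; Fubini exchanges the quantifiers, so that for almost
    -- every p the average is that of a constant.
    have h5 : ∀ᵐ p ∂cubeMeas, ∀ᵐ t ∂unitMeas,
        F (cls p.1 p.2.1 (p.2.2 + t)) * chr (-n) t = F (cls p.1 p.2.1 p.2.2) := by
      have h6 := Measure.measurePreserving_swap (μ := cubeMeas) (ν := unitMeas)
        |>.quasiMeasurePreserving.ae h4
      exact Measure.ae_ae_of_ae_prod h6
    filter_upwards [h5] with p hp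
    simp only [hφ, central_cls]
    rw [integral_congr_ae hp]
    simp [hF]
  · intro a b c
    simp only [hφ, central_cls, zero_add]
    set u : ℝ → ℂ := fun t => F (cls a b t) * chr (-n) t with hu
    have hper : Function.Periodic u 1 := by
      intro t
      have h1 := chr_int (-n) 1
      rw [Int.cast_one] at h1
      simp only [hu]
      rw [cls_add_one_c, chr_add, h1, mul_one]
    have e : ∀ t, F (cls a b (c + t)) * chr (-n) t = u (t + c) * chr n c := by
      intro t
      simp only [hu]
      rw [chr_add, chr_neg_index n c, add_comm c t]
      field_simp [chr_ne_zero]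
    simp_rw [e]
    rw [integral_mul_const]
    congr 1
    rw [integral_unitMeas, integral_unitMeas, intervalIntegral.integral_comp_add_right, zero_add,
      add_comm 1 c, hper.intervalIntegral_add_eq c 0, zero_add]

end Heis

namespace Heis

/-! ## Profiles: quasi-periodic square integrable functions of two variables -/

/-- A function `g` on the plane such that `g(a, b) e^{2πinc}` comes from a square integrable
function on the nilmanifold. -/
structure Profile (n : ℤ) (g : ℝ → ℝ → ℂ) : Prop where
  measurable : Measurable (Function.uncurry g)
  quasi : ∀ a b, g (a + 1) b = g a b * chr (-n) b
  finite : ∫⁻ a, ∫⁻ b, ‖g a b‖ₑ ^ 2 ∂unitMeas ∂unitMeas ≠ ⊤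

/-- The Fourier coefficient in the second variable. -/
noncomputable def partialCoeff (g : ℝ → ℝ → ℂ) (m : ℤ) (a : ℝ) : ℂ := fcoeff (g a) m

theorem lintegral_vol_of_central {n : ℤ} {φ : M → ℂ} (hφ : Measurable φ)
    (h : ∀ a b c, φ (cls a b c) = φ (cls a b 0) * chr n c) (p : ℕ) :
    ∫⁻ x, ‖φ x‖ₑ ^ p ∂vol = ∫⁻ a, ∫⁻ b, ‖φ (cls a b 0)‖ₑ ^ p ∂unitMeas ∂unitMeas := by
  rw [lintegral_vol (hφ.enorm.pow_const p)]
  refine lintegral_congr fun a => lintegral_congr fun b => ?_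
  have e : ∀ c, ‖φ (cls a b c)‖ₑ ^ p = ‖φ (cls a b 0)‖ₑ ^ p := by
    intro c
    rw [h, enorm_mul, ← ofReal_norm (chr n c), norm_chr]
    simp
  simp [e]

theorem lintegral_enorm_sq_eq (f : L2) : ∫⁻ x, ‖f x‖ₑ ^ 2 ∂vol = ENNReal.ofReal (‖f‖ ^ 2) := by
  have h := eLpNorm_nnreal_pow_eq_lintegral (f := f) (μ := vol) (p := 2) (by norm_num)
  simp only [NNReal.coe_ofNat, ENNReal.rpow_ofNat, ENNReal.coe_ofNat] at h
  rw [← h, Lp.norm_def, ENNReal.ofReal_pow ENNReal.toReal_nonneg,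
    ENNReal.ofReal_toReal (Lp.eLpNorm_ne_top f)]

theorem profile_of_central {n : ℤ} {φ : M → ℂ} {f : L2} (hφ : Measurable φ) (hf : f =ᵐ[vol] φ)
    (h : ∀ a b c, φ (cls a b c) = φ (cls a b 0) * chr n c) :
    Profile n fun a b => φ (cls a b 0) := by
  refine ⟨?_, fun a b => ?_, ?_⟩
  · exact hφ.comp (measurable_cls.comp (by fun_prop :
      Measurable fun q : ℝ × ℝ => (q.1, q.2, (0 : ℝ))))
  · have h1 := h (a + 1) b b
    have h2 := cls_add_one_a a b 0
    rw [zero_add] at h2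
    rw [h2] at h1
    rw [h1, chr_neg_index, mul_inv_cancel_right₀ (chr_ne_zero _ _)]
  · rw [← lintegral_vol_of_central hφ h]
    have e : ∫⁻ x, ‖φ x‖ₑ ^ 2 ∂vol = ∫⁻ x, ‖f x‖ₑ ^ 2 ∂vol :=
      lintegral_congr_ae (hf.mono fun x hx => by simp only [hx])
    rw [e, lintegral_enorm_sq_eq]
    exact ENNReal.ofReal_ne_top

theorem tsum_enorm_fcoeff_sq {f : ℝ → ℂ} (hf : MemLp f 2 unitMeas) :
    ∑' m, ‖fcoeff f m‖ₑ ^ 2 = ∫⁻ b, ‖f b‖ₑ ^ 2 ∂unitMeas := by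
  have h := hasSum_norm_fcoeff_sq hf
  have e : ∀ z : ℂ, ‖z‖ₑ ^ 2 = ENNReal.ofReal (‖z‖ ^ 2) := fun z => by
    rw [ENNReal.ofReal_pow (norm_nonneg _), ofReal_norm]
  simp only [e]
  rw [← ofReal_integral_eq_lintegral_ofReal
    ((memLp_two_iff_integrable_sq_norm hf.1).1 hf) (Filter.Eventually.of_forall fun b => by positivity),
    ← h.tsum_eq, ENNReal.ofReal_tsum_of_nonneg (fun m => by positivity) h.summable]

namespace Profile

variable {n : ℤ} {g : ℝ → ℝ → ℂ}

theorem measurable_left (hg : Profile n g) (a : ℝ) : Measurable (g a) :=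
  hg.measurable.comp measurable_prodMk_left

theorem measurable_lintegral (hg : Profile n g) :
    Measurable fun a => ∫⁻ b, ‖g a b‖ₑ ^ 2 ∂unitMeas :=
  (hg.measurable.enorm.pow_const 2).lintegral_prod_right'

theorem measurable_partialCoeff (hg : Profile n g) (m : ℤ) : Measurable (partialCoeff g m) := by
  have h : Measurable fun q : ℝ × ℝ => chr (-m) q.2 * g q.1 q.2 :=
    ((continuous_chr _).measurable.comp measurable_snd).mul hg.measurable
  exact (h.stronglyMeasurable.integral_prod_right (ν := unitMeas)).measurable

/-- The multiplier e^{−2πinb} produced by a ↦ a + 1 is a shift of the frequency by n. -/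
theorem partialCoeff_add (hg : Profile n g) (m : ℤ) (a : ℝ) :
    partialCoeff g (m + n) a = partialCoeff g m (a + 1) := by
  rw [partialCoeff, partialCoeff, fcoeff, fcoeff]
  congr 1
  funext b
  rw [hg.quasi, neg_add, chr_add_index]
  ring

theorem ae_memLp (hg : Profile n g) : ∀ᵐ a ∂unitMeas, MemLp (g a) 2 unitMeas := by
  filter_upwards [ae_lt_top hg.measurable_lintegral hg.finite] with a ha
  rw [memLp_two_iff_integrable_sq_norm (hg.measurable_left a).aestronglyMeasurable]
  refine ⟨((hg.measurable_left a).norm.pow_const 2).aestronglyMeasurable, ?_⟩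
  rw [hasFiniteIntegral_iff_enorm]
  simpa using ha

theorem tsum_lintegral_partialCoeff (hg : Profile n g) :
    ∑' m, ∫⁻ a, ‖partialCoeff g m a‖ₑ ^ 2 ∂unitMeas =
      ∫⁻ a, ∫⁻ b, ‖g a b‖ₑ ^ 2 ∂unitMeas ∂unitMeas := by
  rw [← lintegral_tsum fun m => ((hg.measurable_partialCoeff m).enorm.pow_const 2).aemeasurable]
  refine lintegral_congr_ae ?_
  filter_upwards [hg.ae_memLp] with a ha
  exact tsum_enorm_fcoeff_sq ha

/-- The integral over the line unfolds into unit integrals of the coefficients m + kn, a subfamily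
of those in Parseval's identity. -/
theorem lintegral_partialCoeff_le (hg : Profile n g) (hn : n ≠ 0) (m : ℤ) :
    ∫⁻ x, ‖partialCoeff g m x‖ₑ ^ 2 ≤ ∫⁻ a, ∫⁻ b, ‖g a b‖ₑ ^ 2 ∂unitMeas ∂unitMeas := by
  rw [lintegral_eq_tsum_unit, ← hg.tsum_lintegral_partialCoeff]
  simp only [← shift_mul hg.partialCoeff_add]
  refine ENNReal.tsum_comp_le_tsum_of_injective (f := fun k : ℤ => m + k * n) (fun k l h => ?_)
    (fun m => ∫⁻ a, ‖partialCoeff g m a‖ₑ ^ 2 ∂unitMeas)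
  simpa [hn] using h

theorem memLp_partialCoeff (hg : Profile n g) (hn : n ≠ 0) (m : ℤ) :
    MemLp (partialCoeff g m) 2 := by
  have hm := hg.measurable_partialCoeff m
  rw [memLp_two_iff_integrable_sq_norm hm.aestronglyMeasurable]
  refine ⟨(hm.norm.pow_const 2).aestronglyMeasurable, ?_⟩
  rw [hasFiniteIntegral_iff_enorm]
  simpa using (hg.lintegral_partialCoeff_le hn m).trans_lt hg.finite.lt_top

/-- Any complete system of residues gives the full mass. The offset s is there for the indices ρ − r
in the coefficients of |g|². -/
theorem sum_lintegral_partialCoeff (hg : Profile n g) (hn : n ≠ 0) (s : ℤ) :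
    ∑ r : Fin n.natAbs, ∫⁻ x, ‖partialCoeff g (r - s) x‖ₑ ^ 2 =
      ∫⁻ a, ∫⁻ b, ‖g a b‖ₑ ^ 2 ∂unitMeas ∂unitMeas := by
  rw [← tsum_lintegral_unit_eq hn (f := fun m a => ‖partialCoeff g (m - s) a‖ₑ ^ 2),
    ← hg.tsum_lintegral_partialCoeff]
  · exact (Equiv.subRight s).tsum_eq (fun m => ∫⁻ a, ‖partialCoeff g m a‖ₑ ^ 2 ∂unitMeas)
  · intro m a
    rw [← hg.partialCoeff_add, sub_add_eq_add_sub]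

end Profile

/-! ## The weak eigenvalue equation -/

theorem measurable_of_isSmooth {φ : M → ℂ} (h : IsSmooth φ) : Measurable φ :=
  measurable_of_comp_cls h.continuous.measurable

theorem memLp_of_isSmooth {φ : M → ℂ} (h : IsSmooth φ) : MemLp φ 2 vol := by
  have hK : IsCompact (Set.Icc (0 : ℝ) 1 ×ˢ Set.Icc (0 : ℝ) 1 ×ˢ Set.Icc (0 : ℝ) 1) :=
    isCompact_Icc.prod (isCompact_Icc.prod isCompact_Icc)
  obtain ⟨C, hC⟩ := hK.exists_bound_of_continuousOn h.continuous.continuousOn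
  have hm := measurable_of_isSmooth h
  refine MemLp.of_bound hm.aestronglyMeasurable C ?_
  refine ae_vol_of_ae_cube (measurableSet_le hm.norm measurable_const) ?_
  rw [cubeMeas, unitMeas, Measure.prod_restrict, Measure.prod_restrict]
  filter_upwards [ae_restrict_mem (measurableSet_Ico.prod (measurableSet_Ico.prod
    measurableSet_Ico))] with p hp
  exact hC p ⟨Set.Ico_subset_Icc_self hp.1, Set.Ico_subset_Icc_self hp.2.1,
    Set.Ico_subset_Icc_self hp.2.2⟩

theorem contDiff_ofReal_comp {χ : ℝ → ℝ} (h : ContDiff ℝ ∞ χ) :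
    ContDiff ℝ ∞ fun x => (χ x : ℂ) := Complex.ofRealCLM.contDiff.comp h

theorem hasCompactSupport_ofReal_comp {χ : ℝ → ℝ} (h : HasCompactSupport χ) :
    HasCompactSupport fun x => (χ x : ℂ) := h.comp_left (g := Complex.ofReal) rfl

/-- Pairing with a theta-like test function unfolds to an integral over the line. -/
theorem integral_conj_testFun_mul {n : ℤ} (hn : n ≠ 0) (j : ℤ) {φ : M → ℂ} {f : L2}
    (hφ : Measurable φ) (hf : f =ᵐ[vol] φ)
    (h : ∀ a b c, φ (cls a b c) = φ (cls a b 0) * chr n c) {χ : ℝ → ℝ} (hχ : ContDiff ℝ ∞ χ)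
    (hc : HasCompactSupport χ) :
    ∫ x, (starRingEnd ℂ) (testFun n j (fun x => (χ x : ℂ)) x) * φ x ∂vol =
      ∫ x, (χ x : ℂ) * partialCoeff (fun a b => φ (cls a b 0)) j x := by
  set g : ℝ → ℝ → ℂ := fun a b => φ (cls a b 0) with hg
  have hP : Profile n g := profile_of_central hφ hf h
  set G := partialCoeff g with hG
  have hχ' := contDiff_ofReal_comp hχ
  have hc' := hasCompactSupport_ofReal_comp hc
  set θ := testFun n j (fun x => (χ x : ℂ)) with hθ
  have hs : IsSmooth θ := isSmooth_testFun n j hχ' hc'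
  have hφ2 : MemLp φ 2 vol := (memLp_congr_ae hf).1 (Lp.memLp f)
  have hint : Integrable (fun x => (starRingEnd ℂ) (θ x) * φ x) vol :=
    (memLp_of_isSmooth hs).star.integrable_mul hφ2
  obtain ⟨R, hR⟩ := HasCompactSupport.exists_bound hc'
  -- As |a| ≤ 1 on the unit interval, one finite range of k serves for all a.
  obtain ⟨K, hK⟩ := exists_nat_gt (R + 1)
  have hint3 : Integrable (fun p : ℝ × ℝ × ℝ =>
      (starRingEnd ℂ) (θ (cls p.1 p.2.1 p.2.2)) * φ (cls p.1 p.2.1 p.2.2)) cubeMeas := by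
    rw [vol_eq] at hint
    exact hint.comp_measurable measurable_cls
  have e1 : ∀ a b c, (starRingEnd ℂ) (θ (cls a b c)) * φ (cls a b c) =
      (starRingEnd ℂ) (thetaSum n j (fun x => (χ x : ℂ)) a b) * g a b := by
    intro a b c
    rw [hθ, testFun_cls, h a b c, map_mul, conj_chr, chr_neg_index]
    have := chr_ne_zero n c
    simp only [hg]
    field_simp
  have hL : Integrable fun x => (χ x : ℂ) * G j x :=
    (hχ'.continuous.memLp_of_hasCompactSupport (p := 2) hc').integrable_mul (hP.memLp_partialCoeff hn j)
  have hLk : ∀ k : ℤ, Integrable (fun a : ℝ => (χ (a + k) : ℂ) * G j (a + k)) unitMeas :=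
    fun k => (hL.comp_add_right (k : ℝ)).restrict
  have hmem : ∀ᵐ a ∂unitMeas, |a| ≤ (1 : ℝ) := by
    rw [unitMeas]
    filter_upwards [ae_restrict_mem measurableSet_Ico] with a ha
    rw [abs_of_nonneg ha.1]
    exact ha.2.le
  have e2 : ∀ᵐ a ∂unitMeas, ∫ q, (starRingEnd ℂ) (θ (cls a q.1 q.2)) * φ (cls a q.1 q.2)
      ∂(unitMeas.prod unitMeas) = ∑ k ∈ Finset.Icc (-(K : ℤ)) K, (χ (a + k) : ℂ) * G j (a + k) := by
    have hint2 : ∀ᵐ a ∂unitMeas, Integrable (fun q : ℝ × ℝ =>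
        (starRingEnd ℂ) (θ (cls a q.1 q.2)) * φ (cls a q.1 q.2)) (unitMeas.prod unitMeas) := by
      have := hint3
      rw [cubeMeas] at this
      exact this.prod_right_ae
    filter_upwards [hmem, hP.ae_memLp, hint2] with a ha hga h2
    have hga' : Integrable (g a) unitMeas := hga.integrable (by norm_num)
    rw [integral_prod _ h2]
    simp only [e1, integral_const, probReal_univ, one_smul]
    simp only [thetaSum_eq_sum n j hR ha hK, map_sum, Finset.sum_mul]
    rw [integral_finsetSum]
    · refine Finset.sum_congr rfl fun k _ => ?_
      have e3 : ∀ b, (starRingEnd ℂ) ((χ (a + k) : ℂ) * chr (j + n * k) b) * g a b =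
          (χ (a + k) : ℂ) * (chr (-(j + k * n)) b * g a b) := by
        intro b
        rw [map_mul, conj_chr, Complex.conj_ofReal, mul_assoc, mul_comm n k]
      simp_rw [e3]
      rw [integral_const_mul, hG, ← shift_mul hP.partialCoeff_add]
      rfl
    · intro k _
      refine hga'.bdd_mul (c := ‖(χ (a + k) : ℂ)‖) ?_ ?_
      · exact (Complex.continuous_conj.comp
          (continuous_const.mul (continuous_chr _))).aestronglyMeasurable
      · refine Filter.Eventually.of_forall fun b => ?_
        rw [RCLike.norm_conj, norm_mul, norm_chr, mul_one]
  have hsm : AEStronglyMeasurable (fun x => (starRingEnd ℂ) (θ x) * φ x) vol := hint.1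
  have e4 : ∫ x, (starRingEnd ℂ) (θ x) * φ x ∂vol = ∫ a, ∫ q,
      (starRingEnd ℂ) (θ (cls a q.1 q.2)) * φ (cls a q.1 q.2)
      ∂(unitMeas.prod unitMeas) ∂unitMeas := by
    rw [vol_eq] at hsm ⊢
    rw [integral_map measurable_cls.aemeasurable hsm, cubeMeas, integral_prod]
    exact hint3
  rw [e4, integral_congr_ae e2, integral_finsetSum _ fun k _ => hLk k,
    ← (hasSum_integral_unit hL).tsum_eq, tsum_eq_sum]
  intro k hk
  rw [integral_eq_zero_of_ae]
  filter_upwards [hmem] with a ha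
  have := eq_zero_of_forall_notMem_Icc hR ha hK hk
  rw [this, zero_mul]
  rfl

/-- The Fourier coefficients of an eigenfunction are weak solutions of an oscillator equation. -/
theorem integral_oscillator_mul_partialCoeff {n : ℤ} (hn : n ≠ 0) (j : ℤ) {φ : M → ℂ} {f : L2}
    (hφ : Measurable φ) (hf : f =ᵐ[vol] φ)
    (h : ∀ a b c, φ (cls a b c) = φ (cls a b 0) * chr n c) {e : ℝ} (he : f ∈ eigenspace e)
    {χ : ℝ → ℝ} (hχ : ContDiff ℝ ∞ χ) (hc : HasCompactSupport χ) :
    ∫ x : ℝ, ((-deriv (deriv χ) x + 4 * Real.pi ^ 2 * (n * x + j) ^ 2 * χ x - e * χ x : ℝ) : ℂ) *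
      partialCoeff (fun a b => φ (cls a b 0)) j x = 0 := by
  have hχ' := contDiff_ofReal_comp hχ
  have hc' := hasCompactSupport_ofReal_comp hc
  set χ₂ : ℝ → ℝ := fun x => -deriv (deriv χ) x + 4 * Real.pi ^ 2 * (n * x + j) ^ 2 * χ x with hχ₂
  have hχ1 : ContDiff ℝ ∞ (deriv χ) := (contDiff_infty_iff_deriv.1 hχ).2
  have hs₂ : ContDiff ℝ ∞ χ₂ := by
    have h1 : ContDiff ℝ ∞ (deriv (deriv χ)) := (contDiff_infty_iff_deriv.1 hχ1).2
    exact h1.neg.add (ContDiff.mul (by fun_prop) hχ)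
  have hc₂ : HasCompactSupport χ₂ := by
    have h1 : HasCompactSupport fun x => -deriv (deriv χ) x :=
      hc.deriv.deriv.comp_left (g := fun z => -z) neg_zero
    have h2 : HasCompactSupport fun x : ℝ => 4 * Real.pi ^ 2 * (n * x + j) ^ 2 * χ x := hc.mul_left
    exact h1.add h2
  have hd : ∀ {u : ℝ → ℝ}, ContDiff ℝ ∞ u →
      deriv (fun x => (u x : ℂ)) = fun x => ((deriv u x : ℝ) : ℂ) := by
    intro u hu
    funext x
    exact ((hu.differentiable (by simp) x).hasDerivAt.ofReal_comp).deriv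
  have hsub : subLaplacian (testFun n j fun x => (χ x : ℂ)) = testFun n j fun x => (χ₂ x : ℂ) := by
    rw [subLaplacian_testFun n j hχ' hc', hd hχ, hd hχ1]
    congr 1
    funext x
    simp only [hχ₂]
    push_cast
    ring
  have hm1 := memLp_of_isSmooth (isSmooth_testFun n j hχ' hc')
  have hm2 := memLp_of_isSmooth (isSmooth_testFun n j (contDiff_ofReal_comp hs₂)
    (hasCompactSupport_ofReal_comp hc₂))
  -- The weak eigenvalue equation is tested on the theta function of χ, whose sub-Laplacian is the
  -- theta function of χ₂.
  have key := he (hm1.toLp _, hm2.toLp _) ⟨_, isSmooth_testFun n j hχ' hc', hm1.coeFn_toLp, by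
    rw [hsub]
    exact hm2.coeFn_toLp⟩
  simp only [inner_smul_right] at key
  have pair : ∀ {u : ℝ → ℝ} (hu : ContDiff ℝ ∞ u) (hcu : HasCompactSupport u)
      (hm : MemLp (testFun n j fun x => (u x : ℂ)) 2 vol),
      inner ℂ (hm.toLp _) f = ∫ x, (u x : ℂ) * partialCoeff (fun a b => φ (cls a b 0)) j x := by
    intro u hu hcu hm
    rw [← integral_conj_testFun_mul hn j hφ hf h hu hcu, MeasureTheory.L2.inner_def]
    refine integral_congr_ae ?_
    filter_upwards [hm.coeFn_toLp, hf] with x h1 h2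
    rw [h1, h2, RCLike.inner_apply, mul_comm]
  rw [pair hs₂ hc₂, pair hχ hc, ← integral_const_mul] at key
  have hP := (profile_of_central hφ hf h).memLp_partialCoeff hn j
  have hL : ∀ {u : ℝ → ℝ}, ContDiff ℝ ∞ u → HasCompactSupport u → Integrable fun x =>
      (u x : ℂ) * partialCoeff (fun a b => φ (cls a b 0)) j x := fun hu hcu =>
    ((contDiff_ofReal_comp hu).continuous.memLp_of_hasCompactSupport (p := 2)
      (hasCompactSupport_ofReal_comp hcu)).integrable_mul hP
  rw [← sub_eq_zero, ← integral_sub (hL hs₂ hc₂) ((hL hχ hc).const_mul _)] at key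
  rw [← key]
  refine integral_congr_ae (Filter.Eventually.of_forall fun x => ?_)
  simp only [hχ₂]
  push_cast
  ring

end Heis

namespace Heis

/-! ## Rescaling to the standard oscillator -/

theorem ae_comp_affine {P : ℝ → Prop} (h : ∀ᵐ y, P y) {κ : ℝ} (hκ : κ ≠ 0) (d : ℝ) :
    ∀ᵐ x, P (κ * x + d) := by
  have h1 := (measurePreserving_add_right (volume : Measure ℝ) d).quasiMeasurePreserving.ae h
  have h2 : ∀ᵐ y ∂(Measure.map (κ * ·) (volume : Measure ℝ)), P (y + d) := by
    rw [Real.map_volume_mul_left hκ]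
    exact Measure.ae_smul_measure h1 _
  exact ae_of_ae_map (f := (κ * ·)) (p := fun y => P (y + d)) (by fun_prop) h2

theorem integral_comp_affine {E : Type*} [NormedAddCommGroup E] [NormedSpace ℝ E] (u : ℝ → E)
    {κ : ℝ} (hκ : 0 < κ) (d : ℝ) : ∫ x, u (κ * x + d) = κ⁻¹ • ∫ y, u y := by
  rw [Measure.integral_comp_mul_left (fun z => u (z + d)), abs_of_pos (inv_pos.2 hκ),
    integral_add_right_eq_self]

theorem memLp_comp_affine_inv {G : ℝ → ℂ} (hm : Measurable G) (hG : MemLp G 2) {κ : ℝ}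
    (hκ : κ ≠ 0) (d : ℝ) : MemLp (fun y => G ((y - d) / κ)) 2 := by
  have hm' : Measurable fun y => G ((y - d) / κ) := hm.comp (by fun_prop)
  rw [memLp_two_iff_integrable_sq_norm hm'.aestronglyMeasurable]
  rw [memLp_two_iff_integrable_sq_norm hm.aestronglyMeasurable] at hG
  exact (hG.comp_div hκ).comp_sub_right d

theorem hasCompactSupport_comp_affine {χ : ℝ → ℝ} (hc : HasCompactSupport χ) {κ : ℝ}
    (hκ : κ ≠ 0) (d : ℝ) : HasCompactSupport fun x => χ (κ * x + d) := by
  have h := hc.comp_homeomorph ((Homeomorph.mulLeft₀ κ hκ).trans (Homeomorph.addRight d))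
  simpa [Function.comp_def] using h

/-- The substitution y = κ(x + j/n) with κ² = 4π|n| turns 4π²(nx + j)² into κ² · y²/4. The energy
becomes e/κ², which must be ℓ + 1/2. -/
theorem exists_hermFun_of_weak_eigenfunction {n : ℤ} (hn : n ≠ 0) (j : ℤ) {G : ℝ → ℂ}
    (hm : Measurable G) (hG : MemLp G 2) {e : ℝ}
    (hw : ∀ χ : ℝ → ℝ, ContDiff ℝ ∞ χ → HasCompactSupport χ →
      ∫ x : ℝ, ((-deriv (deriv χ) x + 4 * Real.pi ^ 2 * (n * x + j) ^ 2 * χ x - e * χ x : ℝ) : ℂ) *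
        G x = 0) :
    (∀ᵐ x, G x = 0) ∨ ∃ ℓ : ℕ, e = 2 * Real.pi * |(n : ℝ)| * (2 * (ℓ : ℝ) + 1) ∧
      ∃ c : ℂ, ∀ᵐ x, G x = c * hermFun ℓ (Real.sqrt (4 * Real.pi * |(n : ℝ)|) * x +
        Real.sqrt (4 * Real.pi * |(n : ℝ)|) * j / n) := by
  have hn' : (n : ℝ) ≠ 0 := by exact_mod_cast hn
  have hpos : 0 < 4 * Real.pi * |(n : ℝ)| := by have := Real.pi_pos; positivity
  set κ := Real.sqrt (4 * Real.pi * |(n : ℝ)|) with hκ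
  have hκ0 : 0 < κ := Real.sqrt_pos.2 hpos
  have hκ2 : κ ^ 2 = 4 * Real.pi * |(n : ℝ)| := Real.sq_sqrt hpos.le
  set d := κ * j / n with hd
  set H : ℝ → ℂ := fun y => G ((y - d) / κ) with hH
  have hHG : ∀ x, H (κ * x + d) = G x := fun x => by
    simp only [hH]
    congr 1
    field_simp
    ring
  have hHL : MemLp H 2 := memLp_comp_affine_inv hm hG hκ0.ne' d
  have hosc := ae_eq_hermFun_of_weak_eigenfunction hHL (E := e / κ ^ 2) (fun χ hχ hc => by
    have hχ1 : ContDiff ℝ ∞ (deriv χ) := (contDiff_infty_iff_deriv.1 hχ).2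
    have hder : ∀ {u : ℝ → ℝ}, ContDiff ℝ ∞ u →
        deriv (fun x => u (κ * x + d)) = fun x => κ * deriv u (κ * x + d) := by
      intro u hu
      funext x
      have h1 := (hu.differentiable (by simp) (κ * x + d)).hasDerivAt
      have h2 : HasDerivAt (fun x : ℝ => κ * x + d) κ x := by
        simpa using ((hasDerivAt_id x).const_mul κ).add_const d
      exact ((h1.comp x h2).congr_deriv (mul_comm _ _)).deriv
    have hder2 : deriv (deriv fun x => χ (κ * x + d)) =
        fun x => κ ^ 2 * deriv (deriv χ) (κ * x + d) := by
      rw [hder hχ]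
      funext x
      rw [deriv_const_mul_field, hder hχ1]
      ring
    have haff : ContDiff ℝ ∞ fun x : ℝ => κ * x + d := by fun_prop
    have hcs := hasCompactSupport_comp_affine hc hκ0.ne' d
    have h0 := hw (fun x => χ (κ * x + d)) (hχ.comp haff) hcs
    obtain ⟨u, hu⟩ : ∃ u : ℝ → ℂ, u = fun y => (κ ^ 2 : ℂ) *
        (((-(deriv (deriv χ) y) + y ^ 2 / 4 * χ y - e / κ ^ 2 * χ y : ℝ) : ℂ) * H y) := ⟨_, rfl⟩
    have e1 : ∀ x : ℝ, ((-deriv (deriv fun x => χ (κ * x + d)) x +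
        4 * Real.pi ^ 2 * (n * x + j) ^ 2 * χ (κ * x + d) - e * χ (κ * x + d) : ℝ) : ℂ) * G x =
        u (κ * x + d) := by
      intro x
      simp only [hu, hHG, hder2]
      rw [← mul_assoc]
      congr 1
      rw [← Complex.ofReal_pow, ← Complex.ofReal_mul]
      congr 1
      have h3 : 4 * Real.pi ^ 2 * (n * x + j) ^ 2 = κ ^ 2 * ((κ * x + d) ^ 2 / 4) := by
        have h4 : κ * x + d = κ * (n * x + j) / n := by
          rw [hd]
          field_simp
        rw [h4, div_pow, mul_pow, hκ2, ← sq_abs (n : ℝ)]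
        have : |(n : ℝ)| ≠ 0 := abs_ne_zero.2 hn'
        field_simp
      rw [h3]
      field_simp
    simp_rw [e1] at h0
    rw [integral_comp_affine _ hκ0, hu, integral_const_mul] at h0
    have hκc : (κ ^ 2 : ℂ) ≠ 0 := by exact_mod_cast (pow_pos hκ0 2).ne'
    exact (mul_eq_zero.1 ((smul_eq_zero.1 h0).resolve_left (inv_pos.2 hκ0).ne')).resolve_left hκc)
  rcases hosc with h | ⟨ℓ, hℓ, c, hc⟩
  · left
    filter_upwards [ae_comp_affine h hκ0.ne' d] with x hx
    rwa [hHG] at hx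
  · right
    refine ⟨ℓ, ?_, c, ?_⟩
    · rw [div_eq_iff (pow_pos hκ0 2).ne', hκ2] at hℓ
      rw [hℓ]
      ring
    · filter_upwards [ae_comp_affine hc hκ0.ne' d] with x hx
      rwa [hHG] at hx

/-! ## Decay of Hermite functions -/

open Polynomial in
theorem exists_bound_eval_mul_gaussian (Q : ℝ[X]) :
    ∃ B, ∀ y : ℝ, |Q.eval y * Real.exp (-(1 / 4) * y ^ 2)| ≤ B := by
  induction Q using Polynomial.induction_on' with
  | add p q hp hq =>
    obtain ⟨B, hB⟩ := hp
    obtain ⟨B', hB'⟩ := hq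
    refine ⟨B + B', fun y => ?_⟩
    rw [eval_add, add_mul]
    exact (abs_add_le _ _).trans (add_le_add (hB y) (hB' y))
  | monomial k a =>
    refine ⟨|a| * (1 + 4 ^ k * k.factorial), fun y => ?_⟩
    have hE := Real.exp_pos (-(1 / 4) * y ^ 2)
    have hE1 : Real.exp (-(1 / 4) * y ^ 2) ≤ 1 := Real.exp_le_one_iff.2 (by nlinarith [sq_nonneg y])
    rw [eval_monomial, abs_mul, abs_mul, abs_of_pos hE, mul_assoc]
    refine mul_le_mul_of_nonneg_left ?_ (abs_nonneg _)
    have hk : (0 : ℝ) < k.factorial := by exact_mod_cast k.factorial_pos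
    have h1 := Real.pow_div_factorial_le_exp (y ^ 2 / 4) (by positivity) k
    have h2 : (y ^ 2) ^ k ≤ 4 ^ k * k.factorial * Real.exp (y ^ 2 / 4) := by
      rw [div_pow, div_div, div_le_iff₀ (by positivity)] at h1
      linarith
    have h3 : Real.exp (y ^ 2 / 4) * Real.exp (-(1 / 4) * y ^ 2) = 1 := by
      rw [← Real.exp_add, show y ^ 2 / 4 + -(1 / 4) * y ^ 2 = 0 by ring, Real.exp_zero]
    have h4 : |y ^ k| ≤ 1 + (y ^ 2) ^ k := by
      have : (y ^ 2) ^ k = |y ^ k| ^ 2 := by rw [sq_abs]; ring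
      rw [this]
      nlinarith [sq_nonneg (|y ^ k| - 1), abs_nonneg (y ^ k)]
    calc |y ^ k| * Real.exp (-(1 / 4) * y ^ 2)
        ≤ (1 + 4 ^ k * k.factorial * Real.exp (y ^ 2 / 4)) * Real.exp (-(1 / 4) * y ^ 2) := by
          gcongr
          linarith
      _ = Real.exp (-(1 / 4) * y ^ 2) + 4 ^ k * k.factorial *
            (Real.exp (y ^ 2 / 4) * Real.exp (-(1 / 4) * y ^ 2)) := by ring
      _ ≤ _ := by rw [h3, mul_one]; linarith

theorem exists_hermFun_decay (k : ℕ) : ∃ B, 0 ≤ B ∧ ∀ y, |hermFun k y| ≤ B / (1 + y ^ 2) := by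
  obtain ⟨B, hB⟩ := exists_bound_eval_mul_gaussian ((1 + Polynomial.X ^ 2) * herm ℝ k)
  refine ⟨B, (abs_nonneg _).trans (hB 0), fun y => ?_⟩
  rw [le_div_iff₀ (by positivity)]
  refine le_trans (le_of_eq ?_) (hB y)
  rw [Polynomial.eval_mul, mul_assoc, abs_mul, hermFun, mul_comm]
  simp only [Polynomial.eval_add, Polynomial.eval_one, Polynomial.eval_pow, Polynomial.eval_X]
  rw [abs_of_pos (by positivity : 0 < 1 + y ^ 2)]

theorem summable_one_div_one_add_sq : Summable fun m : ℤ => 1 / (1 + (m : ℝ) ^ 2) := by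
  have h1 : Summable fun m : ℤ => 1 / (m : ℝ) ^ 2 := Real.summable_one_div_int_pow.2 (by norm_num)
  have h2 : Summable fun m : ℤ => if m = 0 then (1 : ℝ) else 0 := (hasSum_ite_eq 0 1).summable
  refine Summable.of_nonneg_of_le (fun m => by positivity) (fun m => ?_) (h1.add h2)
  by_cases hm : m = 0
  · simp [hm]
  · have h0 : (m : ℝ) ≠ 0 := by exact_mod_cast hm
    rw [if_neg hm, add_zero]
    gcongr
    linarith

/-- The ambiguity integral of a rescaled Hermite function. -/
theorem norm_integral_chr_mul_hermFun (k : ℕ) (s : ℤ) {κ : ℝ} (hκ : 0 < κ) (α p : ℝ) :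
    ‖∫ x : ℝ, chr (-s) x * ((hermFun k (κ * x + α) * hermFun k (κ * x + α - 2 * p) : ℝ) : ℂ)‖ =
      κ⁻¹ * (Real.sqrt (2 * Real.pi) * (k.factorial : ℝ)) *
        |laguerre k (p ^ 2 + (2 * Real.pi * s / κ) ^ 2)| := by
  set q : ℝ := -(2 * Real.pi * s / κ) with hq
  obtain ⟨u, hu⟩ : ∃ u : ℝ → ℂ, u = fun y => ((hermFun k (y + p) * hermFun k (y - p) : ℝ) : ℂ) *
    Complex.exp (Complex.I * q * y) := ⟨_, rfl⟩
  -- Recentring at y = κx + α − p makes the two shifts symmetric, y ± p; the character contributes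
  -- only a phase of modulus 1.
  have e : ∀ x : ℝ,
      chr (-s) x * ((hermFun k (κ * x + α) * hermFun k (κ * x + α - 2 * p) : ℝ) : ℂ) =
      Complex.exp ((-(q * (α - p)) : ℝ) * Complex.I) * u (κ * x + (α - p)) := by
    intro x
    have h1 : chr (-s) x = Complex.exp ((-(q * (α - p)) : ℝ) * Complex.I) *
        Complex.exp (Complex.I * q * ((κ * x + (α - p) : ℝ) : ℂ)) := by
      rw [← Complex.exp_add, chr]
      congr 1
      have h2 : (q : ℂ) * κ = -(2 * Real.pi * s) := by
        have : q * κ = -(2 * Real.pi * s) := by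
          rw [hq]
          field_simp
        exact_mod_cast this
      push_cast
      linear_combination (-Complex.I * x) * h2
    simp only [hu]
    rw [h1, show κ * x + (α - p) + p = κ * x + α by ring,
      show κ * x + (α - p) - p = κ * x + α - 2 * p by ring]
    ring
  simp_rw [e]
  rw [integral_const_mul, integral_comp_affine _ hκ, hu, integral_hermFun_mul_hermFun, norm_mul,
    Complex.norm_exp_ofReal_mul_I, one_mul, norm_smul, Complex.norm_real, Real.norm_eq_abs,
    Real.norm_eq_abs, abs_of_pos (inv_pos.2 hκ), abs_mul, hq, neg_sq,
    abs_of_nonneg (by positivity : 0 ≤ Real.sqrt (2 * Real.pi) * (k.factorial : ℝ)), ← mul_assoc]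

end Heis

namespace Heis

/-! ## The fourth power estimate for profiles of Hermite type -/

theorem enorm_sq_eq (z : ℂ) : ‖z‖ₑ ^ 2 = ENNReal.ofReal (‖z‖ ^ 2) := by
  rw [ENNReal.ofReal_pow (norm_nonneg _), ofReal_norm]

theorem lintegral_enorm_sq_of_memLp {α : Type*} [MeasurableSpace α] {μ : Measure α} {f : α → ℂ}
    (hf : MemLp f 2 μ) : ∫⁻ x, ‖f x‖ₑ ^ 2 ∂μ = ENNReal.ofReal (∫ x, ‖f x‖ ^ 2 ∂μ) := by
  simp only [enorm_sq_eq]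
  rw [ofReal_integral_eq_lintegral_ofReal ((memLp_two_iff_integrable_sq_norm hf.1).1 hf)
    (Filter.Eventually.of_forall fun b => by positivity)]

/-- The squared `L²` norm of a profile. -/
noncomputable def mass (g : ℝ → ℝ → ℂ) : ℝ :=
  (∫⁻ a, ∫⁻ b, ‖g a b‖ₑ ^ 2 ∂unitMeas ∂unitMeas).toReal

theorem mass_nonneg (g : ℝ → ℝ → ℂ) : 0 ≤ mass g := ENNReal.toReal_nonneg

theorem memLp_unitMeas_of_memLp {f : ℝ → ℂ} (hf : MemLp f 2) : MemLp f 2 unitMeas := hf.restrict _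

theorem integrable_unitMeas {E : Type*} [NormedAddCommGroup E] {f : ℝ → E} (hf : Integrable f) :
    Integrable f unitMeas := hf.restrict

theorem ae_unitMeas_of_ae {P : ℝ → Prop} (h : ∀ᵐ x, P x) : ∀ᵐ x ∂unitMeas, P x :=
  ae_restrict_of_ae h

theorem norm_mul_conj_le (z w : ℂ) : ‖z * (starRingEnd ℂ) w‖ ≤ (‖z‖ ^ 2 + ‖w‖ ^ 2) / 2 := by
  rw [norm_mul, RCLike.norm_conj]
  nlinarith [sq_nonneg (‖z‖ - ‖w‖)]

namespace Profile

variable {n : ℤ} {g : ℝ → ℝ → ℂ}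

theorem integral_partialCoeff_le (hg : Profile n g) (hn : n ≠ 0) (m : ℤ) :
    ∫ x, ‖partialCoeff g m x‖ ^ 2 ≤ mass g := by
  have h := hg.lintegral_partialCoeff_le hn m
  rw [lintegral_enorm_sq_of_memLp (hg.memLp_partialCoeff hn m)] at h
  exact (ENNReal.ofReal_le_iff_le_toReal hg.finite).1 h

theorem sum_integral_partialCoeff (hg : Profile n g) (hn : n ≠ 0) (s : ℤ) :
    ∑ r : Fin n.natAbs, ∫ x, ‖partialCoeff g (r - s) x‖ ^ 2 = mass g := by
  have h := hg.sum_lintegral_partialCoeff hn s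
  simp only [lintegral_enorm_sq_of_memLp (hg.memLp_partialCoeff hn _)] at h
  rw [← ENNReal.ofReal_sum_of_nonneg fun r _ => integral_nonneg fun x => by positivity] at h
  rw [mass, ← h, ENNReal.toReal_ofReal]
  exact Finset.sum_nonneg fun r _ => integral_nonneg fun x => by positivity

theorem summable_integral_partialCoeff (hg : Profile n g) (hn : n ≠ 0) :
    Summable fun m => ∫ a, ‖partialCoeff g m a‖ ^ 2 ∂unitMeas := by
  have h := ENNReal.summable_toReal (hg.tsum_lintegral_partialCoeff.trans_ne hg.finite)
  refine h.congr fun m => ?_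
  rw [lintegral_enorm_sq_of_memLp (memLp_unitMeas_of_memLp (hg.memLp_partialCoeff hn m)),
    ENNReal.toReal_ofReal (integral_nonneg fun x => by positivity)]

/-- The `r`-th Fourier coefficient in the second variable of the squared modulus of a profile. -/
noncomputable def sqCoeff (g : ℝ → ℝ → ℂ) (r : ℤ) (a : ℝ) : ℂ :=
  fcoeff (fun b => ((‖g a b‖ ^ 2 : ℝ) : ℂ)) r

theorem measurable_sqCoeff (hg : Profile n g) (r : ℤ) : Measurable (sqCoeff g r) := by
  have h : Measurable fun q : ℝ × ℝ => chr (-r) q.2 * ((‖g q.1 q.2‖ ^ 2 : ℝ) : ℂ) :=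
    ((continuous_chr _).measurable.comp measurable_snd).mul
      (Complex.measurable_ofReal.comp (hg.measurable.norm.pow_const 2))
  exact (h.stronglyMeasurable.integral_prod_right (ν := unitMeas)).measurable

/-- Parseval for the pair g and e^{2πirb} g, whose pointwise product with conjugation is e^{−2πirb}
|g|². -/
theorem hasSum_sqCoeff {a : ℝ} (ha : MemLp (g a) 2 unitMeas) (r : ℤ) :
    HasSum (fun m => partialCoeff g m a * (starRingEnd ℂ) (partialCoeff g (m - r) a))
      (sqCoeff g r a) := by
  have h2 : MemLp (fun b => chr r b * g a b) 2 unitMeas := by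
    refine ha.of_le_mul (c := 1) ((continuous_chr r).aestronglyMeasurable.mul ha.1)
      (Filter.Eventually.of_forall fun b => ?_)
    rw [norm_mul, norm_chr]
  have h := hasSum_fcoeff_mul_fcoeff ha h2
  have e1 : ∀ m, fcoeff (fun b => chr r b * g a b) m = partialCoeff g (m - r) a := by
    intro m
    rw [partialCoeff, fcoeff, fcoeff]
    congr 1
    funext b
    rw [show -(m - r) = -m + r by ring, chr_add_index]
    ring
  have e2 : ∫ b, g a b * (starRingEnd ℂ) (chr r b * g a b) ∂unitMeas = sqCoeff g r a := by
    rw [sqCoeff, fcoeff]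
    congr 1
    funext b
    rw [map_mul, conj_chr, mul_left_comm, Complex.mul_conj, Complex.normSq_eq_norm_sq]
  simp only [e1] at h
  rw [e2] at h
  exact h

/-- The double Fourier coefficients of the squared modulus unfold to integrals over the line. -/
theorem fcoeff_sqCoeff (hg : Profile n g) (hn : n ≠ 0) (r s : ℤ) :
    fcoeff (sqCoeff g r) s = ∑ ρ : Fin n.natAbs, ∫ x, chr (-s) x *
      (partialCoeff g ρ x * (starRingEnd ℂ) (partialCoeff g (ρ - r) x)) := by
  set F : ℤ → ℝ → ℂ := fun m a => chr (-s) a *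
    (partialCoeff g m a * (starRingEnd ℂ) (partialCoeff g (m - r) a)) with hF
  have hFm : ∀ m, AEStronglyMeasurable (F m) volume := fun m =>
    ((continuous_chr _).measurable.mul ((hg.measurable_partialCoeff m).mul
      (Complex.continuous_conj.measurable.comp
        (hg.measurable_partialCoeff (m - r))))).aestronglyMeasurable
  have hsq : ∀ m, Integrable fun x => ‖partialCoeff g m x‖ ^ 2 := fun m =>
    (memLp_two_iff_integrable_sq_norm (hg.memLp_partialCoeff hn m).1).1 (hg.memLp_partialCoeff hn m)
  have hle : ∀ m x, ‖F m x‖ ≤ (‖partialCoeff g m x‖ ^ 2 + ‖partialCoeff g (m - r) x‖ ^ 2) / 2 := by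
    intro m x
    rw [hF, norm_mul, norm_chr, one_mul]
    exact norm_mul_conj_le _ _
  have hFi : ∀ m, Integrable (F m) := fun m =>
    (((hsq m).add (hsq (m - r))).div_const 2).mono' (hFm m) (Filter.Eventually.of_forall (hle m))
  -- The character in a is 1-periodic, so the quasi-periodicity of the coefficients passes to the
  -- products and the unfolding applies.
  have hFper : ∀ m a, F (m + n) a = F m (a + 1) := by
    intro m a
    have h1 := chr_int (-s) 1
    rw [Int.cast_one] at h1
    simp only [hF]
    rw [chr_add, h1, mul_one, ← hg.partialCoeff_add, ← hg.partialCoeff_add,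
      sub_add_eq_add_sub]
  have hS := hg.summable_integral_partialCoeff hn
  have hS' : Summable fun m => ∫ a, ‖partialCoeff g (m - r) a‖ ^ 2 ∂unitMeas :=
    (Equiv.subRight r).summable_iff.2 hS
  have hsum : Summable fun m => ∫ a, ‖F m a‖ ∂unitMeas := by
    refine Summable.of_nonneg_of_le (fun m => integral_nonneg fun a => norm_nonneg _) (fun m => ?_)
      ((hS.add hS').div_const 2)
    rw [← integral_add (integrable_unitMeas (hsq m)) (integrable_unitMeas (hsq (m - r))), ← integral_div]
    exact integral_mono (integrable_unitMeas (hFi m).norm)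
      (integrable_unitMeas (((hsq m).add (hsq (m - r))).div_const 2)) (hle m)
  have key := hasSum_integral_of_summable_integral_norm (fun m => integrable_unitMeas (hFi m)) hsum
  rw [← tsum_integral_unit_eq hn hFper hFi key.summable, key.tsum_eq, fcoeff]
  refine integral_congr_ae ?_
  filter_upwards [hg.ae_memLp] with a ha
  simp only [hF]
  rw [tsum_mul_left, (hasSum_sqCoeff ha r).tsum_eq]

section Hermite

variable {ℓ : ℕ} {c : ℤ → ℂ} {κ : ℝ}

theorem integral_norm_sq_of_hermite (hκ : 0 < κ) {m : ℤ}
    (hc : ∀ᵐ x, partialCoeff g m x = c m * hermFun ℓ (κ * x + κ * m / n)) :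
    ∫ x, ‖partialCoeff g m x‖ ^ 2 =
      ‖c m‖ ^ 2 * (κ⁻¹ * (Real.sqrt (2 * Real.pi) * (ℓ.factorial : ℝ))) := by
  have e : ∀ᵐ x, ‖partialCoeff g m x‖ ^ 2 = ‖c m‖ ^ 2 * hermFun ℓ (κ * x + κ * m / n) ^ 2 := by
    filter_upwards [hc] with x hx
    rw [hx, norm_mul, mul_pow, Complex.norm_real, Real.norm_eq_abs, sq_abs]
  rw [integral_congr_ae e, integral_const_mul,
    integral_comp_affine (fun y => hermFun ℓ y ^ 2) hκ, integral_hermFun_sq, smul_eq_mul]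

/-- Bounded coefficients c_m and the decay of h_ℓ make the Fourier series in b absolutely summable,
uniformly in a. The bound itself does not enter the final estimate: it only ensures that |g|² is
square integrable, so that Parseval may be applied to it. -/
theorem exists_ae_bound (hg : Profile n g) (hn : n ≠ 0) (hκ : 0 < κ)
    (hc : ∀ m, ∀ᵐ x, partialCoeff g m x = c m * hermFun ℓ (κ * x + κ * m / n)) :
    ∃ K, ∀ᵐ a ∂unitMeas, ∀ᵐ b ∂unitMeas, ‖g a b‖ ≤ K := by
  obtain ⟨B, hB0, hB⟩ := exists_hermFun_decay ℓ
  have hn' : (n : ℝ) ≠ 0 := by exact_mod_cast hn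
  set A := κ⁻¹ * (Real.sqrt (2 * Real.pi) * (ℓ.factorial : ℝ)) with hA
  have hA0 : 0 < A := by
    have : (0 : ℝ) < ℓ.factorial := by exact_mod_cast ℓ.factorial_pos
    have := Real.pi_pos
    positivity
  -- The mass bounds A‖c_m‖², and t ≤ 1 + t² passes to ‖c_m‖.
  set C₀ := 1 + mass g / A with hC₀
  have hC₀0 : 0 ≤ C₀ := by have := mass_nonneg g; positivity
  have hcm : ∀ m, ‖c m‖ ≤ C₀ := by
    intro m
    have h1 := hg.integral_partialCoeff_le hn m
    rw [integral_norm_sq_of_hermite hκ (hc m), ← hA, ← le_div_iff₀ hA0] at h1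
    nlinarith [sq_nonneg (‖c m‖ - 1), norm_nonneg (c m)]
  -- D is chosen so that 1 + m² ≤ D(1 + y²) when m = n(y/κ − a) with a in [0, 1).
  set D := 1 + 2 * (n : ℝ) ^ 2 + 2 * (n : ℝ) ^ 2 / κ ^ 2 with hD
  have hD0 : 0 < D := by positivity
  have hsum := summable_one_div_one_add_sq.mul_left (C₀ * (B * D))
  refine ⟨∑' m : ℤ, C₀ * (B * D) * (1 / (1 + (m : ℝ) ^ 2)), ?_⟩
  have hall : ∀ᵐ a ∂unitMeas, ∀ m, partialCoeff g m a = c m * hermFun ℓ (κ * a + κ * m / n) :=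
    ae_all_iff.2 fun m => ae_unitMeas_of_ae (hc m)
  have hmem : ∀ᵐ a ∂unitMeas, a ∈ Set.Ico (0 : ℝ) 1 := ae_restrict_mem measurableSet_Ico
  filter_upwards [hall, hmem, hg.ae_memLp] with a ha ha1 hga
  have hle : ∀ m, ‖fcoeff (g a) m‖ ≤ C₀ * (B * D) * (1 / (1 + (m : ℝ) ^ 2)) := by
    intro m
    have h1 : fcoeff (g a) m = c m * hermFun ℓ (κ * a + κ * m / n) := ha m
    rw [h1, norm_mul, Complex.norm_real, Real.norm_eq_abs, mul_assoc]
    refine mul_le_mul (hcm m) ?_ (abs_nonneg _) hC₀0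
    set y := κ * a + κ * m / n with hy
    refine (hB y).trans ?_
    rw [mul_one_div, div_le_div_iff₀ (by positivity) (by positivity), mul_assoc]
    refine mul_le_mul_of_nonneg_left ?_ hB0
    have hm : (m : ℝ) = n * (y / κ - a) := by
      rw [hy]
      field_simp
      ring
    have h2 : (m : ℝ) ^ 2 ≤ 2 * (n : ℝ) ^ 2 / κ ^ 2 * y ^ 2 + 2 * (n : ℝ) ^ 2 := by
      have h3 : a ^ 2 ≤ 1 := by nlinarith [ha1.1, ha1.2]
      have h4 : (y / κ - a) ^ 2 ≤ 2 * (y ^ 2 / κ ^ 2) + 2 := by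
        rw [← div_pow]
        nlinarith [sq_nonneg (y / κ + a)]
      rw [hm, mul_pow]
      calc (n : ℝ) ^ 2 * (y / κ - a) ^ 2 ≤ (n : ℝ) ^ 2 * (2 * (y ^ 2 / κ ^ 2) + 2) := by gcongr
        _ = _ := by ring
    have h5 : 0 ≤ 2 * (n : ℝ) ^ 2 / κ ^ 2 := by positivity
    have h6 : 0 ≤ (1 + 2 * (n : ℝ) ^ 2) * y ^ 2 := by positivity
    rw [hD]
    linarith
  have hs : Summable fun m => ‖fcoeff (g a) m‖ :=
    Summable.of_nonneg_of_le (fun m => norm_nonneg _) hle hsum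
  filter_upwards [ae_norm_le_tsum_norm_fcoeff hga hs] with b hb
  exact hb.trans (hs.tsum_le_tsum hle hsum)

/-- Every summand is an ambiguity integral with the same Laguerre factor. The products
‖c_ρ‖‖c_{ρ−r}‖ are split by the arithmetic–geometric mean, and each half sums to the mass, since ρ
and ρ − r both run over a complete system of residues. -/
theorem norm_fcoeff_sqCoeff_le (hg : Profile n g) (hn : n ≠ 0) (hκ : 0 < κ)
    (hκ2 : κ ^ 2 = 4 * Real.pi * |(n : ℝ)|)
    (hc : ∀ m, ∀ᵐ x, partialCoeff g m x = c m * hermFun ℓ (κ * x + κ * m / n)) (r s : ℤ) :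
    ‖fcoeff (sqCoeff g r) s‖ ≤
      |laguerre ℓ (Real.pi * (((r : ℝ) ^ 2 + (s : ℝ) ^ 2) / |(n : ℝ)|))| * mass g := by
  have hn' : (n : ℝ) ≠ 0 := by exact_mod_cast hn
  have hna : |(n : ℝ)| ≠ 0 := abs_ne_zero.2 hn'
  set L := |laguerre ℓ (Real.pi * (((r : ℝ) ^ 2 + (s : ℝ) ^ 2) / |(n : ℝ)|))| with hL
  set A := κ⁻¹ * (Real.sqrt (2 * Real.pi) * (ℓ.factorial : ℝ)) with hA
  have hA0 : 0 ≤ A := by positivity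
  have harg : (κ * r / (2 * n)) ^ 2 + (2 * Real.pi * s / κ) ^ 2 =
      Real.pi * (((r : ℝ) ^ 2 + (s : ℝ) ^ 2) / |(n : ℝ)|) := by
    rw [div_pow, div_pow, mul_pow, mul_pow, hκ2, mul_pow, ← sq_abs (n : ℝ)]
    field_simp
    ring
  have hterm : ∀ ρ : ℤ, ‖∫ x, chr (-s) x *
      (partialCoeff g ρ x * (starRingEnd ℂ) (partialCoeff g (ρ - r) x))‖ ≤
      L * ((∫ x, ‖partialCoeff g ρ x‖ ^ 2) + ∫ x, ‖partialCoeff g (ρ - r) x‖ ^ 2) / 2 := by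
    intro ρ
    have e : ∀ᵐ x, chr (-s) x *
        (partialCoeff g ρ x * (starRingEnd ℂ) (partialCoeff g (ρ - r) x)) =
        (c ρ * (starRingEnd ℂ) (c (ρ - r))) * (chr (-s) x *
          ((hermFun ℓ (κ * x + κ * ρ / n) *
            hermFun ℓ (κ * x + κ * ρ / n - 2 * (κ * r / (2 * n))) : ℝ) : ℂ)) := by
      filter_upwards [hc ρ, hc (ρ - r)] with x h1 h2
      have h3 : κ * x + κ * ((ρ - r : ℤ) : ℝ) / n = κ * x + κ * ρ / n - 2 * (κ * r / (2 * n)) := by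
        push_cast
        field_simp
        ring
      rw [h1, h2, h3, map_mul, Complex.conj_ofReal]
      push_cast
      ring
    rw [integral_congr_ae e, integral_const_mul, norm_mul, norm_integral_chr_mul_hermFun ℓ s hκ,
      harg, ← hA, ← hL, integral_norm_sq_of_hermite hκ (hc ρ),
      integral_norm_sq_of_hermite hκ (hc (ρ - r)), ← hA]
    have h4 := norm_mul_conj_le (c ρ) (c (ρ - r))
    have h5 : 0 ≤ A * L := mul_nonneg hA0 (abs_nonneg _)
    calc _ ≤ (‖c ρ‖ ^ 2 + ‖c (ρ - r)‖ ^ 2) / 2 * (A * L) := by gcongr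
      _ = _ := by ring
  rw [hg.fcoeff_sqCoeff hn]
  refine (norm_sum_le _ _).trans ((Finset.sum_le_sum fun (ρ : Fin n.natAbs) _ =>
    hterm ((ρ : ℕ) : ℤ)).trans (le_of_eq ?_))
  rw [← Finset.sum_div, ← Finset.mul_sum, Finset.sum_add_distrib, hg.sum_integral_partialCoeff hn]
  have h0 := hg.sum_integral_partialCoeff hn 0
  simp only [sub_zero] at h0
  rw [h0]
  ring

/-- The fourth power estimate. -/
theorem lintegral_enorm_pow_four_le (hg : Profile n g) (hn : n ≠ 0) (hκ : 0 < κ)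
    (hκ2 : κ ^ 2 = 4 * Real.pi * |(n : ℝ)|)
    (hc : ∀ m, ∀ᵐ x, partialCoeff g m x = c m * hermFun ℓ (κ * x + κ * m / n)) :
    ∫⁻ a, ∫⁻ b, ‖g a b‖ₑ ^ 4 ∂unitMeas ∂unitMeas ≤
      ENNReal.ofReal ((∑' p, laguerreTerm ℓ n p) * mass g ^ 2) := by
  obtain ⟨K, hK⟩ := hg.exists_ae_bound hn hκ hc
  have h1 : ∀ᵐ a ∂unitMeas,
      ∫⁻ b, ‖g a b‖ₑ ^ 4 ∂unitMeas = ∑' r, ‖sqCoeff g r a‖ₑ ^ 2 := by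
    filter_upwards [hK] with a ha
    have hm : MemLp (fun b => ((‖g a b‖ ^ 2 : ℝ) : ℂ)) 2 unitMeas := by
      refine MemLp.of_bound (C := K ^ 2) ?_ ?_
      · exact (Complex.measurable_ofReal.comp
          ((hg.measurable_left a).norm.pow_const 2)).aestronglyMeasurable
      · filter_upwards [ha] with b hb
        rw [Complex.norm_real, Real.norm_of_nonneg (by positivity)]
        gcongr
    unfold sqCoeff
    rw [tsum_enorm_fcoeff_sq hm]
    refine lintegral_congr fun b => ?_
    rw [enorm_sq_eq, Complex.norm_real, Real.norm_of_nonneg (by positivity), ← ofReal_norm,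
      ← ENNReal.ofReal_pow (norm_nonneg _)]
    congr 1
    ring
  have h2 : ∀ r, MemLp (sqCoeff g r) 2 unitMeas := by
    intro r
    refine MemLp.of_bound (C := K ^ 2) (hg.measurable_sqCoeff r).aestronglyMeasurable ?_
    filter_upwards [hK] with a ha
    refine (norm_fcoeff_le _ _).trans ?_
    have h3 : ∀ᵐ b ∂unitMeas, ‖‖((‖g a b‖ ^ 2 : ℝ) : ℂ)‖‖ ≤ K ^ 2 := by
      filter_upwards [ha] with b hb
      rw [norm_norm, Complex.norm_real, Real.norm_of_nonneg (by positivity)]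
      gcongr
    have h4 := norm_integral_le_of_norm_le_const h3
    rw [probReal_univ, mul_one] at h4
    exact (Real.le_norm_self _).trans h4
  have hsm := (summable_laguerreTerm_and_tsum_le ℓ hn).1
  -- Parseval in b has been applied for almost every a; after exchanging sum and integral, Parseval
  -- in a is applied to each coefficient.
  rw [lintegral_congr_ae h1, lintegral_tsum fun r =>
    ((hg.measurable_sqCoeff r).enorm.pow_const 2).aemeasurable]
  simp only [← tsum_enorm_fcoeff_sq (h2 _)]
  rw [← tsum_mul_right, ENNReal.ofReal_tsum_of_nonneg
    (fun p => mul_nonneg (laguerreTerm_nonneg _ _ _) (sq_nonneg _)) (hsm.mul_right _),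
    ENNReal.tsum_prod']
  refine ENNReal.tsum_le_tsum fun r => ENNReal.tsum_le_tsum fun s => ?_
  rw [enorm_sq_eq]
  refine ENNReal.ofReal_le_ofReal ?_
  rw [laguerreTerm, ← mul_pow]
  gcongr
  exact hg.norm_fcoeff_sqCoeff_le hn hκ hκ2 hc r s

end Hermite

end Profile

end Heis

namespace Heis

/-! ## Joint eigenfunctions of the sub-Laplacian and the centre -/

/-- Eigenvalues and the `L⁴` estimate for joint eigenfunctions. -/
theorem exists_eigenvalue_and_eLpNorm_four_le {n : ℤ} (hn : n ≠ 0) {e : ℝ} {f : L2}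
    (hcent : ∀ t, centralOp t f = chr n t • f) (he : f ∈ eigenspace e) (hf0 : f ≠ 0) :
    ∃ ℓ : ℕ, e = 2 * Real.pi * |(n : ℝ)| * (2 * (ℓ : ℝ) + 1) ∧
      eLpNorm f 4 vol ≤ ENNReal.ofReal (‖f‖ * (∑' p, laguerreTerm ℓ n p) ^ (1 / 4 : ℝ)) := by
  obtain ⟨φ, hφ, hfφ, hφc⟩ := exists_measurable_representative hcent
  set g : ℝ → ℝ → ℂ := fun a b => φ (cls a b 0) with hg
  have hP : Profile n g := profile_of_central hφ hfφ hφc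
  have hpow : ∀ p : ℕ, ∫⁻ x, ‖f x‖ₑ ^ p ∂vol = ∫⁻ a, ∫⁻ b, ‖g a b‖ₑ ^ p ∂unitMeas ∂unitMeas := by
    intro p
    rw [hg, ← lintegral_vol_of_central hφ hφc]
    exact lintegral_congr_ae (hfφ.mono fun x hx => by simp only [hx])
  have hmass : mass g = ‖f‖ ^ 2 := by
    rw [mass, ← hpow, lintegral_enorm_sq_eq, ENNReal.toReal_ofReal (by positivity)]
  have hn' : (n : ℝ) ≠ 0 := by exact_mod_cast hn
  have hpos : 0 < 4 * Real.pi * |(n : ℝ)| := by have := Real.pi_pos; positivity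
  set κ := Real.sqrt (4 * Real.pi * |(n : ℝ)|) with hκ
  have hκ0 : 0 < κ := Real.sqrt_pos.2 hpos
  have hκ2 : κ ^ 2 = 4 * Real.pi * |(n : ℝ)| := Real.sq_sqrt hpos.le
  have hdich : ∀ m, (∀ᵐ x, partialCoeff g m x = 0) ∨
      ∃ ℓ : ℕ, e = 2 * Real.pi * |(n : ℝ)| * (2 * (ℓ : ℝ) + 1) ∧
        ∃ c : ℂ, ∀ᵐ x, partialCoeff g m x = c * hermFun ℓ (κ * x + κ * m / n) := fun m =>
    exists_hermFun_of_weak_eigenfunction hn m (hP.measurable_partialCoeff m)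
      (hP.memLp_partialCoeff hn m) fun χ hχ hc =>
        integral_oscillator_mul_partialCoeff hn m hφ hfφ hφc he hχ hc
  -- If e were not of this form, all coefficients would vanish, hence the mass, contradicting f ≠ 0.
  have hex : ∃ ℓ : ℕ, e = 2 * Real.pi * |(n : ℝ)| * (2 * (ℓ : ℝ) + 1) := by
    by_contra hno
    have hz : ∀ m, ∫ x, ‖partialCoeff g m x‖ ^ 2 = 0 := by
      intro m
      rcases hdich m with h | ⟨ℓ, hℓ, -⟩
      · refine integral_eq_zero_of_ae (h.mono fun x hx => ?_)
        simp [hx]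
      · exact absurd ⟨ℓ, hℓ⟩ hno
    have h0 := hP.sum_integral_partialCoeff hn 0
    simp only [hz, Finset.sum_const_zero] at h0
    rw [hmass] at h0
    exact hf0 (norm_eq_zero.1 (pow_eq_zero_iff two_ne_zero |>.1 h0.symm))
  obtain ⟨ℓ, hℓ⟩ := hex
  -- The eigenvalue determines the degree, so the same ℓ serves for all m; vanishing coefficients
  -- take c = 0.
  have hc : ∀ m, ∃ c : ℂ, ∀ᵐ x, partialCoeff g m x = c * hermFun ℓ (κ * x + κ * m / n) := by
    intro m
    rcases hdich m with h | ⟨ℓ', hℓ', c, hc⟩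
    · exact ⟨0, h.mono fun x hx => by rw [hx, zero_mul]⟩
    · have h1 : 2 * Real.pi * |(n : ℝ)| ≠ 0 := by linarith
      have h2 : (ℓ : ℝ) = ℓ' := by
        have := mul_left_cancel₀ h1 (hℓ.symm.trans hℓ')
        linarith
      rw [Nat.cast_inj.1 h2]
      exact ⟨c, hc⟩
  choose c hc using hc
  refine ⟨ℓ, hℓ, ?_⟩
  have h4 := hP.lintegral_enorm_pow_four_le hn hκ0 hκ2 hc
  have hT : 0 ≤ ∑' p, laguerreTerm ℓ n p := tsum_nonneg (laguerreTerm_nonneg ℓ n)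
  have h5 := eLpNorm_nnreal_pow_eq_lintegral (f := f) (μ := vol) (p := 4) (by norm_num)
  simp only [NNReal.coe_ofNat, ENNReal.rpow_ofNat, ENNReal.coe_ofNat] at h5
  rw [← hpow, ← h5, hmass] at h4
  have h6 : (∑' p, laguerreTerm ℓ n p) * (‖f‖ ^ 2) ^ 2 =
      (‖f‖ * (∑' p, laguerreTerm ℓ n p) ^ (1 / 4 : ℝ)) ^ 4 := by
    rw [mul_pow, ← Real.rpow_mul_natCast hT]
    norm_num
    ring
  rw [h6, ENNReal.ofReal_pow (by positivity)] at h4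
  exact (ENNReal.pow_le_pow_left_iff (by norm_num)).1 h4

/-- The lattice sum is at most 2592 |n|(ℓ + 1) ≤ 8⁴ μ². As μ ≥ 1, raising the exponent by ε only
weakens the bound. -/
theorem rpow_quarter_tsum_laguerreTerm_le {ε : ℝ} (hε : 0 < ε) {n : ℤ} (hn : n ≠ 0) {μ : ℝ}
    (hμ : 0 ≤ μ) {ℓ : ℕ} (h : μ ^ 2 = 2 * Real.pi * |(n : ℝ)| * (2 * (ℓ : ℝ) + 1)) :
    (∑' p, laguerreTerm ℓ n p) ^ (1 / 4 : ℝ) ≤ 8 * μ ^ ((1 + ε) / 2) := by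
  have hT : 0 ≤ ∑' p, laguerreTerm ℓ n p := tsum_nonneg (laguerreTerm_nonneg ℓ n)
  have hn1 : (1 : ℝ) ≤ |(n : ℝ)| := by exact_mod_cast Int.one_le_abs hn
  have hℓ : (0 : ℝ) ≤ ℓ := ℓ.cast_nonneg
  have hX : (1 : ℝ) ≤ |(n : ℝ)| * (2 * (ℓ : ℝ) + 1) :=
    one_le_mul_of_one_le_of_one_le hn1 (by linarith)
  have hXμ : |(n : ℝ)| * (2 * (ℓ : ℝ) + 1) ≤ μ ^ 2 := by
    rw [h, mul_assoc]
    nlinarith [Real.pi_gt_three]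
  have hμ1 : 1 ≤ μ := by nlinarith
  have hle : ∑' p, laguerreTerm ℓ n p ≤ (8 * μ ^ ((1 + ε) / 2)) ^ 4 := by
    have h1 := (summable_laguerreTerm_and_tsum_le ℓ hn).2
    have h2 : |(n : ℝ)| * ((ℓ : ℝ) + 1) ≤ |(n : ℝ)| * (2 * (ℓ : ℝ) + 1) := by
      gcongr
      linarith
    have h3 : μ ^ 2 ≤ (μ ^ ((1 + ε) / 2)) ^ 4 := by
      rw [← Real.rpow_mul_natCast hμ, ← Real.rpow_natCast μ 2]
      refine Real.rpow_le_rpow_of_exponent_le hμ1 ?_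
      push_cast
      linarith
    rw [mul_pow]
    nlinarith
  calc (∑' p, laguerreTerm ℓ n p) ^ (1 / 4 : ℝ)
      ≤ ((8 * μ ^ ((1 + ε) / 2)) ^ 4) ^ (1 / 4 : ℝ) := by gcongr
    _ = 8 * μ ^ ((1 + ε) / 2) := by
      rw [← Real.rpow_natCast_mul (by positivity)]
      norm_num

end Heis

/-! ### The eigenvalue formula and the two inequalities -/

theorem proposition3p4 (ε : ℝ) (hε0 : 0 < ε) (hε1 : ε < 1) :
    ∃ C : ℝ, 0 < C ∧ ∀ (lam : ℤ) (μ : ℝ), lam ≠ 0 → 0 ≤ μ →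
      (Heis.specProj μ).comp (Heis.fourierProj lam) ≠ 0 →
      ∃ ℓ : ℕ, μ ^ 2 = 2 * Real.pi * |(lam : ℝ)| * (2 * (ℓ : ℝ) + 1) ∧
        Summable (Heis.laguerreTerm ℓ lam) ∧
        ∀ f : Heis.L2,
          eLpNorm (Heis.specProj μ (Heis.fourierProj lam f)) 4 Heis.vol ≤
              ENNReal.ofReal (‖Heis.specProj μ (Heis.fourierProj lam f)‖ *
                (∑' p : ℤ × ℤ, Heis.laguerreTerm ℓ lam p) ^ (1 / 4 : ℝ)) ∧
          ‖Heis.specProj μ (Heis.fourierProj lam f)‖ *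
                (∑' p : ℤ × ℤ, Heis.laguerreTerm ℓ lam p) ^ (1 / 4 : ℝ) ≤
              C * μ ^ ((1 + ε) / 2) * ‖Heis.specProj μ (Heis.fourierProj lam f)‖ := by
  refine ⟨8, by norm_num, fun lam μ hlam hμ hne => ?_⟩
  have main : ∀ f : Heis.L2, Heis.specProj μ (Heis.fourierProj lam f) ≠ 0 → _ := fun f hf =>
    Heis.exists_eigenvalue_and_eLpNorm_four_le hlam
      (Heis.centralOp_specProj_fourierProj μ lam f)
      (Submodule.starProjection_apply_mem (Heis.eigenspace (μ ^ 2)) _) hf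
  -- The degree ℓ has to be fixed before f, so it is read off from one nonzero image. Any other
  -- nonzero image gives the same degree, because μ² determines it.
  obtain ⟨f₀, hf₀⟩ : ∃ f, Heis.specProj μ (Heis.fourierProj lam f) ≠ 0 := by
    by_contra! h
    exact hne (ContinuousLinearMap.ext h)
  obtain ⟨ℓ, hℓ, -⟩ := main f₀ hf₀
  refine ⟨ℓ, hℓ, (Heis.summable_laguerreTerm_and_tsum_le ℓ hlam).1, fun f => ⟨?_, ?_⟩⟩
  · by_cases hf : Heis.specProj μ (Heis.fourierProj lam f) = 0
    · rw [hf, eLpNorm_congr_ae (Lp.coeFn_zero ℂ 2 Heis.vol), eLpNorm_zero]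
      exact zero_le
    · obtain ⟨ℓ', hℓ', h⟩ := main f hf
      have hlam' : (lam : ℝ) ≠ 0 := by exact_mod_cast hlam
      have h1 : 2 * Real.pi * |(lam : ℝ)| ≠ 0 :=
        mul_ne_zero (by positivity) (abs_ne_zero.2 hlam')
      have h2 : (ℓ : ℝ) = ℓ' := by
        have := mul_left_cancel₀ h1 (hℓ.symm.trans hℓ')
        linarith
      rwa [Nat.cast_inj.1 h2]
  · rw [mul_comm]
    exact mul_le_mul_of_nonneg_right
      (Heis.rpow_quarter_tsum_laguerreTerm_le hε0 hlam hμ hℓ) (norm_nonneg _)
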